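/- **Conventions.** Fix qudit dimensions $d,d'\ge 2$. A *local operator* on $n$ qudits of dimension $d$ is a sum of Hermitian terms $H=\sum_i H_i$, each given by the list of qudits it acts on and a dense matrix on those qudits with entries in $\mathbb{Q}(i)$; $n$ is written in unary, numbers in binary. A *family* $\mathcal F$ of Hamiltonians is a set of such described operators. "Polynomial" means a polynomial with coefficients in $\mathbb{N}$, and $\lambda(H)$ is the smallest eigenvalue of $H$. All norms are operator norms. **APX-SIM2.** For a family $\mathcal F$ and a polynomial $q$, the promise problem $\mathcal F\text{-APX-SIM2}_q$ has as inputs tuples $(H,A,k,\ell,a,b,\delta)$, with $H\in\mathcal F$ a $k$-local Hamiltonian and $A$ an $\ell$-local observable on the same $n$ qudits and $a,b,\delta$ rational, that are *admissible*: $d^k,d^\ell\le q(n)$ (so $k,\ell=O(\log n)$), every term of $H$ and of $A$ has norm at most $q(n)$, the whole description has length at most $q(n)$, and $b-a\ge 1/q(n)$, $\delta\ge 1/q(n)$. The input is a YES instance if every unit vector $|\psi\rangle$ with $\langle\psi|H|\psi\rangle\le\lambda(H)+\delta$ satisfies $\langle\psi|A|\psi\rangle\le a$, and a NO instance if every such $|\psi\rangle$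 satisfies $\langle\psi|A|\psi\rangle\ge b$. **Simulation.** A *local encoding* of $n$ qudits of dimension $d$ into $n'$ qudits of dimension $d'$ is a map $\mathcal E(M)=V(M\otimes P+\overline M\otimes Q)V^\dagger$. Here the $n'$ qudits are partitioned into blocks; $V=\bigotimes_i V_i$, where $V_i$ is an isometry from (at most one qudit)$\,\otimes E_i$ to the $i$-th block and each of the $n$ qudits is used by exactly one block; $P,Q$ are projectors on $E=\bigotimes_i E_i$ with $PQ=0$ and $P+Q\neq 0$; and for each $i$ there are projectors $P_{E_i},Q_{E_i}$ on $E_i$ with $P_{E_i}Q_{E_i}=0$, $PP_{E_i}=P$, $QQ_{E_i}=Q$ (extended by the identity to $E$). Let $P_{\le\Delta(H')}$ be the projector onto the span of the eigenvectors of $H'$ with eigenvalue at most $\Delta$. $H'$ is a $(\Delta,\eta,\varepsilon)$-*simulation* of $H$ with encoding $\mathcal E$ if there is an isometry $\widetilde V$ with $\|\widetilde V-V\|\le\eta$ such that $\widetilde{\mathcal E}(M)=\widetilde V(M\otimes P+\overline M\otimes Q)\widetilde V^\dagger$ satisfies $\widetilde{\mathcal E}(I)=P_{\le\Delta(H')}$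 and $\|P_{\le\Delta(H')}H'P_{\le\Delta(H')}-\widetilde{\mathcal E}(H)\|\le\varepsilon$. A family $\mathcal F$ is *efficiently simulated* by a family $\mathcal F'$ if there are a constant $K$, polynomials $p_0,p_1,p_2$ and an algorithm such that the following holds for all $H\in\mathcal F$ with description length $|H|$, all $B\in\mathbb N$ bounding the norms of the terms of $H$, and all positive integers $h,e$ and integers $\Delta\ge p_0(|H|+B)$. On input $(H,\Delta,h,e)$ the algorithm outputs, in time at most $p_1(|H|+\Delta+h+e)$, a Hamiltonian $H'\in\mathcal F'$ with terms of norm at most $p_2(|H|+B+\Delta+h+e)$ that is a $(\Delta,1/h,1/e)$-simulation of $H$ with a local encoding all of whose blocks have at most $K$ qudits; and, for each qudit of $H$, it outputs the target qudits of its block $i$, $\dim E_i$, and $V_i,P_{E_i},Q_{E_i}$ up to norm error $1/h$. Time is the cost of a program on binary trees of integers in which every elementary operation is charged the bit size of its operands and result, which is polynomially equivalent to Turing machine time. **Theorem.** Let $\mathcal F$ be efficiently simulated by $\mathcal F'$. Then for every polynomial $q$ there is a polynomial $q'$ such that $\mathcal F\text{-APX-SIM2}_q$ reduces to $\mathcal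 F'\text{-APX-SIM2}_{q'}$ by a polynomial-time many-one reduction of promise problems (YES instances are mapped to YES instances and NO instances to NO instances). Moreover, the reduction and a constant $C$ can be chosen so that every admissible input $(H,A,k,\ell,a,b,\delta)$ on $n$ qudits is mapped, in polynomial time, to an admissible input $(H',A',k',\ell',a',b',\delta')$ such that $k'$ is at most the locality of $H'$, $\ell'\le C\ell$, $$a'=a+\tfrac{b-a}{3},\qquad b'=b-\tfrac{b-a}{3},$$ and, for some $\Delta\ge q(n)$ and $0<\eta,\varepsilon\le 1/q(n)$, $H'$ is a $(\Delta,\eta,\varepsilon)$-simulation of $H$ with a local encoding $\mathcal E$ whose blocks have at most $C$ qudits, and $A'$ is obtained from $A$ term by term: the terms of $A'$ correspond to those of $A$, the term $A'_j$ acts only on qudits in the blocks of the qudits on which $A_j$ acts, and $\|A'_j\,\mathcal E(I)-\mathcal E(A_j)\|\le 1/q(n)$. -/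

import Mathlib

open scoped Matrix Kronecker Matrix.Norms.L2Operator

namespace ApxSim

/-! ### Machine model

Words are binary trees whose leaves are integers written in binary. A program is built from
elementary operations on such trees, pairing, sequencing, branching and unbounded loops. Every
elementary operation is charged the full bit size of what it reads and of what it writes
(logarithmic cost), so that polynomial cost is the same as polynomial time on a Turing machine. -/

/-- Words of the machine. -/
inductive Val : Type
  | int : ℤ → Val
  | pair : Val → Val → Val

/-- The length of a word; an integer counts with its number of binary digits. -/
def Val.size : Val → ℕ
  | .int z => z.natAbs.size + 1
  | .pair u v => u.size + v.size + 1

/-- Elementary operations. -/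
inductive Op : Type
  | ident
  | fst
  | snd
  | isPair
  | add
  | sub
  | mul
  | div
  | le

/-- The effect of an elementary operation; on words of the wrong shape the result is `0`. -/
def Op.apply : Op → Val → Val
  | .ident, v => v
  | .fst, .pair u _ => u
  | .snd, .pair _ v => v
  | .isPair, .pair _ _ => .int 1
  | .add, .pair (.int x) (.int y) => .int (x + y)
  | .sub, .pair (.int x) (.int y) => .int (x - y)
  | .mul, .pair (.int x) (.int y) => .int (x * y)
  | .div, .pair (.int x) (.int y) => .int (x / y)
  | .le, .pair (.int x) (.int y) => .int (if x ≤ y then 1 else 0)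
  | _, _ => .int 0

/-- Programs. -/
inductive Prog : Type
  | op : Op → Prog
  | const : Val → Prog
  | pair : Prog → Prog → Prog
  | seq : Prog → Prog → Prog
  | cond : Prog → Prog → Prog → Prog
  | loop : Prog → Prog → Prog

/-- `Eval p x y t`: the program `p`, started on the word `x`, halts with output `y` after a
computation of cost exactly `t`. A test succeeds when its value is not the integer `0`;
`loop c p` repeats `p` as long as the test `c` succeeds. -/
inductive Eval : Prog → Val → Val → ℕ → Prop
  | op (o : Op) (x : Val) :
      Eval (.op o) x (o.apply x) (x.size + (o.apply x).size + 1)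
  | const (v x : Val) : Eval (.const v) x v (x.size + v.size + 1)
  | pair {p q : Prog} {x y z : Val} {s t : ℕ} :
      Eval p x y s → Eval q x z t → Eval (.pair p q) x (.pair y z) (s + t + 1)
  | seq {p q : Prog} {x y z : Val} {s t : ℕ} :
      Eval p x y s → Eval q y z t → Eval (.seq p q) x z (s + t + 1)
  | cond_true {c p q : Prog} {x v y : Val} {s t : ℕ} :
      Eval c x v s → v ≠ .int 0 → Eval p x y t → Eval (.cond c p q) x y (s + t + 1)
  | cond_false {c p q : Prog} {x y : Val} {s t : ℕ} :
      Eval c x (.int 0) s → Eval q x y t → Eval (.cond c p q) x y (s + t + 1)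
  | loop_stop {c p : Prog} {x : Val} {s : ℕ} :
      Eval c x (.int 0) s → Eval (.loop c p) x x (s + 1)
  | loop_step {c p : Prog} {x v y z : Val} {s t u : ℕ} :
      Eval c x v s → v ≠ .int 0 → Eval p x y t → Eval (.loop c p) y z u →
        Eval (.loop c p) x z (s + t + u + 1)

/-- `p` started on `x` halts with output `y` within time `T`. -/
def Prog.Computes (p : Prog) (x y : Val) (T : ℕ) : Prop := ∃ t ≤ T, Eval p x y t

/-- A promise problem: yes-words and no-words. -/
structure PromiseProblem where
  yes : Set Val
  no : Set Val

/-- `p` is a polynomial-time many-one reduction from `A` to `B`: on each word satisfying the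
promise of `A` it halts in time polynomial in the length of the word, and it maps yes-words to
yes-words and no-words to no-words. -/
def IsPolyTimeReduction (p : Prog) (A B : PromiseProblem) : Prop :=
  ∃ time : Polynomial ℕ,
    (∀ v ∈ A.yes, ∃ w ∈ B.yes, p.Computes v w (time.eval v.size)) ∧
    (∀ v ∈ A.no, ∃ w ∈ B.no, p.Computes v w (time.eval v.size))

/-! ### Encodings of finite data as words -/

def encNat (m : ℕ) : Val := .int m

def encList : List Val → Val
  | [] => .int 0
  | v :: l => .pair v (encList l)

def encUnary (m : ℕ) : Val := encList (List.replicate m (.int 0))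

/-! ### Finitely described numbers, matrices and local operators -/

/-- A rational number given by a fraction, not necessarily in lowest terms. -/
structure Frac where
  num : ℤ
  den : ℕ
  den_pos : 0 < den

noncomputable def Frac.val (x : Frac) : ℝ := (x.num : ℝ) / (x.den : ℝ)

def Frac.enc (x : Frac) : Val := .pair (.int x.num) (encNat x.den)

/-- A matrix with entries in `ℚ(i)`: numerators (real and imaginary part) over a common
denominator. -/
structure GMat (R C : ℕ) where
  num : Fin R → Fin C → ℤ × ℤ
  den : ℕ
  den_pos : 0 < den

noncomputable def GMat.toMatrix {R C : ℕ} (M : GMat R C) : Matrix (Fin R) (Fin C) ℂ :=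
  Matrix.of fun r c =>
    (((M.num r c).1 : ℂ) + ((M.num r c).2 : ℂ) * Complex.I) / (M.den : ℂ)

/-- Entry at a position given by natural numbers, `0` outside the range. -/
noncomputable def GMat.entry {R C : ℕ} (M : GMat R C) (r c : ℕ) : ℂ :=
  if h : r < R ∧ c < C then M.toMatrix ⟨r, h.1⟩ ⟨c, h.2⟩ else 0

def GMat.enc {R C : ℕ} (M : GMat R C) : Val :=
  .pair (encNat M.den) (encList (List.ofFn fun r =>
    encList (List.ofFn fun c => .pair (.int (M.num r c).1) (.int (M.num r c).2))))

/-- Operators on `n` qudits of dimension `d`, in the computational basis `Fin n → Fin d`. -/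
abbrev QOp (d n : ℕ) : Type := Matrix (Fin n → Fin d) (Fin n → Fin d) ℂ

/-- A local term on `n` qudits of dimension `d`: the list of qudits that it acts on and a
Hermitian matrix on those qudits (whose basis states, digit strings, are
numbered by `finFunctionFinEquiv`). -/
structure LocalTerm (d n : ℕ) where
  supp : List (Fin n)
  nodup : supp.Nodup
  mat : GMat (d ^ supp.length) (d ^ supp.length)
  herm : mat.toMatrix.IsHermitian

/-- The operator of a local term: its matrix on the support, tensored with the identity. -/
noncomputable def LocalTerm.op {d n : ℕ} (t : LocalTerm d n) : QOp d n :=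
  Matrix.of fun x y =>
    if ∀ i, i ∉ t.supp → x i = y i then
      t.mat.toMatrix (finFunctionFinEquiv fun r => x (t.supp.get r))
        (finFunctionFinEquiv fun r => y (t.supp.get r))
    else 0

def LocalTerm.enc {d n : ℕ} (t : LocalTerm d n) : Val :=
  .pair (encList (t.supp.map fun i => encNat i)) t.mat.enc

/-- A sum of local terms on `n` qudits of dimension `d` (a local Hamiltonian or observable). -/
structure LocalOp (d n : ℕ) where
  terms : List (LocalTerm d n)

noncomputable def LocalOp.op {d n : ℕ} (H : LocalOp d n) : QOp d n :=
  (H.terms.map LocalTerm.op).sum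

/-- Each term acts on at most `k` qudits. -/
def LocalOp.IsLocal {d n : ℕ} (H : LocalOp d n) (k : ℕ) : Prop :=
  ∀ t ∈ H.terms, t.supp.length ≤ k

/-- Each term has operator norm at most `B`. -/
def LocalOp.TermBound {d n : ℕ} (H : LocalOp d n) (B : ℝ) : Prop :=
  ∀ t ∈ H.terms, ‖t.op‖ ≤ B

/-- The number of qudits is written in unary. -/
def LocalOp.enc {d n : ℕ} (H : LocalOp d n) : Val :=
  .pair (encUnary n) (encList (H.terms.map LocalTerm.enc))

theorem LocalTerm.op_isHermitian {d n : ℕ} (t : LocalTerm d n) : t.op.IsHermitian := by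
  ext x y
  simp only [Matrix.conjTranspose_apply, LocalTerm.op, Matrix.of_apply]
  by_cases h : ∀ i, i ∉ t.supp → x i = y i
  · have h' : ∀ i, i ∉ t.supp → y i = x i := fun i hi => (h i hi).symm
    rw [if_pos h, if_pos h']
    exact t.herm.apply _ _
  · have h' : ¬ ∀ i, i ∉ t.supp → y i = x i := fun g => h fun i hi => (g i hi).symm
    rw [if_neg h, if_neg h', star_zero]

theorem LocalOp.op_isHermitian {d n : ℕ} (H : LocalOp d n) : H.op.IsHermitian := by
  obtain ⟨l⟩ := H
  induction l with
  | nil => simp [LocalOp.op]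
  | cons t l ih =>
    have h : (LocalOp.mk (t :: l)).op = t.op + (LocalOp.mk l).op := by simp [LocalOp.op]
    rw [h]
    exact t.op_isHermitian.add ih

/-- A family of Hamiltonians on qudits of dimension `d`. -/
abbrev HamFamily (d : ℕ) : Type := ∀ n : ℕ, Set (LocalOp d n)

/-! ### The problem APX-SIM2 -/

/-- The expectation value `⟨ψ|M|ψ⟩` (a real number for Hermitian `M`). -/
noncomputable def expect {d n : ℕ} (M : QOp d n) (ψ : (Fin n → Fin d) → ℂ) : ℝ :=
  (star ψ ⬝ᵥ (M *ᵥ ψ)).re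

def IsState {d n : ℕ} (ψ : (Fin n → Fin d) → ℂ) : Prop := star ψ ⬝ᵥ ψ = 1

/-- The smallest eigenvalue of a Hermitian operator. -/
noncomputable def groundEnergy {d n : ℕ} (M : QOp d n) : ℝ := sInf (spectrum ℝ M)

/-- An input `(H, A, k, ℓ, a, b, δ)`. -/
structure Inst (d : ℕ) where
  n : ℕ
  H : LocalOp d n
  A : LocalOp d n
  k : ℕ
  l : ℕ
  a : Frac
  b : Frac
  δ : Frac

def Inst.enc {d : ℕ} (x : Inst d) : Val :=
  encList [x.H.enc, x.A.enc, encNat x.k, encNat x.l, x.a.enc, x.b.enc, x.δ.enc]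

/-- `|ψ⟩` is a state with `⟨ψ|H|ψ⟩ ≤ λ(H) + δ`. -/
def Inst.LowEnergy {d : ℕ} (x : Inst d) (ψ : (Fin x.n → Fin d) → ℂ) : Prop :=
  IsState ψ ∧ expect x.H.op ψ ≤ groundEnergy x.H.op + x.δ.val

/-- The requirements on an input, with all "polynomial in the number `n` of qudits" bounds given
by the polynomial `q`: the Hamiltonian is from the family, `H` is `k`-local and `A` is `ℓ`-local
with `k, ℓ = O(log n)`, the local terms have polynomially bounded norm, the description (in
particular the number of terms) has polynomial length, and `b - a` and `δ` are at least inverse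
polynomial. -/
structure Inst.Admissible {d : ℕ} (F : HamFamily d) (q : Polynomial ℕ) (x : Inst d) : Prop where
  mem : x.H ∈ F x.n
  H_local : x.H.IsLocal x.k
  A_local : x.A.IsLocal x.l
  k_log : d ^ x.k ≤ q.eval x.n
  l_log : d ^ x.l ≤ q.eval x.n
  H_norm : x.H.TermBound (q.eval x.n : ℕ)
  A_norm : x.A.TermBound (q.eval x.n : ℕ)
  size_le : x.enc.size ≤ q.eval x.n
  gap : 1 ≤ ((q.eval x.n : ℕ) : ℝ) * (x.b.val - x.a.val)
  δ_ge : 1 ≤ ((q.eval x.n : ℕ) : ℝ) * x.δ.val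

/-- APX-SIM2 restricted to Hamiltonians from `F`, with polynomial bounds given by `q`. -/
def apxSim2 {d : ℕ} (F : HamFamily d) (q : Polynomial ℕ) : PromiseProblem where
  yes := {v | ∃ x : Inst d, v = x.enc ∧ x.Admissible F q ∧
    ∀ ψ, x.LowEnergy ψ → expect x.A.op ψ ≤ x.a.val}
  no := {v | ∃ x : Inst d, v = x.enc ∧ x.Admissible F q ∧
    ∀ ψ, x.LowEnergy ψ → x.b.val ≤ expect x.A.op ψ}

/-! ### Local encodings and simulation -/

/-- The projector onto the span of the eigenvectors of `M` with eigenvalue at most `Δ`. -/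
noncomputable def lowProj {d n : ℕ} {M : QOp d n} (hM : M.IsHermitian) (Δ : ℝ) : QOp d n :=
  (hM.eigenvectorUnitary : QOp d n) *
    Matrix.diagonal (fun i => if hM.eigenvalues i ≤ Δ then (1 : ℂ) else 0) *
    (hM.eigenvectorUnitary : QOp d n)ᴴ

/-- `M ↦ V (M ⊗ P + M̄ ⊗ Q) V†`. -/
def encodeWith {d n d' n' : ℕ} {E : Type} [Fintype E]
    (V : Matrix (Fin n' → Fin d') ((Fin n → Fin d) × E) ℂ) (P Q : Matrix E E ℂ)
    (M : QOp d n) : QOp d' n' :=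
  V * (M ⊗ₖ P + M.map (starRingEnd ℂ) ⊗ₖ Q) * Vᴴ

/-- Input dimension of a block: `d` for a block that encodes a qudit, `1` for a block of ancillas. -/
abbrev inDim (d : ℕ) {n m : ℕ} : Fin n ⊕ Fin m → ℕ
  | .inl _ => d
  | .inr _ => 1

/-- The part of a basis state that enters a block. -/
def localIn {d n m : ℕ} (x : Fin n → Fin d) : ∀ i : Fin n ⊕ Fin m, Fin (inDim d i)
  | .inl j => x j
  | .inr _ => (0 : Fin 1)

/-- An operator on `⨂ i, E i` acting as `M` on the factor `i` and as the identity elsewhere. -/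
def onSite {ι : Type} [Fintype ι] [DecidableEq ι] {e : ι → ℕ} (i : ι)
    (M : Matrix (Fin (e i)) (Fin (e i)) ℂ) :
    Matrix (∀ i, Fin (e i)) (∀ i, Fin (e i)) ℂ :=
  Matrix.of fun z z' => if ∀ j, j ≠ i → z j = z' j then M (z i) (z' i) else 0

/-- A local encoding of `n` qudits of dimension `d` into `n'` qudits of dimension `d'`.
The `n'` qudits are partitioned into blocks; the block `inl j` encodes qudit `j`, and each of the
`anc` blocks `inr i` encodes no qudit. The block `i` has an ancilla space `E i` of dimension
`dimE i` and an isometry `V i` from (at most one qudit) `⊗ E i` to its target qudits. `P` and `Q`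
are projectors on `E = ⨂ i, E i`, orthogonal to each other and not both zero, `PE i` and `QE i`
orthogonal projectors on `E i` with `P (PE i ⊗ 1) = P` and `Q (QE i ⊗ 1) = Q`. -/
structure LocalEncoding (d n d' n' : ℕ) where
  anc : ℕ
  tgt : Fin n ⊕ Fin anc → List (Fin n')
  tgt_nodup : ∀ i, (tgt i).Nodup
  tgt_partition : ∀ w : Fin n', ∃! i, w ∈ tgt i
  dimE : Fin n ⊕ Fin anc → ℕ
  V : ∀ i, Matrix (Fin (tgt i).length → Fin d') (Fin (inDim d i) × Fin (dimE i)) ℂ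
  V_isometry : ∀ i, (V i)ᴴ * V i = 1
  P : Matrix (∀ i, Fin (dimE i)) (∀ i, Fin (dimE i)) ℂ
  Q : Matrix (∀ i, Fin (dimE i)) (∀ i, Fin (dimE i)) ℂ
  P_proj : IsStarProjection P
  Q_proj : IsStarProjection Q
  PQ : P * Q = 0
  nonzero : P + Q ≠ 0
  PE : ∀ i, Matrix (Fin (dimE i)) (Fin (dimE i)) ℂ
  QE : ∀ i, Matrix (Fin (dimE i)) (Fin (dimE i)) ℂ
  PE_proj : ∀ i, IsStarProjection (PE i)
  QE_proj : ∀ i, IsStarProjection (QE i)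
  PE_QE : ∀ i, PE i * QE i = 0
  P_PE : ∀ i, P * onSite i (PE i) = P
  Q_QE : ∀ i, Q * onSite i (QE i) = Q

namespace LocalEncoding

variable {d n d' n' : ℕ} (L : LocalEncoding d n d' n')

/-- The global isometry `V = ⨂ i, V i`. -/
noncomputable def isom :
    Matrix (Fin n' → Fin d') ((Fin n → Fin d) × (∀ i, Fin (L.dimE i))) ℂ :=
  Matrix.of fun y xz => ∏ i, L.V i (fun r => y ((L.tgt i).get r)) (localIn xz.1 i, xz.2 i)

/-- The encoding `M ↦ V (M ⊗ P + M̄ ⊗ Q) V†`. -/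
noncomputable def encode (M : QOp d n) : QOp d' n' := encodeWith L.isom L.P L.Q M

/-- Every block has at most `K` target qudits. -/
def BlocksLe (K : ℕ) : Prop := ∀ i, (L.tgt i).length ≤ K

/-- `H'` is a `(Δ, η, ε)`-simulation of `H` with the local encoding `L`. -/
def IsSimulation (Δ η ε : ℝ) (H : LocalOp d n) (H' : LocalOp d' n') : Prop :=
  ∃ W : Matrix (Fin n' → Fin d') ((Fin n → Fin d) × (∀ i, Fin (L.dimE i))) ℂ,
    Wᴴ * W = 1 ∧ ‖W - L.isom‖ ≤ η ∧
    encodeWith W L.P L.Q (1 : QOp d n) = lowProj H'.op_isHermitian Δ ∧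
    ‖lowProj H'.op_isHermitian Δ * H'.op * lowProj H'.op_isHermitian Δ -
      encodeWith W L.P L.Q H.op‖ ≤ ε

end LocalEncoding

/-- A finite description of the part of a local encoding that belongs to one encoded qudit. -/
structure BlockData (d d' n' : ℕ) where
  tgt : List (Fin n')
  dimE : ℕ
  V : GMat (d' ^ tgt.length) (d * dimE)
  PE : GMat dimE dimE
  QE : GMat dimE dimE

def BlockData.enc {d d' n' : ℕ} (B : BlockData d d' n') : Val :=
  encList [encList (B.tgt.map fun w => encNat w), encNat B.dimE, B.V.enc, B.PE.enc, B.QE.enc]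

/-- The output of a simulation algorithm: the simulating Hamiltonian and, for each encoded
qudit, a description of its block. -/
structure SimOutput (d n d' : ℕ) where
  n' : ℕ
  H' : LocalOp d' n'
  block : Fin n → BlockData d d' n'

def SimOutput.enc {d n d' : ℕ} (o : SimOutput d n d') : Val :=
  .pair o.H'.enc (encList (List.ofFn fun j => (o.block j).enc))

/-- The output describes the blocks of the encoding `L`, its matrices up to an error of `η`. -/
def SimOutput.Describes {d n d' : ℕ} (o : SimOutput d n d') (L : LocalEncoding d n d' o.n')
    (η : ℝ) : Prop :=
  ∀ j : Fin n,
    L.tgt (.inl j) = (o.block j).tgt ∧ L.dimE (.inl j) = (o.block j).dimE ∧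
    ‖L.V (.inl j) - Matrix.of (fun y c =>
      (o.block j).V.entry (finFunctionFinEquiv y) (finProdFinEquiv c))‖ ≤ η ∧
    ‖L.PE (.inl j) - Matrix.of (fun z z' : Fin _ => (o.block j).PE.entry z.val z'.val)‖ ≤ η ∧
    ‖L.QE (.inl j) - Matrix.of (fun z z' : Fin _ => (o.block j).QE.entry z.val z'.val)‖ ≤ η

/-- The family `F` is efficiently simulated by the family `F'`: there is a program which, given
`H ∈ F` and positive integers `Δ`, `h`, `e` with `Δ` above a threshold that is polynomial in the
length of `H` and the norm of its terms, produces in time polynomial in the length of `H` and in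
`Δ`, `h`, `e` a Hamiltonian `H' ∈ F'` with polynomially bounded terms that is a
`(Δ, 1/h, 1/e)`-simulation of `H`, together with the local isometries and projectors of the
encoding, up to an error of `1/h`; all blocks of the encoding consist of `O(1)` qudits. -/
def EfficientlySimulatedBy {d d' : ℕ} (F : HamFamily d) (F' : HamFamily d') : Prop :=
  ∃ (S : Prog) (time threshold strength : Polynomial ℕ) (K : ℕ),
    ∀ (n : ℕ), ∀ H ∈ F n, ∀ (B Δ h e : ℕ), H.TermBound B → 0 < h → 0 < e →
      threshold.eval (H.enc.size + B) ≤ Δ →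
      ∃ (o : SimOutput d n d') (L : LocalEncoding d n d' o.n'),
        S.Computes (encList [H.enc, encNat Δ, encNat h, encNat e]) o.enc
          (time.eval (H.enc.size + Δ + h + e)) ∧
        o.H' ∈ F' o.n' ∧
        o.H'.TermBound (strength.eval (H.enc.size + B + Δ + h + e) : ℕ) ∧
        L.BlocksLe K ∧
        o.Describes L (1 / (h : ℝ)) ∧
        L.IsSimulation Δ (1 / (h : ℝ)) (1 / (e : ℝ)) H o.H'

end ApxSim

open ApxSim

/-!
Fix an admissible input on `n` qudits and write `N = q(n)`. The reduction runs the given simulation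
algorithm with `Δ = h = e = W` for a polynomial `W = w(n)` (`precision`), keeps the simulating
Hamiltonian `H'`, and replaces each term `A_j` of the observable by an approximation of
`V (A_j ⊗ (⨂ P_{E_i}) + Ā_j ⊗ (⨂ Q_{E_i})) V†` on the blocks of the qudits on which `A_j` acts
(`outTerm`), computed from the description of those blocks and made Hermitian. The thresholds
become `a + (b - a)/3` and `b - (b - a)/3`, and the new energy tolerance is `1/W²`.

*The observable.* The global isometry is a tensor product over the blocks, so an operator that
acts on a few blocks only can be moved past it block by block
(`LocalEncoding.blockTensor_mul_isom`). As `P` and `Q` are fixed by the local projectors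
`P_{E_i}` and `Q_{E_i}`, the ideal local operator, multiplied by `𝓔(1)`, is exactly the encoding
of the term (`LocalEncoding.ideal_mul_encode_one`). If the term acts on no qudit there is no local
projector that tells `P` from `Q`; such a term is a real multiple of the identity, and only a
factor `2` has to be removed (`emptyFactor`). Since terms act on `O(log n)` qudits and blocks have
bounded size, all matrices involved have polynomial size, and estimating entries and row sums
suffices: the total error is a polynomial in `N` times `1/W` (`outTerm_bounds`,
`outObs_encodeWith_le`).

*The energies.* If `A` has expectation at most `a` in all states of energy at most `λ(H) + δ`,
then the operator inequality `A ≤ a + (2‖A‖/δ) (H - λ(H))` holds (`dominated_of_lowEnergy`).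
Encodings are positive maps, so the inequality passes to the encoded operators. A state of energy
at most `λ(H') + 1/W²` has weight at most `1/W²` outside the low-energy space, and `λ(H')` exceeds
`λ(H)` by at most the error of the simulation; hence its encoded excess energy is small, and so is
the difference between the expectations of `A'` and of the encoding of `A`
(`expect_le_of_simulation`). NO instances are treated by passing to `-A`. Once `W` dominates a
power of `N`, all errors together are below `1/(3N) ≤ (b - a)/3` (`error_le`).

*Running time.* `PolyTime f` says that `f` is computed by a program of polynomial cost on the
words of its arguments; this class is closed under composition, branching, folds with polynomially
growing state, and arithmetic. The transformation of an instance is described on plain lists of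
numbers (`rawOut`), where its polynomial cost is read off from these closure properties, and
`outInst_raw` identifies it with the transformation of the mathematical objects. As each block is
nonempty, the new system has at least `n` qudits (`LocalEncoding.le_card`), so that bounds
polynomial in `n` are also polynomial in the new number of qudits.
-/

namespace ApxSim

/-! ### Polynomially bounded functions and polynomial-time functions -/

theorem eval_mono (P : Polynomial ℕ) {a b : ℕ} (h : a ≤ b) : P.eval a ≤ P.eval b := by
  rw [Polynomial.eval_eq_sum, Polynomial.eval_eq_sum]
  exact Finset.sum_le_sum fun i _ => Nat.mul_le_mul_left _ (Nat.pow_le_pow_left h i)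

theorem Val.one_le_size (v : Val) : 1 ≤ v.size := by
  cases v <;> simp only [Val.size] <;> omega

/-- The cost of a computation is at least the length of its input and of its output. -/
theorem Eval.size_le {p : Prog} {x y : Val} {t : ℕ} (h : Eval p x y t) :
    x.size ≤ t ∧ y.size ≤ t := by
  induction h <;> first | omega | (simp only [Val.size] at *; omega)

/-- A type whose elements are written as words. -/
class Word (α : Type) where
  enc : α → Val

/-- The length of the word of an element. -/
def sz {α : Type} [Word α] (a : α) : ℕ := (Word.enc a).size

instance : Word Unit := ⟨fun _ => .int 0⟩
instance : Word ℤ := ⟨.int⟩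
instance : Word ℕ := ⟨encNat⟩
instance : Word Bool := ⟨fun b => .int (if b then 1 else 0)⟩
instance {α β : Type} [Word α] [Word β] : Word (α × β) := ⟨fun p => .pair (Word.enc p.1) (Word.enc p.2)⟩
instance {α : Type} [Word α] : Word (List α) := ⟨fun l => encList (l.map Word.enc)⟩
instance {α : Type} [Word α] (p : α → Prop) : Word {a // p a} := ⟨fun a => Word.enc a.1⟩

section
variable {α β γ σ : Type} [Word α] [Word β] [Word γ] [Word σ]

theorem one_le_sz (a : α) : 1 ≤ sz a := Val.one_le_size _

@[simp] theorem sz_pair (a : α) (b : β) : sz (a, b) = sz a + sz b + 1 := rfl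

@[simp] theorem sz_nil : sz ([] : List α) = 1 := rfl

@[simp] theorem sz_cons (a : α) (l : List α) : sz (a :: l) = sz a + sz l + 1 := rfl

theorem sz_int (z : ℤ) : sz z = z.natAbs.size + 1 := rfl

theorem sz_nat (m : ℕ) : sz m = m.size + 1 := rfl

theorem sz_bool_le (b : Bool) : sz b ≤ 2 := by cases b <;> decide

@[simp] theorem sz_append (l₁ l₂ : List α) : sz (l₁ ++ l₂) + 1 = sz l₁ + sz l₂ := by
  induction l₁ with
  | nil => simp; omega
  | cons a l ih => simp only [List.cons_append, sz_cons]; omega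

theorem length_lt_sz (l : List α) : l.length < sz l := by
  induction l with
  | nil => simp
  | cons a l ih => simp only [List.length_cons, sz_cons]; have := one_le_sz a; omega

theorem sz_lt_of_mem {l : List α} {a : α} (h : a ∈ l) : sz a < sz l := by
  induction l with
  | nil => simp at h
  | cons b l ih =>
    rcases List.mem_cons.1 h with rfl | h
    · simp only [sz_cons]; omega
    · have := ih h; simp only [sz_cons]; omega

theorem sz_le_of_forall {l : List α} {M : ℕ} (h : ∀ a ∈ l, sz a ≤ M) :
    sz l ≤ l.length * (M + 1) + 1 := by
  induction l with
  | nil => simp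
  | cons b l ih =>
    have h1 := h b (by simp)
    have h2 := ih fun a ha => h a (by simp [ha])
    simp only [sz_cons, List.length_cons, add_mul]; omega

/-- `g` is bounded by a polynomial in the length of its argument. -/
def PolyBdd (g : α → ℕ) : Prop := ∃ T : Polynomial ℕ, ∀ a, g a ≤ T.eval (sz a)

theorem PolyBdd.mono {f g : α → ℕ} (hg : PolyBdd g) (h : ∀ a, f a ≤ g a) : PolyBdd f :=
  let ⟨T, hT⟩ := hg
  ⟨T, fun a => (h a).trans (hT a)⟩

theorem PolyBdd.const (c : ℕ) : PolyBdd (fun _ : α => c) := ⟨Polynomial.C c, fun _ => by simp⟩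

theorem PolyBdd.sz : PolyBdd (fun a : α => sz a) := ⟨Polynomial.X, fun a => by simp⟩

theorem PolyBdd.add {f g : α → ℕ} (hf : PolyBdd f) (hg : PolyBdd g) :
    PolyBdd (fun a => f a + g a) :=
  let ⟨T, hT⟩ := hf
  let ⟨U, hU⟩ := hg
  ⟨T + U, fun a => by rw [Polynomial.eval_add]; exact add_le_add (hT a) (hU a)⟩

theorem PolyBdd.mul {f g : α → ℕ} (hf : PolyBdd f) (hg : PolyBdd g) :
    PolyBdd (fun a => f a * g a) :=
  let ⟨T, hT⟩ := hf
  let ⟨U, hU⟩ := hg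
  ⟨T * U, fun a => by rw [Polynomial.eval_mul]; exact Nat.mul_le_mul (hT a) (hU a)⟩

theorem PolyBdd.eval {f : α → ℕ} (hf : PolyBdd f) (P : Polynomial ℕ) :
    PolyBdd (fun a => P.eval (f a)) :=
  let ⟨T, hT⟩ := hf
  ⟨P.comp T, fun a => by rw [Polynomial.eval_comp]; exact eval_mono P (hT a)⟩

theorem PolyBdd.pow {f : α → ℕ} (hf : PolyBdd f) (m : ℕ) : PolyBdd (fun a => f a ^ m) :=
  (hf.eval (Polynomial.X ^ m)).mono fun a => by simp

/-- `f` is computed by a program in polynomial time. -/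
def PolyTime (f : α → β) : Prop :=
  ∃ (p : Prog) (g : α → ℕ), PolyBdd g ∧ ∀ a, p.Computes (Word.enc a) (Word.enc (f a)) (g a)

theorem PolyTime.sz_bdd {f : α → β} (hf : PolyTime f) : PolyBdd (fun a => ApxSim.sz (f a)) := by
  obtain ⟨p, g, hg, h⟩ := hf
  refine hg.mono fun a => ?_
  obtain ⟨t, ht, he⟩ := h a
  exact he.size_le.2.trans ht

theorem PolyTime.congr {f g : α → β} (hf : PolyTime f) (h : ∀ a, f a = g a) : PolyTime g := by
  rwa [← funext h]

/-- Polynomial-time computability depends only on the words of arguments and values. -/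
theorem PolyTime.transport {α' β' : Type} [Word α'] [Word β'] {f : α → β} (hf : PolyTime f)
    (i : α' → α) (hi : ∀ a, Word.enc (i a) = Word.enc a) {g : α' → β'}
    (h : ∀ a, Word.enc (g a) = Word.enc (f (i a))) : PolyTime g := by
  obtain ⟨p, b, ⟨T, hT⟩, hp⟩ := hf
  refine ⟨p, fun a => b (i a), ⟨T, fun a => ?_⟩, fun a => ?_⟩
  · have := hT (i a)
    unfold ApxSim.sz at *
    rwa [hi] at this
  · have := hp (i a)
    rwa [hi, ← h] at this

theorem PolyTime.op (o : Op) {f : α → β} (h : ∀ a, o.apply (Word.enc a) = Word.enc (f a))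
    (hb : PolyBdd (fun a => ApxSim.sz (f a))) : PolyTime f :=
  ⟨.op o, fun a => ApxSim.sz a + ApxSim.sz (f a) + 1, (PolyBdd.sz.add hb).add (.const 1),
    fun a => ⟨_, le_rfl, by
      have := Eval.op o (Word.enc a)
      rwa [h] at this⟩⟩

/-- A function that does not change the word is computed by the program that does nothing. -/
theorem PolyTime.recode {f : α → β} (h : ∀ a, Word.enc a = Word.enc (f a)) : PolyTime f :=
  .op .ident h (PolyBdd.sz.mono fun a => by unfold ApxSim.sz; rw [h])

theorem PolyTime.id : PolyTime (fun a : α => a) := .recode fun _ => rfl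

theorem PolyTime.const (b : β) : PolyTime (fun _ : α => b) :=
  ⟨.const (Word.enc b), fun a => ApxSim.sz a + ApxSim.sz b + 1,
    (PolyBdd.sz.add (.const _)).add (.const 1), fun _ => ⟨_, le_rfl, Eval.const _ _⟩⟩

theorem PolyTime.comp {g : β → γ} {f : α → β} (hg : PolyTime g) (hf : PolyTime f) :
    PolyTime (fun a => g (f a)) := by
  have hs := hf.sz_bdd
  obtain ⟨p, bf, hbf, hp⟩ := hf
  obtain ⟨r, bg, ⟨T, hT⟩, hr⟩ := hg
  refine ⟨.seq p r, fun a => bf a + T.eval (ApxSim.sz (f a)) + 1,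
    (hbf.add (hs.eval T)).add (.const 1), fun a => ?_⟩
  obtain ⟨t, ht, he⟩ := hp a
  obtain ⟨u, hu, he'⟩ := hr (f a)
  refine ⟨_, ?_, Eval.seq he he'⟩
  have := hT (f a)
  beta_reduce
  omega

theorem PolyTime.pair {f : α → β} {g : α → γ} (hf : PolyTime f) (hg : PolyTime g) :
    PolyTime (fun a => (f a, g a)) := by
  obtain ⟨p, bf, hbf, hp⟩ := hf
  obtain ⟨r, bg, hbg, hr⟩ := hg
  refine ⟨.pair p r, fun a => bf a + bg a + 1, (hbf.add hbg).add (.const 1), fun a => ?_⟩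
  obtain ⟨t, ht, he⟩ := hp a
  obtain ⟨u, hu, he'⟩ := hr a
  refine ⟨_, ?_, Eval.pair he he'⟩
  beta_reduce
  omega

theorem PolyTime.fst' : PolyTime (fun p : α × β => p.1) :=
  .op .fst (fun _ => rfl) (PolyBdd.sz.mono fun a => by rw [sz_pair]; omega)

theorem PolyTime.snd' : PolyTime (fun p : α × β => p.2) :=
  .op .snd (fun _ => rfl) (PolyBdd.sz.mono fun a => by rw [sz_pair]; omega)

theorem PolyTime.fst {f : α → β × γ} (hf : PolyTime f) : PolyTime (fun a => (f a).1) :=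
  PolyTime.fst'.comp hf

theorem PolyTime.snd {f : α → β × γ} (hf : PolyTime f) : PolyTime (fun a => (f a).2) :=
  PolyTime.snd'.comp hf

theorem PolyTime.ite {c : α → Prop} [DecidablePred c] {f g : α → β}
    (hc : PolyTime (fun a => decide (c a))) (hf : PolyTime f) (hg : PolyTime g) :
    PolyTime (fun a => if c a then f a else g a) := by
  obtain ⟨q, bc, hbc, hq⟩ := hc
  obtain ⟨p, bf, hbf, hp⟩ := hf
  obtain ⟨r, bg, hbg, hr⟩ := hg
  refine ⟨.cond q p r, fun a => bc a + (bf a + bg a) + 1, (hbc.add (hbf.add hbg)).add (.const 1),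
    fun a => ?_⟩
  obtain ⟨s, hs, hes⟩ := hq a
  beta_reduce
  by_cases h : c a
  · obtain ⟨t, ht, he⟩ := hp a
    rw [if_pos h]
    refine ⟨_, by omega, Eval.cond_true hes ?_ he⟩
    simp [Word.enc, h]
  · obtain ⟨t, ht, he⟩ := hr a
    rw [if_neg h]
    refine ⟨s + t + 1, by omega, Eval.cond_false ?_ he⟩
    simpa [Word.enc, h] using hes

theorem PolyTime.cons {f : α → β} {g : α → List β} (hf : PolyTime f) (hg : PolyTime g) :
    PolyTime (fun a => f a :: g a) :=
  (hf.pair hg).transport _ (fun _ => rfl) fun _ => rfl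

/-- Case distinction on a list. -/
theorem PolyTime.listCase {l : α → List β} {f : α → γ} {g : α → β → List β → γ}
    (hl : PolyTime l) (hf : PolyTime f)
    (hg : PolyTime (fun p : α × β × List β => g p.1 p.2.1 p.2.2)) :
    PolyTime (fun a => match l a with | [] => f a | b :: t => g a b t) := by
  have hs := hl.sz_bdd
  obtain ⟨pl, bl, hbl, hpl⟩ := hl
  obtain ⟨pf, bf, hbf, hpf⟩ := hf
  obtain ⟨pg, bg, ⟨T, hT⟩, hpg⟩ := hg
  refine ⟨.cond (.seq pl (.op .isPair)) (.seq (.pair (.op .ident) pl) pg) pf,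
    fun a => (bl a + (ApxSim.sz (l a) + 2 + 1) + 1) +
      ((ApxSim.sz a + ApxSim.sz a + 1) + bl a + 1 + T.eval (ApxSim.sz a + ApxSim.sz (l a) + 1) + 1
        + bf a) + 1, ?_, fun a => ?_⟩
  · exact ((((hbl.add ((hs.add (.const 2)).add (.const 1))).add (.const 1)).add
      ((((((PolyBdd.sz.add .sz).add (.const 1)).add hbl).add (.const 1)).add
        (((PolyBdd.sz.add hs).add (.const 1)).eval T)).add (.const 1) |>.add hbf)).add (.const 1))
  · obtain ⟨s, hs, hes⟩ := hpl a
    beta_reduce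
    cases hla : l a with
    | nil =>
      rw [hla] at hes
      obtain ⟨t, ht, he⟩ := hpf a
      refine ⟨_, ?_, Eval.cond_false (Eval.seq hes (Eval.op .isPair _)) he⟩
      have h1 : (Word.enc ([] : List β)).size = 1 := rfl
      have h2 : (Op.isPair.apply (Word.enc ([] : List β))).size = 1 := rfl
      simp only [h1, h2, sz_nil]
      omega
    | cons b r =>
      rw [hla] at hes
      obtain ⟨t, ht, he⟩ := hpg (a, b, r)
      have h0 := hT (a, b, r)
      refine ⟨_, ?_, Eval.cond_true (Eval.seq hes (Eval.op .isPair _)) (by simp [Word.enc, encList, Op.apply])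
        (Eval.seq (Eval.pair (Eval.op .ident _) hes) he)⟩
      have h1 : (Word.enc (b :: r)).size = ApxSim.sz (b :: r) := rfl
      have h2 : (Op.isPair.apply (Word.enc (b :: r))).size = 2 := rfl
      have h3 : (Op.ident.apply (Word.enc a)).size = ApxSim.sz a := rfl
      have h4 : (Word.enc a).size = ApxSim.sz a := rfl
      simp only [h1, h2, h3, h4, sz_pair, sz_cons] at h0 ⊢
      simp only [← add_assoc] at h0 ⊢
      omega

/-- A loop runs in polynomial time if it halts after polynomially many rounds and all its
intermediate states have polynomial length. -/
theorem PolyTime.iterate {c : σ → Bool} {f : σ → σ} {s₀ : α → σ} {N : α → ℕ}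
    (hc : PolyTime c) (hf : PolyTime f) (hs₀ : PolyTime s₀) (hN : PolyBdd N)
    {B : α → ℕ} (hB : PolyBdd B) (hsz : ∀ a, ∀ i ≤ N a, ApxSim.sz (f^[i] (s₀ a)) ≤ B a)
    (hgo : ∀ a, ∀ i < N a, c (f^[i] (s₀ a)) = true)
    (hhalt : ∀ a, c (f^[N a] (s₀ a)) = false) :
    PolyTime (fun a => f^[N a] (s₀ a)) := by
  obtain ⟨pc, bc, ⟨Tc, hTc⟩, hpc⟩ := hc
  obtain ⟨pf, bf, ⟨Tf, hTf⟩, hpf⟩ := hf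
  obtain ⟨ps, bs, hbs, hps⟩ := hs₀
  have key : ∀ (M : ℕ) (m : ℕ) (s : σ), (∀ i ≤ m, ApxSim.sz (f^[i] s) ≤ M) →
      (∀ i < m, c (f^[i] s) = true) → c (f^[m] s) = false →
      (Prog.loop pc pf).Computes (Word.enc s) (Word.enc (f^[m] s))
        ((m + 1) * (Tc.eval M + Tf.eval M + 1)) := by
    intro M m
    induction m with
    | zero =>
      intro s h1 _ h3
      obtain ⟨t, ht, he⟩ := hpc s
      simp only [Function.iterate_zero, _root_.id] at h3 ⊢
      rw [h3] at he
      refine ⟨t + 1, ?_, Eval.loop_stop he⟩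
      have h4 : Tc.eval (ApxSim.sz s) ≤ Tc.eval M := eval_mono _ (h1 0 le_rfl)
      have := hTc s
      omega
    | succ m ih =>
      intro s h1 h2 h3
      obtain ⟨t, ht, he⟩ := hpc s
      obtain ⟨u, hu, he'⟩ := hpf s
      obtain ⟨w, hw, he''⟩ := ih (f s) (fun i hi => h1 (i + 1) (by omega))
        (fun i hi => h2 (i + 1) (by omega)) h3
      have hcs : c s = true := h2 0 (by omega)
      rw [hcs] at he
      refine ⟨_, ?_, Eval.loop_step he (by simp [Word.enc]) he' he''⟩
      have h4 : Tc.eval (ApxSim.sz s) ≤ Tc.eval M := eval_mono _ (h1 0 (by omega))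
      have h5 : Tf.eval (ApxSim.sz s) ≤ Tf.eval M := eval_mono _ (h1 0 (by omega))
      have := hTc s
      have := hTf s
      rw [show (m + 1 + 1) * (Tc.eval M + Tf.eval M + 1) =
        (m + 1) * (Tc.eval M + Tf.eval M + 1) + (Tc.eval M + Tf.eval M + 1) by ring]
      omega
  refine ⟨.seq ps (.loop pc pf), fun a => bs a +
    (N a + 1) * (Tc.eval (B a) + Tf.eval (B a) + 1) + 1, ?_, fun a => ?_⟩
  · exact (hbs.add ((hN.add (.const 1)).mul (((hB.eval Tc).add (hB.eval Tf)).add (.const 1)))).add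
      (.const 1)
  · obtain ⟨t, ht, he⟩ := hps a
    obtain ⟨w, hw, he'⟩ := key (B a) (N a) (s₀ a) (hsz a) (hgo a) (hhalt a)
    refine ⟨_, ?_, Eval.seq he he'⟩
    beta_reduce
    omega

theorem PolyTime.isCons {l : α → List β} (hl : PolyTime l) :
    PolyTime (fun a => !(l a).isEmpty) :=
  (PolyTime.listCase (f := fun _ => false) (g := fun _ _ _ => true) hl (.const _) (.const _)).congr
    fun a => by cases l a <;> rfl

/-- Left folds run in polynomial time if their intermediate states have polynomial length. -/
theorem PolyTime.foldl {l : α → List β} {s₀ : α → σ} {f : α → σ → β → σ}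
    (hl : PolyTime l) (hs₀ : PolyTime s₀) (hf : PolyTime (fun p : α × σ × β => f p.1 p.2.1 p.2.2))
    {B : α → ℕ} (hB : PolyBdd B)
    (hsz : ∀ a l₁ l₂, l a = l₁ ++ l₂ → ApxSim.sz (l₁.foldl (f a) (s₀ a)) ≤ B a) :
    PolyTime (fun a => (l a).foldl (f a) (s₀ a)) := by
  -- the loop works on the argument, the current state and the rest of the list
  let F : α × σ × List β → α × σ × List β := fun p =>
    match p.2.2 with
    | [] => p
    | b :: t => (p.1, f p.1 p.2.1 b, t)
  have hF : PolyTime F := by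
    refine PolyTime.listCase (f := fun p => p)
      (g := fun (p : α × σ × List β) b t => (p.1, f p.1 p.2.1 b, t))
      PolyTime.id.snd.snd .id ?_
    have h1 : PolyTime (fun p : (α × σ × List β) × β × List β => p.1.1) := PolyTime.id.fst.fst
    exact h1.pair ((hf.comp (h1.pair (PolyTime.id.fst.snd.fst.pair PolyTime.id.snd.fst))).pair
      PolyTime.id.snd.snd)
  have hiter : ∀ a (i : ℕ), i ≤ (l a).length → F^[i] (a, s₀ a, l a) =
      (a, ((l a).take i).foldl (f a) (s₀ a), (l a).drop i) := by
    intro a i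
    induction i with
    | zero => simp
    | succ i ih =>
      intro hi
      rw [Function.iterate_succ_apply', ih (by omega)]
      have hd : (l a).drop i = (l a)[i] :: (l a).drop (i + 1) := List.drop_eq_getElem_cons (by omega)
      have ht : (l a).take (i + 1) = (l a).take i ++ [(l a)[i]] := by
        rw [List.take_succ_eq_append_getElem]
      simp only [F, hd, ht, List.foldl_append, List.foldl_cons, List.foldl_nil]
  have := PolyTime.iterate (c := fun p : α × σ × List β => !p.2.2.isEmpty) (f := F)
    (s₀ := fun a => (a, s₀ a, l a)) (N := fun a => (l a).length)
    (B := fun a => ApxSim.sz a + (B a + ApxSim.sz (l a) + 1) + 1)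
    (.isCons PolyTime.id.snd.snd) hF (PolyTime.id.pair (hs₀.pair hl))
    (hl.sz_bdd.mono fun a => (length_lt_sz _).le)
    ((PolyBdd.sz.add ((hB.add hl.sz_bdd).add (.const 1))).add (.const 1)) ?_ ?_ ?_
  · refine this.snd.fst.congr fun a => ?_
    rw [hiter a _ le_rfl, List.take_length]
  · intro a i hi
    rw [hiter a i hi]
    have h1 := hsz a _ _ (List.take_append_drop i (l a)).symm
    have h2 : ApxSim.sz ((l a).drop i) ≤ ApxSim.sz (l a) := by
      have := sz_append ((l a).take i) ((l a).drop i)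
      rw [List.take_append_drop] at this
      have := one_le_sz ((l a).take i)
      omega
    simp only [sz_pair]
    omega
  · intro a i hi
    rw [hiter a i hi.le]
    simpa using hi
  · intro a
    rw [hiter a _ le_rfl]
    simp

/-- A left fold runs in polynomial time if a measure of the state that controls its length grows
in each step by a polynomial amount only. -/
theorem PolyTime.foldl_of_measure {l : α → List β} {s₀ : α → σ} {f : α → σ → β → σ}
    (hl : PolyTime l) (hs₀ : PolyTime s₀) (hf : PolyTime (fun p : α × σ × β => f p.1 p.2.1 p.2.2))
    (m : σ → ℕ) {P : ℕ} (hm : ∀ s, ApxSim.sz s ≤ P * m s + P) (hm₀ : ∀ s, m s ≤ ApxSim.sz s)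
    {G : α × β → ℕ} (hG : PolyBdd G) (hstep : ∀ a s b, m (f a s b) ≤ m s + G (a, b)) :
    PolyTime (fun a => (l a).foldl (f a) (s₀ a)) := by
  obtain ⟨T, hT⟩ := hG
  refine PolyTime.foldl hl hs₀ hf (B := fun a => P * (ApxSim.sz (s₀ a) + ApxSim.sz (l a) *
    T.eval (ApxSim.sz a + ApxSim.sz (l a) + 1)) + P) ?_ ?_
  · exact ((PolyBdd.const P).mul (hs₀.sz_bdd.add (hl.sz_bdd.mul
      (((PolyBdd.sz.add hl.sz_bdd).add (.const 1)).eval T)))).add (.const P)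
  · intro a l₁ l₂ h
    have key : ∀ (r : List β) (s : σ) (M : ℕ), (∀ b ∈ r, G (a, b) ≤ M) →
        m (r.foldl (f a) s) ≤ m s + r.length * M := by
      intro r
      induction r with
      | nil => simp
      | cons b r ih =>
        intro s M hM
        have h1 := ih (f a s b) M fun b hb => hM b (by simp [hb])
        have h2 := hstep a s b
        have h3 := hM b (by simp)
        simp only [List.foldl_cons, List.length_cons, add_mul]
        omega
    have h1 := key l₁ (s₀ a) (T.eval (ApxSim.sz a + ApxSim.sz (l a) + 1)) fun b hb => by
      refine (hT (a, b)).trans (eval_mono _ ?_)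
      have := sz_lt_of_mem (l := l a) (a := b) (by rw [h]; simp [hb])
      simp only [sz_pair]; omega
    have h2 : l₁.length ≤ ApxSim.sz (l a) := by
      have := length_lt_sz (l a)
      have h3 : (l a).length = l₁.length + l₂.length := by rw [h]; simp
      omega
    refine (hm _).trans ?_
    gcongr
    refine h1.trans ?_
    gcongr
    exact hm₀ _

theorem PolyTime.reverse {l : α → List β} (hl : PolyTime l) :
    PolyTime (fun a => (l a).reverse) := by
  refine (PolyTime.foldl_of_measure (f := fun _ (s : List β) b => b :: s) (s₀ := fun _ => [])
    hl (.const _) (.cons PolyTime.id.snd.snd PolyTime.id.snd.fst) ApxSim.sz (P := 1)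
    (fun s => by omega) (fun _ => le_rfl) (G := fun p => ApxSim.sz p.2 + 1)
    (PolyTime.id.snd.sz_bdd.add (.const 1)) ?_).congr fun a => ?_
  · intro a s b; simp only [sz_cons]; omega
  · simp

theorem PolyTime.map {l : α → List β} {g : α → β → γ} (hl : PolyTime l)
    (hg : PolyTime (fun p : α × β => g p.1 p.2)) : PolyTime (fun a => (l a).map (g a)) := by
  refine (PolyTime.reverse (PolyTime.foldl_of_measure
    (f := fun a (s : List γ) b => g a b :: s) (s₀ := fun _ => [])
    hl (.const _) (.cons (hg.comp (PolyTime.id.fst.pair PolyTime.id.snd.snd)) PolyTime.id.snd.fst)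
    ApxSim.sz (P := 1) (fun s => by omega) (fun _ => le_rfl)
    (G := fun p => ApxSim.sz (g p.1 p.2) + 1)
    (hg.sz_bdd.add (.const 1)) ?_)).congr fun a => ?_
  · intro a s b; simp only [sz_cons]; omega
  · rw [← List.foldl_map (f := g a) (g := fun s c => c :: s)]
    simp

theorem PolyTime.append {l r : α → List β} (hl : PolyTime l) (hr : PolyTime r) :
    PolyTime (fun a => l a ++ r a) := by
  refine (PolyTime.foldl_of_measure (f := fun _ (s : List β) b => b :: s) (s₀ := r)
    hl.reverse hr (.cons PolyTime.id.snd.snd PolyTime.id.snd.fst) ApxSim.sz (P := 1)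
    (fun s => by omega) (fun _ => le_rfl) (G := fun p => ApxSim.sz p.2 + 1)
    (PolyTime.id.snd.sz_bdd.add (.const 1)) ?_).congr fun a => ?_
  · intro a s b; simp only [sz_cons]; omega
  · simp

theorem PolyTime.flatMap {l : α → List β} {g : α → β → List γ} (hl : PolyTime l)
    (hg : PolyTime (fun p : α × β => g p.1 p.2)) : PolyTime (fun a => (l a).flatMap (g a)) := by
  refine (PolyTime.foldl_of_measure (f := fun a (s : List γ) b => s ++ g a b) (s₀ := fun _ => [])
    hl (.const _) (.append PolyTime.id.snd.fst (hg.comp (PolyTime.id.fst.pair PolyTime.id.snd.snd)))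
    ApxSim.sz (P := 1) (fun s => by omega) (fun _ => le_rfl) (G := fun p => ApxSim.sz (g p.1 p.2))
    hg.sz_bdd ?_).congr fun a => ?_
  · intro a s b
    have := sz_append s (g a b)
    change ApxSim.sz (s ++ g a b) ≤ ApxSim.sz s + ApxSim.sz (g a b)
    omega
  · rw [List.flatMap_eq_foldl]

end

/-! ### Polynomial-time arithmetic -/

section
variable {α β γ σ : Type} [Word α] [Word β] [Word γ] [Word σ]

theorem size_le_of_lt {m s : ℕ} (h : m < 2 ^ s) : m.size ≤ s := Nat.size_le.2 h

theorem natSize_add_le (m n : ℕ) : (m + n).size ≤ m.size + n.size + 1 := by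
  apply size_le_of_lt
  have h1 := Nat.lt_size_self m
  have h2 := Nat.lt_size_self n
  have h3 : 2 ^ m.size ≤ 2 ^ (m.size + n.size) := Nat.pow_le_pow_right (by norm_num) (by omega)
  have h4 : 2 ^ n.size ≤ 2 ^ (m.size + n.size) := Nat.pow_le_pow_right (by norm_num) (by omega)
  rw [pow_succ]
  omega

theorem natSize_mul_le (m n : ℕ) : (m * n).size ≤ m.size + n.size := by
  apply size_le_of_lt
  rw [pow_add]
  exact Nat.mul_lt_mul'' (Nat.lt_size_self m) (Nat.lt_size_self n)

theorem sz_int_add_le (x y : ℤ) : sz (x + y) ≤ sz x + sz y := by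
  simp only [sz_int]
  have h1 : (x + y).natAbs.size ≤ (x.natAbs + y.natAbs).size := Nat.size_le_size (Int.natAbs_add_le x y)
  have h2 := natSize_add_le x.natAbs y.natAbs
  omega

theorem PolyTime.intAdd {f g : α → ℤ} (hf : PolyTime f) (hg : PolyTime g) :
    PolyTime (fun a => f a + g a) :=
  (PolyTime.op (f := fun p : ℤ × ℤ => p.1 + p.2) .add (fun _ => rfl)
    (PolyBdd.sz.mono fun p => by
      have := sz_int_add_le p.1 p.2
      rw [show ApxSim.sz p = ApxSim.sz p.1 + ApxSim.sz p.2 + 1 from rfl]; omega)).comp (hf.pair hg)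

theorem PolyTime.intSub {f g : α → ℤ} (hf : PolyTime f) (hg : PolyTime g) :
    PolyTime (fun a => f a - g a) :=
  (PolyTime.op (f := fun p : ℤ × ℤ => p.1 - p.2) .sub (fun _ => rfl)
    (PolyBdd.sz.mono fun p => by
      have := sz_int_add_le p.1 (-p.2)
      rw [← sub_eq_add_neg, show ApxSim.sz (-p.2) = ApxSim.sz p.2 by simp [sz_int]] at this
      rw [show ApxSim.sz p = ApxSim.sz p.1 + ApxSim.sz p.2 + 1 from rfl]; omega)).comp (hf.pair hg)

theorem PolyTime.intMul {f g : α → ℤ} (hf : PolyTime f) (hg : PolyTime g) :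
    PolyTime (fun a => f a * g a) :=
  (PolyTime.op (f := fun p : ℤ × ℤ => p.1 * p.2) .mul (fun _ => rfl)
    (PolyBdd.sz.mono fun p => by
      rw [show ApxSim.sz p = ApxSim.sz p.1 + ApxSim.sz p.2 + 1 from rfl]
      simp only [sz_int, Int.natAbs_mul]
      have := natSize_mul_le p.1.natAbs p.2.natAbs
      omega)).comp (hf.pair hg)

theorem PolyTime.intDiv {f g : α → ℤ} (hf : PolyTime f) (hg : PolyTime g) :
    PolyTime (fun a => f a / g a) :=
  (PolyTime.op (f := fun p : ℤ × ℤ => p.1 / p.2) .div (fun _ => rfl)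
    (PolyBdd.sz.mono fun p => by
      rw [show ApxSim.sz p = ApxSim.sz p.1 + ApxSim.sz p.2 + 1 from rfl]
      simp only [sz_int]
      have := Nat.size_le_size (Int.natAbs_ediv_le_natAbs p.1 p.2)
      omega)).comp (hf.pair hg)

theorem PolyTime.intLe {f g : α → ℤ} (hf : PolyTime f) (hg : PolyTime g) :
    PolyTime (fun a => decide (f a ≤ g a)) :=
  (PolyTime.op (f := fun p : ℤ × ℤ => decide (p.1 ≤ p.2)) .le
    (fun p => by simp [Word.enc, Op.apply])
    ((PolyBdd.const 2).mono fun p => sz_bool_le _)).comp (hf.pair hg)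

theorem PolyTime.cast {f : α → ℕ} (hf : PolyTime f) : PolyTime (fun a => (f a : ℤ)) :=
  hf.transport _root_.id (fun _ => rfl) fun _ => rfl

theorem PolyTime.ofCast {f : α → ℕ} (hf : PolyTime (fun a => (f a : ℤ))) : PolyTime f :=
  hf.transport _root_.id (fun _ => rfl) fun _ => rfl

theorem PolyTime.natAdd {f g : α → ℕ} (hf : PolyTime f) (hg : PolyTime g) :
    PolyTime (fun a => f a + g a) := .ofCast <| (hf.cast.intAdd hg.cast).congr fun a => by push_cast; rfl

theorem PolyTime.natMul {f g : α → ℕ} (hf : PolyTime f) (hg : PolyTime g) :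
    PolyTime (fun a => f a * g a) := .ofCast <| (hf.cast.intMul hg.cast).congr fun a => by push_cast; rfl

theorem PolyTime.natDiv {f g : α → ℕ} (hf : PolyTime f) (hg : PolyTime g) :
    PolyTime (fun a => f a / g a) := .ofCast <| (hf.cast.intDiv hg.cast).congr fun a => by push_cast; rfl

theorem PolyTime.natMod {f g : α → ℕ} (hf : PolyTime f) (hg : PolyTime g) :
    PolyTime (fun a => f a % g a) :=
  .ofCast <| (hf.cast.intSub (hg.cast.intMul (hf.natDiv hg).cast)).congr fun a => by
    have := Int.emod_add_mul_ediv (f a) (g a)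
    push_cast; linarith

theorem PolyTime.natLe {f g : α → ℕ} (hf : PolyTime f) (hg : PolyTime g) :
    PolyTime (fun a => decide (f a ≤ g a)) := (hf.cast.intLe hg.cast).congr fun a => by simp

theorem PolyTime.natEq {f g : α → ℕ} (hf : PolyTime f) (hg : PolyTime g) :
    PolyTime (fun a => decide (f a = g a)) :=
  (PolyTime.ite (c := fun a => f a ≤ g a) (hf.natLe hg) (hg.natLe hf) (.const false)).congr
    fun a => by
      by_cases h : f a ≤ g a
      · rw [if_pos h]; exact decide_eq_decide.2 (by omega)
      · rw [if_neg h, eq_comm, decide_eq_false_iff_not]; omega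

theorem PolyTime.natMax {f g : α → ℕ} (hf : PolyTime f) (hg : PolyTime g) :
    PolyTime (fun a => max (f a) (g a)) := (PolyTime.ite (hf.natLe hg) hg hf).congr fun a => by
      rw [max_def]

theorem PolyTime.natMin {f g : α → ℕ} (hf : PolyTime f) (hg : PolyTime g) :
    PolyTime (fun a => min (f a) (g a)) := (PolyTime.ite (hf.natLe hg) hf hg).congr fun a => by
      rw [min_def]

theorem PolyTime.natPow {f : α → ℕ} (hf : PolyTime f) (m : ℕ) : PolyTime (fun a => f a ^ m) := by
  induction m with
  | zero => exact (PolyTime.const 1).congr fun a => by simp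
  | succ m ih => exact (ih.natMul hf).congr fun a => by rw [pow_succ]

theorem PolyTime.polyEval {f : α → ℕ} (hf : PolyTime f) (P : Polynomial ℕ) :
    PolyTime (fun a => P.eval (f a)) := by
  induction P using Polynomial.induction_on' with
  | add p q hp hq => exact (hp.natAdd hq).congr fun a => by rw [Polynomial.eval_add]
  | monomial n c =>
    exact ((PolyTime.const c).natMul (hf.natPow n)).congr fun a => by rw [Polynomial.eval_monomial]

theorem sz_nat_mono {m n : ℕ} (h : m ≤ n) : sz m ≤ sz n := by
  have := Nat.size_le_size h
  simp only [sz_nat]; omega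

theorem sz_nat_le (m : ℕ) : sz m ≤ m + 1 := by
  have := size_le_of_lt (m := m) (s := m) Nat.lt_two_pow_self
  simp only [sz_nat]; omega

theorem PolyTime.length {l : α → List β} (hl : PolyTime l) : PolyTime (fun a => (l a).length) := by
  have key : ∀ (l : List β) (s : ℕ), l.foldl (fun s _ => s + 1) s = s + l.length := by
    intro l
    induction l with
    | nil => simp
    | cons b l ih => intro s; rw [List.foldl_cons, ih, List.length_cons]; omega
  refine (PolyTime.foldl_of_measure (f := fun _ (s : ℕ) _ => s + 1) (s₀ := fun _ => 0)
    hl (.const _) (.natAdd PolyTime.id.snd.fst (.const 1)) sz (P := 1)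
    (fun s => by omega) (fun _ => le_rfl) (G := fun _ => 2) (.const 2) ?_).congr fun a => ?_
  · intro a s b
    have := sz_int_add_le s 1
    exact this
  · rw [key, zero_add]

/-- A list as long as the value of `N` is written, so that the value itself has to be polynomially
bounded. -/
theorem PolyTime.range {N : α → ℕ} (hN : PolyTime N) (hb : PolyBdd N) :
    PolyTime (fun a => List.range (N a)) := by
  -- count down from `N`, prepending the counter to the list
  let F : ℕ × List ℕ → ℕ × List ℕ := fun p => (p.1 - 1, (p.1 - 1) :: p.2)
  have hpred : PolyTime (fun p : ℕ × List ℕ => p.1 - 1) := by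
    refine .ofCast <| (PolyTime.ite (c := fun p : ℕ × List ℕ => p.1 ≤ 0)
      (PolyTime.id.fst.natLe (.const 0)) (.const 0)
      (PolyTime.id.fst.cast.intSub (.const 1))).congr fun p => ?_
    split_ifs with h
    · simp [Nat.le_zero.1 h]
    · push_cast [show 1 ≤ p.1 by omega]; rfl
  have hF : PolyTime F := hpred.pair (hpred.cons PolyTime.id.snd)
  have hit : ∀ (n i : ℕ), i ≤ n → F^[i] (n, []) = (n - i, List.range' (n - i) i) := by
    intro n i
    induction i with
    | zero => simp
    | succ i ih =>
      intro hi
      rw [Function.iterate_succ_apply', ih (by omega)]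
      simp only [F, List.range'_succ, Prod.mk.injEq, List.cons.injEq]
      refine ⟨by omega, by omega, ?_⟩
      congr 1; omega
  have := PolyTime.iterate (c := fun p : ℕ × List ℕ => !(decide (p.1 ≤ 0))) (f := F)
    (s₀ := fun a => (N a, [])) (N := N)
    (B := fun a => N a + 1 + (N a * (N a + 1 + 1) + 1) + 1) ?_ hF (hN.pair (.const _)) hb
    ?_ ?_ ?_ ?_
  · refine this.snd.congr fun a => ?_
    rw [hit _ _ le_rfl, Nat.sub_self, List.range_eq_range']
  · exact (PolyTime.ite (c := fun p : ℕ × List ℕ => p.1 ≤ 0) (PolyTime.id.fst.natLe (.const 0))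
      (.const false) (.const true)).congr fun p => by split_ifs with h <;> simp [h]
  · exact ((hb.add (.const 1)).add ((hb.mul ((hb.add (.const 1)).add (.const 1))).add
      (.const 1))).add (.const 1)
  · intro a i hi
    rw [hit _ _ hi, sz_pair]
    have h1 := (sz_nat_le (N a - i))
    have h2 := sz_le_of_forall (l := List.range' (N a - i) i) (M := N a + 1) fun b hb => by
      have := List.mem_range'_1.1 hb
      have := sz_nat_le b
      omega
    rw [List.length_range'] at h2
    have h3 : i * (N a + 1 + 1) ≤ N a * (N a + 1 + 1) := Nat.mul_le_mul_right _ hi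
    omega
  · intro a i hi
    rw [hit _ _ hi.le]
    simp; omega
  · intro a
    rw [hit _ _ le_rfl]; simp

/-- The list is scanned with a counter for the position. -/
theorem PolyTime.getD {l : α → List β} {i : α → ℕ} (d : β) (hl : PolyTime l) (hi : PolyTime i) :
    PolyTime (fun a => (l a).getD (i a) d) := by
  have key : ∀ (l : List β) (i k : ℕ) (r : β),
      l.foldl (fun (s : ℕ × β) b => (s.1 + 1, if s.1 = i then b else s.2)) (k, r) =
        (k + l.length, if k ≤ i then l.getD (i - k) r else r) := by
    intro l
    induction l with
    | nil => simp
    | cons b l ih =>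
      intro i k r
      rw [List.foldl_cons, ih]
      simp only [List.length_cons, Prod.mk.injEq]
      refine ⟨by omega, ?_⟩
      rcases lt_trichotomy k i with h | h | h
      · rw [if_pos (by omega), if_pos h.le, if_neg h.ne, show i - k = (i - (k + 1)) + 1 by omega,
          List.getD_cons_succ]
      · subst h
        simp
      · rw [if_neg (by omega), if_neg (by omega), if_neg (by omega)]
  refine (PolyTime.snd (PolyTime.foldl
    (f := fun a (s : ℕ × β) b => (s.1 + 1, if s.1 = i a then b else s.2))
    (s₀ := fun _ => (0, d)) hl (.const _) ?_
    (B := fun a => sz (l a) + 1 + (sz (l a) + sz d) + 1)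
    ((((hl.sz_bdd.add (.const 1))).add (hl.sz_bdd.add (.const _))).add (.const 1)) ?_)).congr
    fun a => ?_
  · exact (PolyTime.natAdd PolyTime.id.snd.fst.fst (.const 1)).pair
      (.ite (PolyTime.natEq PolyTime.id.snd.fst.fst (hi.comp PolyTime.id.fst))
        PolyTime.id.snd.snd PolyTime.id.snd.fst.snd)
  · intro a l₁ l₂ h
    rw [key, sz_pair]
    have h1 : l₁.length ≤ sz (l a) := by
      have := length_lt_sz (l a)
      rw [h, List.length_append] at this
      rw [h]; omega
    have h2 := sz_nat_le (0 + l₁.length)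
    have h3 : sz (if 0 ≤ i a then l₁.getD (i a - 0) d else d) ≤ sz (l a) + sz d := by
      simp only [Nat.zero_le, if_true, Nat.sub_zero]
      by_cases hlt : i a < l₁.length
      · have : sz l₁[i a] < sz (l a) := sz_lt_of_mem (by rw [h]; simp)
        rw [List.getD_eq_getElem _ _ hlt]
        omega
      · rw [List.getD_eq_default _ _ (by omega)]; omega
    omega
  · rw [key]; simp

theorem PolyTime.natProd {l : α → List ℕ} (hl : PolyTime l) : PolyTime (fun a => (l a).prod) := by
  refine (PolyTime.foldl_of_measure (f := fun _ (s : ℕ) b => s * b) (s₀ := fun _ => 1)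
    hl (.const _) (.natMul PolyTime.id.snd.fst PolyTime.id.snd.snd) sz (P := 1)
    (fun s => by omega) (fun _ => le_rfl) (G := fun p => sz p.2)
    (PolyTime.id.snd.sz_bdd) ?_).congr fun a => ?_
  · intro a s b
    have := natSize_mul_le s b
    simp only [sz_nat]; omega
  · rw [List.prod_eq_foldl]

theorem PolyTime.listMax {l : α → List ℕ} (hl : PolyTime l) :
    PolyTime (fun a => (l a).foldl max 0) := by
  refine (PolyTime.foldl_of_measure (f := fun _ (s : ℕ) b => max s b) (s₀ := fun _ => 0)
    hl (.const _) (.natMax PolyTime.id.snd.fst PolyTime.id.snd.snd) sz (P := 1)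
    (fun s => by omega) (fun _ => le_rfl) (G := fun p => sz p.2)
    (PolyTime.id.snd.sz_bdd) ?_)
  · intro a s b
    rcases max_choice s b with h | h <;> rw [h] <;> simp

/-! ### Gaussian integers -/

instance : Word GaussianInt := ⟨fun z => .pair (.int z.re) (.int z.im)⟩

theorem sz_gaussianInt (z : GaussianInt) : sz z = sz z.re + sz z.im + 1 := rfl

theorem PolyTime.re {f : α → GaussianInt} (hf : PolyTime f) : PolyTime (fun a => (f a).re) :=
  (PolyTime.fst (f := fun a => ((f a).re, (f a).im))
    (hf.transport _root_.id (fun _ => rfl) fun _ => rfl))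

theorem PolyTime.im {f : α → GaussianInt} (hf : PolyTime f) : PolyTime (fun a => (f a).im) :=
  (PolyTime.snd (f := fun a => ((f a).re, (f a).im))
    (hf.transport _root_.id (fun _ => rfl) fun _ => rfl))

theorem PolyTime.mkGaussian {f g : α → ℤ} (hf : PolyTime f) (hg : PolyTime g) :
    PolyTime (fun a => (⟨f a, g a⟩ : GaussianInt)) :=
  (hf.pair hg).transport _root_.id (fun _ => rfl) fun _ => rfl

theorem PolyTime.gAdd {f g : α → GaussianInt} (hf : PolyTime f) (hg : PolyTime g) :
    PolyTime (fun a => f a + g a) := (hf.re.intAdd hg.re).mkGaussian (hf.im.intAdd hg.im)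

theorem PolyTime.gMul {f g : α → GaussianInt} (hf : PolyTime f) (hg : PolyTime g) :
    PolyTime (fun a => f a * g a) :=
  (PolyTime.mkGaussian ((hf.re.intMul hg.re).intSub (hf.im.intMul hg.im))
    ((hf.re.intMul hg.im).intAdd (hf.im.intMul hg.re))).congr fun a => by
      ext <;> simp [Zsqrtd.re_mul, Zsqrtd.im_mul]; ring

theorem PolyTime.gStar {f : α → GaussianInt} (hf : PolyTime f) :
    PolyTime (fun a => star (f a)) :=
  (PolyTime.mkGaussian hf.re ((PolyTime.const 0).intSub hf.im)).congr fun a => by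
      ext <;> simp

theorem PolyTime.gCast {f : α → ℕ} (hf : PolyTime f) :
    PolyTime (fun a => (f a : GaussianInt)) :=
  (PolyTime.mkGaussian hf.cast (.const 0)).congr fun a => by ext <;> simp

/-- The number of digits of the larger of the two components. -/
def gsize (z : GaussianInt) : ℕ := max z.re.natAbs.size z.im.natAbs.size

theorem gsize_le (z : GaussianInt) : gsize z ≤ sz z := by
  simp only [gsize, sz_gaussianInt, sz_int]; omega

theorem sz_le_gsize (z : GaussianInt) : sz z ≤ 3 * gsize z + 3 := by
  simp only [gsize, sz_gaussianInt, sz_int]; omega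

theorem gsize_add_le (z w : GaussianInt) : gsize (z + w) ≤ gsize z + (gsize w + 1) := by
  have h1 := sz_int_add_le z.re w.re
  have h2 := sz_int_add_le z.im w.im
  simp only [gsize, sz_int, Zsqrtd.re_add, Zsqrtd.im_add] at *
  omega

theorem gsize_mul_le (z w : GaussianInt) : gsize (z * w) ≤ gsize z + (gsize w + 1) := by
  have h : ∀ n : ℤ, n.natAbs.size ≤ gsize z + (gsize w + 1) ↔
      n.natAbs < 2 ^ (gsize z + gsize w) * 2 := by
    intro n; rw [Nat.size_le, ← pow_succ, add_assoc]
  have hb : ∀ (u v : GaussianInt) , u.re.natAbs < 2 ^ gsize u ∧ u.im.natAbs < 2 ^ gsize u := by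
    intro u _
    exact ⟨Nat.size_le.1 (le_max_left _ _), Nat.size_le.1 (le_max_right _ _)⟩
  obtain ⟨h1, h2⟩ := hb z w
  obtain ⟨h3, h4⟩ := hb w z
  have m1 := Nat.mul_lt_mul'' h1 h3
  have m2 := Nat.mul_lt_mul'' h2 h4
  have m3 := Nat.mul_lt_mul'' h1 h4
  have m4 := Nat.mul_lt_mul'' h2 h3
  rw [← pow_add, ← Int.natAbs_mul] at m1 m2 m3 m4
  refine max_le ((h _).2 ?_) ((h _).2 ?_)
  · have : (z * w).re = z.re * w.re - z.im * w.im := by simp [Zsqrtd.re_mul]; ring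
    rw [this]; omega
  · rw [Zsqrtd.im_mul]; omega

theorem PolyTime.gSum {l : α → List GaussianInt} (hl : PolyTime l) :
    PolyTime (fun a => (l a).sum) := by
  refine (PolyTime.foldl_of_measure (f := fun _ (s : GaussianInt) b => s + b) (s₀ := fun _ => 0)
    hl (.const _) (.gAdd PolyTime.id.snd.fst PolyTime.id.snd.snd) gsize
    sz_le_gsize gsize_le (G := fun p => sz p.2 + 1)
    (PolyTime.id.snd.sz_bdd.add (.const 1)) ?_).congr fun a => ?_
  · intro a s b
    have h1 := gsize_add_le s b
    have h2 := gsize_le b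
    change gsize (s + b) ≤ gsize s + (sz b + 1)
    omega
  · rw [List.sum_eq_foldl]

theorem PolyTime.gSumMap {l : α → List β} {g : α → β → GaussianInt} (hl : PolyTime l)
    (hg : PolyTime (fun p : α × β => g p.1 p.2)) : PolyTime (fun a => ((l a).map (g a)).sum) :=
  (hl.map hg).gSum

end

/-! ### The algorithm that transforms the observable -/

/-- The data of a matrix: denominator and rows of numerators. -/
abbrev RawMat : Type := ℕ × List (List GaussianInt)

/-- The data of a local term: support and matrix. -/
abbrev RawTerm : Type := List ℕ × RawMat

/-- The data of a block of an encoding: target qudits, dimension of the ancilla space, isometry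
and the two projectors. -/
abbrev RawBlock : Type := List ℕ × ℕ × RawMat × RawMat × RawMat × Unit

/-- The data of a local operator: the number of qudits in unary and the list of terms. -/
abbrev RawHam : Type := List Unit × List RawTerm

/-- The data of an input of APX-SIM2. -/
abbrev RawInst : Type := RawHam × RawHam × ℕ × ℕ × (ℤ × ℕ) × (ℤ × ℕ) × (ℤ × ℕ) × Unit

/-- Row and column index of an entry of the new term, row and column index of an entry of the
old term. -/
abbrev Indices : Type := ℕ × ℕ × ℕ × ℕ

/-- Entry of a list of rows, `0` outside the range. -/
def entryAt (M : List (List GaussianInt)) (i j : ℕ) : GaussianInt := (M.getD i []).getD j 0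

/-- The entries of `V (|x⟩⟨x'| ⊗ X) V†`, for integer matrices. -/
def blockNum (e : ℕ) (V X : List (List GaussianInt)) (i : Indices) : GaussianInt :=
  ((List.range X.length).map fun z => ((List.range X.length).map fun z' =>
    entryAt V i.1 (z + e * i.2.2.1) * entryAt X z z' *
      star (entryAt V i.2.1 (z' + e * i.2.2.2))).sum).sum

namespace RawBlock

def dim (b : RawBlock) : ℕ := b.2.1
def V (b : RawBlock) : RawMat := b.2.2.1
def P (b : RawBlock) : RawMat := b.2.2.2.1
def Q (b : RawBlock) : RawMat := b.2.2.2.2.1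

/-- The number of basis states of a block. The maximum with `1` is irrelevant for the blocks of an
encoding; it makes the remainder modulo this number short for arbitrary data. -/
def rows (b : RawBlock) : ℕ := max 1 b.V.2.length

/-- A common denominator of the entries of `V (|x⟩⟨x'| ⊗ P) V†` and `V (|x⟩⟨x'| ⊗ Q) V†`. -/
def den (b : RawBlock) : ℕ := b.V.1 * b.V.1 * (b.P.1 * b.Q.1)

/-- The entries of `V (|x⟩⟨x'| ⊗ P) V†`, as numerators over `den`. -/
def numP (b : RawBlock) (i : Indices) : GaussianInt :=
  (b.Q.1 : GaussianInt) * blockNum b.dim b.V.2 b.P.2 i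

/-- The entries of `V (|x⟩⟨x'| ⊗ Q) V†`, as numerators over `den`. -/
def numQ (b : RawBlock) (i : Indices) : GaussianInt :=
  (b.P.1 : GaussianInt) * blockNum b.dim b.V.2 b.Q.2 i

/-- The lowest digits of the indices. -/
def digit (d : ℕ) (b : RawBlock) (i : Indices) : Indices :=
  (i.1 % b.rows, i.2.1 % b.rows, i.2.2.1 % d, i.2.2.2 % d)

/-- The indices without their lowest digits. -/
def shift (d : ℕ) (b : RawBlock) (i : Indices) : Indices :=
  (i.1 / b.rows, i.2.1 / b.rows, i.2.2.1 / d, i.2.2.2 / d)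

end RawBlock

/-- The entries of a tensor product over a list of blocks, the indices being written in mixed
radix with the digit of the first block as the lowest one. -/
def tensorEntry (d : ℕ) (N : RawBlock → Indices → GaussianInt) : List RawBlock → Indices → GaussianInt
  | [], _ => 1
  | b :: bs, i => N b (b.digit d i) * tensorEntry d N bs (b.shift d i)

/-- The entries of `⨂ V (A ⊗ (⨂ P) + Ā ⊗ (⨂ Q)) ⨂ V†`, up to the denominator. -/
def termNum (d : ℕ) (A : List (List GaussianInt)) (bs : List RawBlock) (r r' : ℕ) : GaussianInt :=
  ((List.range A.length).map fun x => ((List.range A.length).map fun x' =>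
    entryAt A x x' * tensorEntry d RawBlock.numP bs (r, r', x, x') +
      star (entryAt A x x') * tensorEntry d RawBlock.numQ bs (r, r', x, x')).sum).sum

/-- The number of basis states of a list of blocks, cut off at a power of `a`. The cut-off is
without effect for blocks of bounded size and keeps the running time polynomial on all data. -/
def outRows (m a : ℕ) (bs : List RawBlock) : ℕ := min (bs.map RawBlock.rows).prod (a ^ m)

/-- The denominator of the new term. The factor `2` belongs to the symmetrization; for an empty
list of blocks both summands `A ⊗ P` and `Ā ⊗ Q` are present everywhere, which gives another
factor `2`. -/
def outDen (a : ℕ) (bs : List RawBlock) : ℕ :=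
  2 * ((if bs.length = 0 then 2 else 1) * (a * (bs.map RawBlock.den).prod))

/-- The new term that is obtained from a term and the blocks of the qudits on which it acts. -/
def blocksTerm (d m : ℕ) (A : RawMat) (bs : List RawBlock) : RawTerm :=
  (bs.flatMap fun b => b.1, outDen A.1 bs,
    (List.range (outRows m A.2.length bs)).map fun r =>
      (List.range (outRows m A.2.length bs)).map fun r' =>
        termNum d A.2 bs r r' + star (termNum d A.2 bs r' r))

/-- The value for positions outside the list of blocks, which the qudits of an instance never reach. -/
def defaultBlock : RawBlock := ([], 0, (0, []), (0, []), (0, []), ())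

/-- The new term that is obtained from a term and the list of all blocks. -/
def rawTermOut (d m : ℕ) (blocks : List RawBlock) (t : RawTerm) : RawTerm :=
  blocksTerm d m t.2 (t.1.map fun j => blocks.getD j defaultBlock)

section
variable {α β γ σ : Type} [Word α] [Word β] [Word γ] [Word σ]

theorem PolyTime.entryAt {M : α → List (List GaussianInt)} {i j : α → ℕ} (hM : PolyTime M)
    (hi : PolyTime i) (hj : PolyTime j) : PolyTime (fun a => entryAt (M a) (i a) (j a)) :=
  (hM.getD [] hi).getD 0 hj

theorem PolyTime.rangeLength {l : α → List β} (hl : PolyTime l) :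
    PolyTime (fun a => List.range (l a).length) :=
  hl.length.range (hl.sz_bdd.mono fun _ => (length_lt_sz _).le)

theorem polyTime_blockNum : PolyTime (fun p : (ℕ × List (List GaussianInt) ×
    List (List GaussianInt)) × Indices => blockNum p.1.1 p.1.2.1 p.1.2.2 p.2) := by
  unfold blockNum
  refine .gSumMap (.rangeLength PolyTime.id.fst.snd.snd) (.gSumMap
    (.rangeLength PolyTime.id.fst.fst.snd.snd) ?_)
  refine .gMul (.gMul ?_ ?_) (.gStar ?_)
  · exact .entryAt PolyTime.id.fst.fst.fst.snd.fst PolyTime.id.fst.fst.snd.fst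
      (.natAdd PolyTime.id.fst.snd (.natMul PolyTime.id.fst.fst.fst.fst
        PolyTime.id.fst.fst.snd.snd.snd.fst))
  · exact .entryAt PolyTime.id.fst.fst.fst.snd.snd PolyTime.id.fst.snd PolyTime.id.snd
  · exact .entryAt PolyTime.id.fst.fst.fst.snd.fst PolyTime.id.fst.fst.snd.snd.fst
      (.natAdd PolyTime.id.snd (.natMul PolyTime.id.fst.fst.fst.fst
        PolyTime.id.fst.fst.snd.snd.snd.snd))

theorem PolyTime.blockDim {b : α → RawBlock} (hb : PolyTime b) : PolyTime (fun a => (b a).dim) :=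
  hb.snd.fst

theorem PolyTime.blockV {b : α → RawBlock} (hb : PolyTime b) : PolyTime (fun a => (b a).V) :=
  hb.snd.snd.fst

theorem PolyTime.blockP {b : α → RawBlock} (hb : PolyTime b) : PolyTime (fun a => (b a).P) :=
  hb.snd.snd.snd.fst

theorem PolyTime.blockQ {b : α → RawBlock} (hb : PolyTime b) : PolyTime (fun a => (b a).Q) :=
  hb.snd.snd.snd.snd.fst

theorem polyTime_rows : PolyTime RawBlock.rows :=
  .natMax (.const 1) PolyTime.id.blockV.snd.length

theorem polyTime_den : PolyTime RawBlock.den :=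
  .natMul (.natMul PolyTime.id.blockV.fst PolyTime.id.blockV.fst)
    (.natMul PolyTime.id.blockP.fst PolyTime.id.blockQ.fst)

theorem polyTime_numP : PolyTime (fun p : RawBlock × Indices => p.1.numP p.2) := by
  unfold RawBlock.numP
  refine .gMul (.gCast PolyTime.id.fst.blockQ.fst) ?_
  exact polyTime_blockNum.comp (f := fun p : RawBlock × Indices => ((p.1.dim, p.1.V.2, p.1.P.2), p.2))
    ((PolyTime.id.fst.blockDim.pair
      (PolyTime.id.fst.blockV.snd.pair PolyTime.id.fst.blockP.snd)).pair PolyTime.id.snd)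

theorem polyTime_numQ : PolyTime (fun p : RawBlock × Indices => p.1.numQ p.2) := by
  unfold RawBlock.numQ
  refine .gMul (.gCast PolyTime.id.fst.blockP.fst) ?_
  exact polyTime_blockNum.comp (f := fun p : RawBlock × Indices => ((p.1.dim, p.1.V.2, p.1.Q.2), p.2))
    ((PolyTime.id.fst.blockDim.pair
      (PolyTime.id.fst.blockV.snd.pair PolyTime.id.fst.blockQ.snd)).pair PolyTime.id.snd)

theorem PolyTime.rows {b : α → RawBlock} (hb : PolyTime b) : PolyTime (fun a => (b a).rows) :=
  polyTime_rows.comp hb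

theorem PolyTime.digit (d : ℕ) {b : α → RawBlock} {i : α → Indices} (hb : PolyTime b)
    (hi : PolyTime i) : PolyTime (fun a => (b a).digit d (i a)) :=
  (hi.fst.natMod hb.rows).pair ((hi.snd.fst.natMod hb.rows).pair
    ((hi.snd.snd.fst.natMod (.const d)).pair (hi.snd.snd.snd.natMod (.const d))))

theorem PolyTime.shift (d : ℕ) {b : α → RawBlock} {i : α → Indices} (hb : PolyTime b)
    (hi : PolyTime i) : PolyTime (fun a => (b a).shift d (i a)) :=
  (hi.fst.natDiv hb.rows).pair ((hi.snd.fst.natDiv hb.rows).pair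
    ((hi.snd.snd.fst.natDiv (.const d)).pair (hi.snd.snd.snd.natDiv (.const d))))

/-- The tensor product is computed in one pass that keeps the remaining digits and the product so far. -/
theorem tensorEntry_eq_foldl (d : ℕ) (N : RawBlock → Indices → GaussianInt) (bs : List RawBlock)
    (i : Indices) (g : GaussianInt) :
    (bs.foldl (fun (s : Indices × GaussianInt) b => (b.shift d s.1, s.2 * N b (b.digit d s.1)))
      (i, g)).2 = g * tensorEntry d N bs i := by
  induction bs generalizing i g with
  | nil => simp [tensorEntry]
  | cons b bs ih => rw [List.foldl_cons, ih, tensorEntry, mul_assoc]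

theorem polyTime_tensorEntry {d : ℕ} (hd : 0 < d) {N : RawBlock → Indices → GaussianInt}
    (hN : PolyTime (fun p : RawBlock × Indices => N p.1 p.2)) :
    PolyTime (fun p : List RawBlock × Indices => tensorEntry d N p.1 p.2) := by
  -- each factor sees only digits below `rows` and `d`, so that its length does not depend on how
  -- many factors have been multiplied; lengths of products add up
  obtain ⟨T, hT⟩ := hN.sz_bdd
  have hfold := PolyTime.foldl_of_measure (α := List RawBlock × Indices)
    (l := fun p => p.1) (s₀ := fun p => (p.2, (1 : GaussianInt)))
    (f := fun _ (s : Indices × GaussianInt) b => (b.shift d s.1, s.2 * N b (b.digit d s.1)))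
    PolyTime.id.fst (PolyTime.id.snd.pair (.const 1))
    ((PolyTime.shift d PolyTime.id.snd.snd PolyTime.id.snd.fst.fst).pair
      (.gMul PolyTime.id.snd.fst.snd (hN.comp (PolyTime.id.snd.snd.pair
        (.digit d PolyTime.id.snd.snd PolyTime.id.snd.fst.fst)))))
    (fun s => sz s.1 + gsize s.2) (P := 4)
    (fun s => by have := sz_le_gsize s.2; rw [show sz s = sz s.1 + sz s.2 + 1 from rfl]; omega)
    (fun s => by have := gsize_le s.2; rw [show sz s = sz s.1 + sz s.2 + 1 from rfl]; omega)
    (G := fun p => T.eval (sz p.2 + sz (p.2.rows, p.2.rows, d, d) + 1) + 1)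
  refine (hfold ?_ ?_).snd.congr fun p => ?_
  · refine (PolyBdd.eval ((PolyTime.id.snd.sz_bdd.add (PolyTime.sz_bdd ?_)).add (.const 1)) T).add
      (.const 1)
    exact PolyTime.id.snd.rows.pair (PolyTime.id.snd.rows.pair ((PolyTime.const d).pair
      (.const d)))
  · rintro a ⟨⟨r, r', x, x'⟩, g⟩ b
    have hr : 0 < b.rows := lt_of_lt_of_le one_pos (le_max_left _ _)
    have h1 := gsize_mul_le g (N b (b.digit d (r, r', x, x')))
    have h2 := gsize_le (N b (b.digit d (r, r', x, x')))
    have h3 := hT (b, b.digit d (r, r', x, x'))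
    have h4 : sz (b, b.digit d (r, r', x, x')) ≤ sz b + sz (b.rows, b.rows, d, d) + 1 := by
      have e1 := sz_nat_mono (Nat.mod_lt r hr).le
      have e2 := sz_nat_mono (Nat.mod_lt r' hr).le
      have e3 := sz_nat_mono (Nat.mod_lt x hd).le
      have e4 := sz_nat_mono (Nat.mod_lt x' hd).le
      rw [sz_pair]
      simp only [RawBlock.digit, sz_pair]
      omega
    have h5 := eval_mono T h4
    have h6 : sz (b.shift d (r, r', x, x')) ≤ sz (r, r', x, x') := by
      have e1 := sz_nat_mono (Nat.div_le_self r b.rows)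
      have e2 := sz_nat_mono (Nat.div_le_self r' b.rows)
      have e3 := sz_nat_mono (Nat.div_le_self x d)
      have e4 := sz_nat_mono (Nat.div_le_self x' d)
      simp only [RawBlock.shift, sz_pair]
      omega
    change sz (b.shift d (r, r', x, x')) + gsize (g * N b (b.digit d (r, r', x, x'))) ≤
      sz (r, r', x, x') + gsize g + (T.eval (sz b + sz (b.rows, b.rows, d, d) + 1) + 1)
    change sz (N b (b.digit d (r, r', x, x'))) ≤ _ at h3
    omega
  · rw [tensorEntry_eq_foldl, one_mul]

theorem polyTime_termNum {d : ℕ} (hd : 0 < d) :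
    PolyTime (fun p : (List (List GaussianInt) × List RawBlock) × ℕ × ℕ =>
      termNum d p.1.1 p.1.2 p.2.1 p.2.2) := by
  unfold termNum
  refine .gSumMap (.rangeLength PolyTime.id.fst.fst) (.gSumMap
    (.rangeLength PolyTime.id.fst.fst.fst) ?_)
  have hA : PolyTime (fun p : (((List (List GaussianInt) × List RawBlock) × ℕ × ℕ) × ℕ) × ℕ =>
      entryAt p.1.1.1.1 p.1.2 p.2) :=
    .entryAt PolyTime.id.fst.fst.fst.fst PolyTime.id.fst.snd PolyTime.id.snd
  have hi : PolyTime (fun p : (((List (List GaussianInt) × List RawBlock) × ℕ × ℕ) × ℕ) × ℕ =>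
      (p.1.1.1.2, (p.1.1.2.1, p.1.1.2.2, p.1.2, p.2))) :=
    PolyTime.id.fst.fst.fst.snd.pair (PolyTime.id.fst.fst.snd.fst.pair
      (PolyTime.id.fst.fst.snd.snd.pair (PolyTime.id.fst.snd.pair PolyTime.id.snd)))
  exact .gAdd (.gMul hA ((polyTime_tensorEntry hd polyTime_numP).comp hi))
    (.gMul hA.gStar ((polyTime_tensorEntry hd polyTime_numQ).comp hi))

theorem polyTime_blocksTerm {d : ℕ} (hd : 0 < d) (m : ℕ) :
    PolyTime (fun p : RawMat × List RawBlock => blocksTerm d m p.1 p.2) := by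
  have hrows : PolyTime (fun p : RawMat × List RawBlock =>
      List.range (outRows m p.1.2.length p.2)) := by
    refine .range (.natMin (.natProd (.map PolyTime.id.snd PolyTime.id.snd.rows))
      (PolyTime.id.fst.snd.length.natPow m)) ?_
    -- by the cut-off, the number of rows is polynomial in the number of rows of the old matrix
    refine (PolyTime.id.fst.snd.sz_bdd.pow m).mono fun p => ?_
    exact (min_le_right _ _).trans (Nat.pow_le_pow_left (length_lt_sz _).le m)
  refine .pair (.flatMap PolyTime.id.snd PolyTime.id.snd.fst) (.pair ?_ ?_)
  · exact .natMul (.const 2) (.natMul (.ite (.natEq PolyTime.id.snd.length (.const 0)) (.const 2)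
      (.const 1)) (.natMul PolyTime.id.fst.fst (.natProd (.map PolyTime.id.snd
        (polyTime_den.comp PolyTime.id.snd)))))
  · refine .map hrows (.map (hrows.comp PolyTime.id.fst) ?_)
    have h1 : PolyTime (fun p : ((RawMat × List RawBlock) × ℕ) × ℕ => (p.1.1.1.2, p.1.1.2)) :=
      PolyTime.id.fst.fst.fst.snd.pair PolyTime.id.fst.fst.snd
    refine .gAdd ?_ (.gStar ?_)
    · exact (polyTime_termNum hd).comp (f := fun p : ((RawMat × List RawBlock) × ℕ) × ℕ =>
        ((p.1.1.1.2, p.1.1.2), (p.1.2, p.2))) (h1.pair (PolyTime.id.fst.snd.pair PolyTime.id.snd))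
    · exact (polyTime_termNum hd).comp (f := fun p : ((RawMat × List RawBlock) × ℕ) × ℕ =>
        ((p.1.1.1.2, p.1.1.2), (p.2, p.1.2))) (h1.pair (PolyTime.id.snd.pair PolyTime.id.fst.snd))

theorem polyTime_rawTermOut {d : ℕ} (hd : 0 < d) (m : ℕ) :
    PolyTime (fun p : List RawBlock × RawTerm => rawTermOut d m p.1 p.2) :=
  (polyTime_blocksTerm hd m).comp (PolyTime.id.snd.snd.pair (.map PolyTime.id.snd.fst
    (.getD defaultBlock PolyTime.id.fst.fst PolyTime.id.snd)))

end

/-! ### Tensor products over the blocks of a local encoding -/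

/-- Sums over product types of products factorize. -/
theorem sum_prod_pi {ι : Type} [Fintype ι] [DecidableEq ι] {κ : ι → Type} [∀ i, Fintype (κ i)]
    {R : Type} [CommSemiring R] (f : ∀ i, κ i → R) :
    ∑ w : ∀ i, κ i, ∏ i, f i (w i) = ∏ i, ∑ v, f i v := by
  rw [Finset.prod_univ_sum, Fintype.piFinset_univ]

section ProdTensor

variable {ι : Type} [Fintype ι] [DecidableEq ι] {e : ι → ℕ}

/-- The tensor product `⨂ i, X i`. -/
def prodTensor (X : ∀ i, Matrix (Fin (e i)) (Fin (e i)) ℂ) :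
    Matrix (∀ i, Fin (e i)) (∀ i, Fin (e i)) ℂ :=
  Matrix.of fun z z' => ∏ i, X i (z i) (z' i)

theorem prodTensor_mul (X Y : ∀ i, Matrix (Fin (e i)) (Fin (e i)) ℂ) :
    prodTensor X * prodTensor Y = prodTensor fun i => X i * Y i := by
  ext z z'
  simp only [prodTensor, Matrix.mul_apply, Matrix.of_apply, ← Finset.prod_mul_distrib]
  rw [sum_prod_pi (fun i v => X i (z i) v * Y i v (z' i))]

theorem prod_one_apply {ι : Type} [Fintype ι] {κ : ι → Type} [∀ i, DecidableEq (κ i)] (z z' : ∀ i, κ i) :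
    ∏ i, (1 : Matrix (κ i) (κ i) ℂ) (z i) (z' i) = if z = z' then 1 else 0 := by
  simp only [Matrix.one_apply, Finset.prod_ite_zero, Finset.prod_const_one, Finset.mem_univ,
    true_imp_iff, funext_iff]

theorem prodTensor_one {ι : Type} [Fintype ι] {e : ι → ℕ} : prodTensor (fun i => (1 : Matrix (Fin (e i)) (Fin (e i)) ℂ)) = 1 := by
  ext z z'
  exact (prod_one_apply z z').trans Matrix.one_apply.symm

theorem onSite_eq_prodTensor (i : ι) (M : Matrix (Fin (e i)) (Fin (e i)) ℂ) :
    onSite i M = prodTensor (Function.update (fun _ => 1) i M) := by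
  ext z z'
  simp only [onSite, prodTensor, Matrix.of_apply]
  rw [← Finset.mul_prod_erase _ _ (Finset.mem_univ i), Function.update_self]
  have : ∏ j ∈ Finset.univ.erase i,
      (Function.update (fun _ => 1) i M : ∀ i, Matrix (Fin (e i)) (Fin (e i)) ℂ) j (z j) (z' j) =
      ∏ j ∈ Finset.univ.erase i, if z j = z' j then (1 : ℂ) else 0 := by
    refine Finset.prod_congr rfl fun j hj => ?_
    rw [Function.update_of_ne (Finset.ne_of_mem_erase hj), Matrix.one_apply]
  rw [this, Finset.prod_ite_zero]
  simp only [Finset.prod_const_one, Finset.mem_erase, Finset.mem_univ, and_true, mul_ite, mul_one,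
    mul_zero]

/-- The operator that acts as `X i` on the sites `i ∈ S` and as the identity elsewhere. -/
def sitesProd (S : Finset ι) (X : ∀ i, Matrix (Fin (e i)) (Fin (e i)) ℂ) :
    Matrix (∀ i, Fin (e i)) (∀ i, Fin (e i)) ℂ :=
  prodTensor fun i => if i ∈ S then X i else 1

theorem sitesProd_insert {S : Finset ι} {i : ι} (hi : i ∉ S)
    (X : ∀ i, Matrix (Fin (e i)) (Fin (e i)) ℂ) :
    sitesProd (insert i S) X = sitesProd S X * onSite i (X i) := by
  rw [onSite_eq_prodTensor, sitesProd, sitesProd, prodTensor_mul]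
  congr 1
  funext j
  by_cases h : j = i
  · subst h; simp [hi]
  · simp [h, Function.update_of_ne]

theorem onSite_mul (i : ι) (M N : Matrix (Fin (e i)) (Fin (e i)) ℂ) :
    onSite i M * onSite i N = onSite i (M * N) := by
  rw [onSite_eq_prodTensor, onSite_eq_prodTensor, onSite_eq_prodTensor, prodTensor_mul]
  congr 1
  funext j
  by_cases h : j = i
  · subst h; simp
  · simp [h, Function.update_of_ne]

theorem onSite_zero (i : ι) : onSite i (0 : Matrix (Fin (e i)) (Fin (e i)) ℂ) = 0 := by
  ext; simp [onSite]

theorem onSite_conjTranspose (i : ι) (M : Matrix (Fin (e i)) (Fin (e i)) ℂ) :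
    (onSite i M)ᴴ = onSite i Mᴴ := by
  ext z z'
  simp only [onSite, Matrix.conjTranspose_apply, Matrix.of_apply, apply_ite star, star_zero,
    eq_comm]

theorem sitesProd_mul_of_forall (S : Finset ι) {X : ∀ i, Matrix (Fin (e i)) (Fin (e i)) ℂ}
    {P : Matrix (∀ i, Fin (e i)) (∀ i, Fin (e i)) ℂ} (h : ∀ i, onSite i (X i) * P = P) :
    sitesProd S X * P = P := by
  induction S using Finset.induction_on with
  | empty =>
    rw [show sitesProd ∅ X = 1 by simp [sitesProd, prodTensor_one], Matrix.one_mul]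
  | insert i S hi ih => rw [sitesProd_insert hi, Matrix.mul_assoc, h, ih]

/-- On the range of `Q`, which is fixed by `Y i`, a single factor `X i` with `X i * Y i = 0` suffices
to annihilate the product. -/
theorem sitesProd_mul_eq_zero {S : Finset ι} (hS : S.Nonempty)
    {X Y : ∀ i, Matrix (Fin (e i)) (Fin (e i)) ℂ}
    {Q : Matrix (∀ i, Fin (e i)) (∀ i, Fin (e i)) ℂ} (h : ∀ i, onSite i (Y i) * Q = Q)
    (hXY : ∀ i, X i * Y i = 0) : sitesProd S X * Q = 0 := by
  obtain ⟨i, hi⟩ := hS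
  rw [← Finset.insert_erase hi, sitesProd_insert (Finset.notMem_erase i S), ← h i,
    Matrix.mul_assoc, ← Matrix.mul_assoc (onSite i (X i)), onSite_mul, hXY, onSite_zero,
    Matrix.zero_mul, Matrix.mul_zero]

end ProdTensor

namespace LocalEncoding

variable {d n d' n' : ℕ} (L : LocalEncoding d n d' n')

/-- The part of a basis state that belongs to a block. -/
def part (y : Fin n' → Fin d') (i : Fin n ⊕ Fin L.anc) : Fin (L.tgt i).length → Fin d' :=
  fun r => y ((L.tgt i).get r)

/-- The target qudits are partitioned into the blocks. -/
theorem tgt_bijective :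
    Function.Bijective fun p : Σ i, Fin (L.tgt i).length => (L.tgt p.1).get p.2 := by
  constructor
  · rintro ⟨i, r⟩ ⟨j, s⟩ h
    obtain rfl : i = j := by
      obtain ⟨k, _, hk⟩ := L.tgt_partition ((L.tgt i).get r)
      rw [hk i (List.get_mem _ _), hk j (by dsimp only at h; rw [h]; exact List.get_mem _ _)]
    obtain rfl : r = s := (L.tgt_nodup i).injective_get h
    rfl
  · intro w
    obtain ⟨i, hi, _⟩ := L.tgt_partition w
    obtain ⟨r, hr⟩ := List.mem_iff_get.1 hi
    exact ⟨⟨i, r⟩, hr⟩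

/-- A basis state of the target qudits is given by its parts. -/
noncomputable def partEquiv : (Fin n' → Fin d') ≃ ∀ i, Fin (L.tgt i).length → Fin d' :=
  ((Equiv.ofBijective _ L.tgt_bijective).arrowCongr (Equiv.refl (Fin d'))).symm.trans
    (Equiv.piCurry fun _ _ => Fin d')

/-- A basis state of the domain of the global isometry is given by its parts. -/
def inEquiv : ((Fin n → Fin d) × ∀ i, Fin (L.dimE i)) ≃ ∀ i, Fin (inDim d i) × Fin (L.dimE i) where
  toFun p i := (localIn p.1 i, p.2 i)
  invFun w := (fun j => (w (.inl j)).1, fun i => (w i).2)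
  left_inv _ := rfl
  right_inv w := by
    funext i
    rcases i with j | r
    · rfl
    · exact Prod.ext (Subsingleton.elim (α := Fin 1) _ _) rfl

theorem sum_part {R : Type} [CommSemiring R] (f : ∀ i, (Fin (L.tgt i).length → Fin d') → R) :
    ∑ y, ∏ i, f i (L.part y i) = ∏ i, ∑ w, f i w := by
  rw [← sum_prod_pi, ← Equiv.sum_comp L.partEquiv]
  rfl

theorem sum_in {R : Type} [CommSemiring R] (f : ∀ i, Fin (inDim d i) × Fin (L.dimE i) → R) :
    ∑ p : (Fin n → Fin d) × ∀ i, Fin (L.dimE i), ∏ i, f i (localIn p.1 i, p.2 i) =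
      ∏ i, ∑ w, f i w := by
  rw [← sum_prod_pi, ← Equiv.sum_comp L.inEquiv]
  rfl

/-- The tensor product of operators on the blocks. -/
def blockTensor (G : ∀ i, Matrix (Fin (L.tgt i).length → Fin d') (Fin (L.tgt i).length → Fin d') ℂ) :
    QOp d' n' :=
  Matrix.of fun y y' => ∏ i, G i (L.part y i) (L.part y' i)

/-- The tensor product of operators on the inputs of the blocks. -/
def inTensor (R : ∀ i, Matrix (Fin (inDim d i) × Fin (L.dimE i)) (Fin (inDim d i) × Fin (L.dimE i)) ℂ) :
    Matrix ((Fin n → Fin d) × ∀ i, Fin (L.dimE i)) ((Fin n → Fin d) × ∀ i, Fin (L.dimE i)) ℂ :=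
  Matrix.of fun p q => ∏ i, R i (localIn p.1 i, p.2 i) (localIn q.1 i, q.2 i)

theorem inTensor_one : L.inTensor (fun _ => 1) = 1 := by
  ext p q
  have := prod_one_apply (L.inEquiv p) (L.inEquiv q)
  rw [Matrix.one_apply]
  simp only [L.inEquiv.injective.eq_iff] at this
  exact this

/-- If each `G i` acts on the range of `V i` as `R i`, then `⨂ G i` acts on the range of the global
isometry as `⨂ R i`. -/
theorem blockTensor_mul_isom
    {G : ∀ i, Matrix (Fin (L.tgt i).length → Fin d') (Fin (L.tgt i).length → Fin d') ℂ}
    {R : ∀ i, Matrix (Fin (inDim d i) × Fin (L.dimE i)) (Fin (inDim d i) × Fin (L.dimE i)) ℂ}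
    (h : ∀ i, G i * L.V i = L.V i * R i) : L.blockTensor G * L.isom = L.isom * L.inTensor R := by
  ext y p
  have h1 : (L.blockTensor G * L.isom) y p =
      ∏ i, (G i * L.V i) (L.part y i) (localIn p.1 i, p.2 i) := by
    simp only [Matrix.mul_apply, ← L.sum_part (fun i w => G i (L.part y i) w * L.V i w _),
      Finset.prod_mul_distrib]
    rfl
  have h2 : (L.isom * L.inTensor R) y p =
      ∏ i, (L.V i * R i) (L.part y i) (localIn p.1 i, p.2 i) := by
    simp only [Matrix.mul_apply,
      ← L.sum_in (fun i w => L.V i (L.part y i) w * R i w (localIn p.1 i, p.2 i)),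
      Finset.prod_mul_distrib]
    rfl
  rw [h1, h2]
  simp only [h]

theorem isom_isometry : L.isomᴴ * L.isom = 1 := by
  rw [← L.inTensor_one]
  ext p q
  have : (L.isomᴴ * L.isom) p q =
      ∏ i, ((L.V i)ᴴ * L.V i) (localIn p.1 i, p.2 i) (localIn q.1 i, q.2 i) := by
    simp only [Matrix.mul_apply, ← L.sum_part (fun i w =>
      (L.V i)ᴴ (localIn p.1 i, p.2 i) w * L.V i w (localIn q.1 i, q.2 i)),
      Finset.prod_mul_distrib]
    simp only [Matrix.conjTranspose_apply, isom, Matrix.of_apply, star_prod]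
    rfl
  rw [this]
  simp only [L.V_isometry]
  rfl

theorem onSite_mul_P (i) : onSite i (L.PE i) * L.P = L.P := by
  have := congrArg Matrix.conjTranspose (L.P_PE i)
  rwa [Matrix.conjTranspose_mul, onSite_conjTranspose, ← Matrix.star_eq_conjTranspose,
    ← Matrix.star_eq_conjTranspose, (L.PE_proj i).isSelfAdjoint.star_eq,
    L.P_proj.isSelfAdjoint.star_eq] at this

theorem onSite_mul_Q (i) : onSite i (L.QE i) * L.Q = L.Q := by
  have := congrArg Matrix.conjTranspose (L.Q_QE i)
  rwa [Matrix.conjTranspose_mul, onSite_conjTranspose, ← Matrix.star_eq_conjTranspose,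
    ← Matrix.star_eq_conjTranspose, (L.QE_proj i).isSelfAdjoint.star_eq,
    L.Q_proj.isSelfAdjoint.star_eq] at this

theorem QE_PE (i) : L.QE i * L.PE i = 0 := by
  have := congrArg Matrix.conjTranspose (L.PE_QE i)
  rwa [Matrix.conjTranspose_mul, ← Matrix.star_eq_conjTranspose,
    ← Matrix.star_eq_conjTranspose, (L.QE_proj i).isSelfAdjoint.star_eq,
    (L.PE_proj i).isSelfAdjoint.star_eq, Matrix.conjTranspose_zero] at this

/-! ### The exact image of a local term -/

section Ideal

variable (s : List (Fin n)) (X : ∀ i, Matrix (Fin (L.dimE i)) (Fin (L.dimE i)) ℂ)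

/-- The blocks of a list of qudits. -/
def sites : Finset (Fin n ⊕ Fin L.anc) := s.toFinset.map Function.Embedding.inl

theorem inl_mem_sites {j : Fin n} : Sum.inl j ∈ L.sites s ↔ j ∈ s := by simp [sites]

theorem inr_notMem_sites {r : Fin L.anc} : Sum.inr r ∉ L.sites s := by simp [sites]

/-- `|u⟩⟨u'| ⊗ X` on the inputs of the blocks of the qudits in `s`. -/
noncomputable def unitIn (u u' : Fin s.length → Fin d) :
    ∀ i, Matrix (Fin (inDim d i) × Fin (L.dimE i)) (Fin (inDim d i) × Fin (L.dimE i)) ℂ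
  | .inl j => if h : j ∈ s then
      Matrix.single (u ⟨s.idxOf j, List.idxOf_lt_length_iff.2 h⟩)
        (u' ⟨s.idxOf j, List.idxOf_lt_length_iff.2 h⟩) 1 ⊗ₖ X (.inl j) else 1
  | .inr _ => 1

/-- `V (|u⟩⟨u'| ⊗ X) V†` on the blocks of the qudits in `s`. -/
noncomputable def unitOut (u u' : Fin s.length → Fin d) (i : Fin n ⊕ Fin L.anc) :
    Matrix (Fin (L.tgt i).length → Fin d') (Fin (L.tgt i).length → Fin d') ℂ :=
  if i ∈ L.sites s then L.V i * L.unitIn s X u u' i * (L.V i)ᴴ else 1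

theorem unitOut_mul_V (u u' : Fin s.length → Fin d) (i) :
    L.unitOut s X u u' i * L.V i = L.V i * L.unitIn s X u u' i := by
  unfold unitOut
  split_ifs with h
  · rw [Matrix.mul_assoc _ _ (L.V i), L.V_isometry, Matrix.mul_one]
  · rw [Matrix.one_mul]
    have : L.unitIn s X u u' i = 1 := by
      rcases i with j | r
      · rw [inl_mem_sites] at h
        simp [unitIn, h]
      · rfl
    rw [this, Matrix.mul_one]

/-- The operator that acts on the blocks of the qudits in `s` as `V (M ⊗ X) V†`. -/
noncomputable def ideal (M : Matrix (Fin s.length → Fin d) (Fin s.length → Fin d) ℂ) :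
    QOp d' n' :=
  ∑ u, ∑ u', M u u' • L.blockTensor (L.unitOut s X u u')

/-- The operator `M` on the qudits in the list `s`, tensored with the identity. -/
noncomputable def onQudits (s : List (Fin n))
    (M : Matrix (Fin s.length → Fin d) (Fin s.length → Fin d) ℂ) : QOp d n :=
  Matrix.of fun x y => if ∀ i, i ∉ s → x i = y i then
    M (fun r => x (s.get r)) (fun r => y (s.get r)) else 0

theorem prod_mem_list {R : Type} [CommMonoid R] {s : List (Fin n)} (hs : s.Nodup) (f : Fin n → R) :
    ∏ j, (if j ∈ s then f j else 1) = ∏ r : Fin s.length, f (s.get r) := by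
  symm
  refine Fintype.prod_of_injective (s.get) hs.injective_get _ _ ?_ ?_
  · intro j hj
    rw [if_neg]
    intro h
    obtain ⟨r, hr⟩ := List.mem_iff_get.1 h
    exact hj ⟨r, hr⟩
  · intro r
    rw [if_pos (List.get_mem _ _)]

theorem idxOf_get' {s : List (Fin n)} (hs : s.Nodup) (r : Fin s.length)
    (h : s.idxOf (s.get r) < s.length) : (⟨s.idxOf (s.get r), h⟩ : Fin s.length) = r :=
  Fin.ext (hs.idxOf_getElem _ _)

/-- The matrix units on the qudits in `s` sum up to the operator `M` on these qudits. -/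
theorem sum_unitIn {s : List (Fin n)} (hs : s.Nodup)
    (M : Matrix (Fin s.length → Fin d) (Fin s.length → Fin d) ℂ) :
    ∑ u, ∑ u', M u u' • L.inTensor (L.unitIn s X u u') =
      onQudits s M ⊗ₖ sitesProd (L.sites s) X := by
  ext ⟨x, z⟩ ⟨x', z'⟩
  have key : ∀ u u' : Fin s.length → Fin d, L.inTensor (L.unitIn s X u u') (x, z) (x', z') =
      (if u = fun r => x (s.get r) then 1 else 0) * (if u' = fun r => x' (s.get r) then 1 else 0) *
      ((if ∀ i, i ∉ s → x i = x' i then 1 else 0) * sitesProd (L.sites s) X z z') := by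
    intro u u'
    -- separate the factors of the qudits from those of the ancilla spaces
    have hone : ∀ j, L.unitIn s X u u' (.inl j) (x j, z (.inl j)) (x' j, z' (.inl j)) =
        (if h : j ∈ s then
          (if u ⟨s.idxOf j, List.idxOf_lt_length_iff.2 h⟩ = x j then (1 : ℂ) else 0) *
          (if u' ⟨s.idxOf j, List.idxOf_lt_length_iff.2 h⟩ = x' j then (1 : ℂ) else 0) else 1) *
        ((if j ∈ s then 1 else if x j = x' j then 1 else 0) *
          (if (Sum.inl j : Fin n ⊕ Fin L.anc) ∈ L.sites s then X (.inl j) else 1)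
            (z (.inl j)) (z' (.inl j))) := by
      intro j
      by_cases h : j ∈ s
      · simp only [unitIn, h, dif_pos, inl_mem_sites, if_true, Matrix.kroneckerMap_apply,
          Matrix.single_apply, one_mul]
        congr 1
        split_ifs <;> simp_all
      · simp only [unitIn, h, dif_neg, inl_mem_sites, if_false, not_false_eq_true, one_mul,
          Matrix.one_apply, Prod.mk.injEq]
        split_ifs <;> simp_all
    have hprod : ∀ (v : Fin s.length → Fin d) (y : Fin n → Fin d),
        ∏ j, (if h : j ∈ s then
          (if v ⟨s.idxOf j, List.idxOf_lt_length_iff.2 h⟩ = y j then (1 : ℂ) else 0) else 1) =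
        if v = fun r => y (s.get r) then 1 else 0 := by
      intro v y
      have : ∀ j, (if h : j ∈ s then
          (if v ⟨s.idxOf j, List.idxOf_lt_length_iff.2 h⟩ = y j then (1 : ℂ) else 0) else 1) =
          if j ∈ s then (if ∀ h : j ∈ s, v ⟨s.idxOf j, List.idxOf_lt_length_iff.2 h⟩ = y j
            then (1 : ℂ) else 0) else 1 := by
        intro j
        by_cases h : j ∈ s <;> simp [h]
      simp only [this]
      rw [prod_mem_list hs]
      simp only [Finset.prod_ite_zero, Finset.prod_const_one, funext_iff, Finset.mem_univ,
        true_imp_iff, List.get_mem, idxOf_get' hs]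
    have hsplit : ∀ j, (if h : j ∈ s then
          (if u ⟨s.idxOf j, List.idxOf_lt_length_iff.2 h⟩ = x j then (1 : ℂ) else 0) *
          (if u' ⟨s.idxOf j, List.idxOf_lt_length_iff.2 h⟩ = x' j then (1 : ℂ) else 0) else 1) =
        (if h : j ∈ s then
          (if u ⟨s.idxOf j, List.idxOf_lt_length_iff.2 h⟩ = x j then (1 : ℂ) else 0) else 1) *
        (if h : j ∈ s then
          (if u' ⟨s.idxOf j, List.idxOf_lt_length_iff.2 h⟩ = x' j then (1 : ℂ) else 0) else 1) := by
      intro j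
      by_cases h : j ∈ s <;> simp [h]
    have hinl := Finset.prod_congr (s₁ := Finset.univ) rfl fun j _ => hone j
    simp only [hsplit, Finset.prod_mul_distrib, hprod] at hinl
    have hoff : ∏ j, (if j ∈ s then (1 : ℂ) else if x j = x' j then 1 else 0) =
        if ∀ i, i ∉ s → x i = x' i then 1 else 0 := by
      have : ∀ j, (if j ∈ s then (1 : ℂ) else if x j = x' j then 1 else 0) =
          if j ∉ s → x j = x' j then 1 else 0 := by
        intro j
        by_cases h : j ∈ s <;> simp [h]
      simp only [this, Finset.prod_ite_zero, Finset.prod_const_one, Finset.mem_univ, true_imp_iff]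
    have hanc : ∏ r, L.unitIn s X u u' (.inr r) (localIn x (.inr r), z (.inr r))
        (localIn x' (.inr r), z' (.inr r)) = ∏ r,
        (if (Sum.inr r : Fin n ⊕ Fin L.anc) ∈ L.sites s then X (.inr r) else 1)
          (z (.inr r)) (z' (.inr r)) := by
      refine Finset.prod_congr rfl fun r _ => ?_
      rw [if_neg (L.inr_notMem_sites s)]
      simp [unitIn, Matrix.one_apply, localIn]
    rw [hoff] at hinl
    have hS := Fintype.prod_sum_type fun i => (if i ∈ L.sites s then X i else 1) (z i) (z' i)
    rw [show sitesProd (L.sites s) X z z' = _ from hS]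
    refine (Fintype.prod_sum_type fun i => L.unitIn s X u u' i (localIn x i, z i)
      (localIn x' i, z' i)).trans ((congrArg₂ (· * ·) hinl hanc).trans ?_)
    ring
  simp only [Matrix.sum_apply, Matrix.smul_apply, key, smul_eq_mul, Matrix.kroneckerMap_apply,
    onQudits, Matrix.of_apply]
  rw [Finset.sum_eq_single (fun r => x (s.get r)), Finset.sum_eq_single (fun r => x' (s.get r))]
  · simp only [if_true, one_mul, ite_mul, zero_mul, mul_ite, mul_zero]
  · intro b _ hb
    simp only [if_neg hb, mul_zero, zero_mul]
  · simp
  · intro b _ hb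
    simp only [if_neg hb, mul_zero, zero_mul, Finset.sum_const_zero]
  · simp

/-- On the range of the isometry, the local operator on the blocks acts as `M` on the qudits in `s`. -/
theorem ideal_mul_isom {s : List (Fin n)} (hs : s.Nodup)
    (M : Matrix (Fin s.length → Fin d) (Fin s.length → Fin d) ℂ) :
    L.ideal s X M * L.isom = L.isom * (onQudits s M ⊗ₖ sitesProd (L.sites s) X) := by
  rw [← L.sum_unitIn X hs M, ideal, Matrix.sum_mul, Matrix.mul_sum]
  refine Finset.sum_congr rfl fun u _ => ?_
  rw [Matrix.sum_mul, Matrix.mul_sum]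
  refine Finset.sum_congr rfl fun u' _ => ?_
  rw [Matrix.smul_mul, Matrix.mul_smul, L.blockTensor_mul_isom (L.unitOut_mul_V s X u u')]

theorem onQudits_conj (s : List (Fin n))
    (M : Matrix (Fin s.length → Fin d) (Fin s.length → Fin d) ℂ) :
    (onQudits s M).map (starRingEnd ℂ) = onQudits s (M.map (starRingEnd ℂ)) := by
  ext x y
  simp only [onQudits, Matrix.map_apply, Matrix.of_apply]
  split_ifs <;> simp

/-- If `s` is nonempty, then `V (M ⊗ PE + M̄ ⊗ QE) V†` on the blocks of `s` acts on encoded states as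
the encoding of `M`: the products of the `PE i` and of the `QE i` over these blocks act as
identity on the ranges of `P` and `Q`, and they annihilate the ranges of `Q` and `P`. -/
theorem ideal_mul_encode_one {s : List (Fin n)} (hs : s.Nodup) (hne : s ≠ [])
    (M : Matrix (Fin s.length → Fin d) (Fin s.length → Fin d) ℂ) :
    (L.ideal s L.PE M + L.ideal s L.QE (M.map (starRingEnd ℂ))) * L.encode 1 =
      L.encode (onQudits s M) := by
  have hS : (L.sites s).Nonempty := by
    obtain ⟨j, hj⟩ := List.exists_mem_of_ne_nil s hne
    exact ⟨.inl j, (L.inl_mem_sites s).2 hj⟩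
  have h1 := sitesProd_mul_of_forall (L.sites s) L.onSite_mul_P
  have h2 := sitesProd_mul_of_forall (L.sites s) L.onSite_mul_Q
  have h3 := sitesProd_mul_eq_zero hS L.onSite_mul_Q L.PE_QE
  have h4 := sitesProd_mul_eq_zero hS L.onSite_mul_P L.QE_PE
  have hone : (1 : QOp d n).map (starRingEnd ℂ) = 1 := by
    ext; simp [Matrix.one_apply, apply_ite]
  rw [encode, encodeWith, encode, encodeWith, ← Matrix.mul_assoc, ← Matrix.mul_assoc,
    Matrix.add_mul, L.ideal_mul_isom _ hs, L.ideal_mul_isom _ hs, hone, ← Matrix.mul_add,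
    Matrix.mul_assoc L.isom]
  simp only [Matrix.add_mul, Matrix.mul_add, ← Matrix.mul_kronecker_mul, h1, h2, h3, h4,
    Matrix.mul_one, Matrix.kronecker_zero, add_zero, zero_add,
    onQudits_conj]

end Ideal
end LocalEncoding

/-! ### Operator norms -/

section

open scoped ComplexOrder
set_option linter.unusedSectionVars false

section Norms

variable {m n l : Type} [Fintype m] [Fintype n] [Fintype l] [DecidableEq m] [DecidableEq n]
  [DecidableEq l]

theorem norm_toLp_sq (v : n → ℂ) : ‖WithLp.toLp 2 v‖ ^ 2 = ∑ i, ‖v i‖ ^ 2 := by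
  rw [EuclideanSpace.norm_sq_eq]

theorem norm_mulVec_le (M : Matrix m n ℂ) (v : n → ℂ) :
    ‖WithLp.toLp 2 (M *ᵥ v)‖ ≤ ‖M‖ * ‖WithLp.toLp 2 v‖ :=
  Matrix.l2_opNorm_mulVec M (WithLp.toLp 2 v)

theorem norm_le_of_mulVec_le (M : Matrix m n ℂ) {c : ℝ} (hc : 0 ≤ c)
    (h : ∀ v, ‖WithLp.toLp 2 (M *ᵥ v)‖ ≤ c * ‖WithLp.toLp 2 v‖) : ‖M‖ ≤ c := by
  rw [Matrix.l2_opNorm_def]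
  refine ContinuousLinearMap.opNorm_le_bound _ hc fun v => ?_
  exact h v.ofLp

theorem norm_entry_le (M : Matrix m n ℂ) (i : m) (j : n) : ‖M i j‖ ≤ ‖M‖ := by
  have h1 := norm_mulVec_le M (Pi.single j (1 : ℂ) : n → ℂ)
  have h2 : ‖WithLp.toLp 2 (Pi.single j (1 : ℂ) : n → ℂ)‖ = 1 :=
    (PiLp.norm_single 2 (fun _ => ℂ) j (1 : ℂ)).trans norm_one
  have h3 : ‖M i j‖ ≤ ‖WithLp.toLp 2 (M *ᵥ (Pi.single j (1 : ℂ) : n → ℂ))‖ := by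
    have := PiLp.norm_apply_le (WithLp.toLp 2 (M *ᵥ (Pi.single j (1 : ℂ) : n → ℂ))) i
    simpa using this
  rw [h2, mul_one] at h1
  exact h3.trans h1

/-- Schur's test. -/
theorem norm_le_of_sum_le (M : Matrix m n ℂ) {c : ℝ} (hc : 0 ≤ c) (hr : ∀ i, ∑ j, ‖M i j‖ ≤ c)
    (hcol : ∀ j, ∑ i, ‖M i j‖ ≤ c) : ‖M‖ ≤ c := by
  refine norm_le_of_mulVec_le M hc fun v => ?_
  refine le_of_sq_le_sq ?_ (by positivity)
  rw [mul_pow, norm_toLp_sq, norm_toLp_sq]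
  have h1 : ∀ i, ‖(M *ᵥ v) i‖ ^ 2 ≤ c * ∑ j, ‖M i j‖ * ‖v j‖ ^ 2 := by
    intro i
    have h2 : ‖(M *ᵥ v) i‖ ≤ ∑ j, ‖M i j‖ * ‖v j‖ := by
      refine (norm_sum_le _ _).trans (Finset.sum_le_sum fun j _ => (norm_mul _ _).le)
    have h3 : (∑ j, ‖M i j‖ * ‖v j‖) ^ 2 ≤ (∑ j, ‖M i j‖) * ∑ j, ‖M i j‖ * ‖v j‖ ^ 2 :=
      Finset.sum_sq_le_sum_mul_sum_of_sq_le_mul _ (fun _ _ => norm_nonneg _)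
        (fun _ _ => by positivity) fun _ _ => le_of_eq (by ring)
    calc ‖(M *ᵥ v) i‖ ^ 2 ≤ (∑ j, ‖M i j‖ * ‖v j‖) ^ 2 := by gcongr
      _ ≤ _ := h3
      _ ≤ _ := by gcongr; exact hr i
  calc ∑ i, ‖(M *ᵥ v) i‖ ^ 2 ≤ ∑ i, c * ∑ j, ‖M i j‖ * ‖v j‖ ^ 2 :=
        Finset.sum_le_sum fun i _ => h1 i
    _ = c * ∑ j, (∑ i, ‖M i j‖) * ‖v j‖ ^ 2 := by
        rw [← Finset.mul_sum, Finset.sum_comm]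
        simp only [Finset.sum_mul]
    _ ≤ c * ∑ j, c * ‖v j‖ ^ 2 := by
        gcongr with j; exact hcol j
    _ = c ^ 2 * ∑ j, ‖v j‖ ^ 2 := by rw [← Finset.mul_sum]; ring

theorem norm_one_le : ‖(1 : Matrix n n ℂ)‖ ≤ 1 := by
  rw [← Matrix.diagonal_one, Matrix.l2_opNorm_diagonal]
  exact (pi_norm_le_iff_of_nonneg zero_le_one).2 fun i => by simp

theorem norm_le_one_of_isometry {W : Matrix m n ℂ} (h : Wᴴ * W = 1) : ‖W‖ ≤ 1 := by
  have := Matrix.l2_opNorm_conjTranspose_mul_self W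
  rw [h] at this
  have h1 := norm_one_le (n := n)
  nlinarith [norm_nonneg W]

theorem norm_le_one_of_isStarProjection {P : Matrix n n ℂ} (h : IsStarProjection P) : ‖P‖ ≤ 1 := by
  have := Matrix.l2_opNorm_conjTranspose_mul_self P
  rw [← Matrix.star_eq_conjTranspose, h.isSelfAdjoint.star_eq, h.isIdempotentElem.eq] at this
  by_contra! hn
  nlinarith [norm_nonneg P]

theorem norm_map_conj_le (M : Matrix m n ℂ) : ‖M.map (starRingEnd ℂ)‖ ≤ ‖M‖ := by
  refine norm_le_of_mulVec_le _ (norm_nonneg _) fun v => ?_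
  have h : ∀ {k : Type} [Fintype k] [DecidableEq k] (w : k → ℂ), ‖WithLp.toLp 2 (star w)‖ = ‖WithLp.toLp 2 w‖ := by
    intro k _ _ w
    rw [← sq_eq_sq₀ (norm_nonneg _) (norm_nonneg _), norm_toLp_sq, norm_toLp_sq]
    simp
  have h1 : M.map (starRingEnd ℂ) *ᵥ v = star (M *ᵥ star v) := by
    ext i
    simp [Matrix.mulVec, dotProduct]
  rw [h1, h, ← h v]
  exact norm_mulVec_le _ _

/-- The operator `M ⊗ 1` acts as `M` on each slice of a vector. -/
theorem norm_kronecker_one_le (M : Matrix m n ℂ) : ‖M ⊗ₖ (1 : Matrix l l ℂ)‖ ≤ ‖M‖ := by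
  refine norm_le_of_mulVec_le _ (norm_nonneg _) fun v => ?_
  refine le_of_sq_le_sq ?_ (by positivity)
  rw [mul_pow, norm_toLp_sq, norm_toLp_sq, Fintype.sum_prod_type_right, Fintype.sum_prod_type_right,
    Finset.mul_sum]
  refine Finset.sum_le_sum fun z _ => ?_
  have h1 : ∀ i, ((M ⊗ₖ (1 : Matrix l l ℂ)) *ᵥ v) (i, z) = (M *ᵥ fun j => v (j, z)) i := by
    intro i
    simp only [Matrix.mulVec, dotProduct, Fintype.sum_prod_type, Matrix.kroneckerMap_apply,
      Matrix.one_apply, mul_ite, mul_one, mul_zero, ite_mul, zero_mul, Finset.sum_ite_eq,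
      Finset.mem_univ, if_true]
  have h2 := norm_mulVec_le M fun j => v (j, z)
  have h3 := pow_le_pow_left₀ (norm_nonneg _) h2 2
  rw [mul_pow, norm_toLp_sq, norm_toLp_sq] at h3
  simpa only [h1] using h3

theorem isStarProjection_one_kronecker {P : Matrix l l ℂ} (h : IsStarProjection P) :
    IsStarProjection ((1 : Matrix m m ℂ) ⊗ₖ P) := by
  constructor
  · rw [IsIdempotentElem, ← Matrix.mul_kronecker_mul, h.isIdempotentElem.eq, Matrix.one_mul]
  · rw [IsSelfAdjoint, Matrix.star_eq_conjTranspose, Matrix.conjTranspose_kronecker,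
      Matrix.conjTranspose_one, ← Matrix.star_eq_conjTranspose, h.isSelfAdjoint.star_eq]

theorem norm_kronecker_le (M : Matrix m n ℂ) {P : Matrix l l ℂ} (h : IsStarProjection P) :
    ‖M ⊗ₖ P‖ ≤ ‖M‖ := by
  have h1 : M ⊗ₖ P = (M ⊗ₖ (1 : Matrix l l ℂ)) * ((1 : Matrix n n ℂ) ⊗ₖ P) := by
    rw [← Matrix.mul_kronecker_mul, Matrix.mul_one, Matrix.one_mul]
  rw [h1]
  refine (Matrix.l2_opNorm_mul _ _).trans ?_
  refine (mul_le_of_le_one_right (norm_nonneg _) ?_).trans (norm_kronecker_one_le M)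
  exact norm_le_one_of_isStarProjection (isStarProjection_one_kronecker h)

end Norms

section Encode

variable {d n d' n' : ℕ} {E : Type} [Fintype E] [DecidableEq E]
  {V W : Matrix (Fin n' → Fin d') ((Fin n → Fin d) × E) ℂ} {P Q : Matrix E E ℂ}

theorem norm_encode_inner_le (hP : IsStarProjection P) (hQ : IsStarProjection Q) (M : QOp d n) :
    ‖M ⊗ₖ P + M.map (starRingEnd ℂ) ⊗ₖ Q‖ ≤ 2 * ‖M‖ := by
  have h1 := norm_kronecker_le M hP
  have h2 := (norm_kronecker_le (M.map (starRingEnd ℂ)) hQ).trans (norm_map_conj_le M)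
  have h3 := norm_add_le (M ⊗ₖ P) (M.map (starRingEnd ℂ) ⊗ₖ Q)
  linarith

theorem norm_encodeWith_le (hV : Vᴴ * V = 1) (hP : IsStarProjection P) (hQ : IsStarProjection Q)
    (M : QOp d n) : ‖encodeWith V P Q M‖ ≤ 2 * ‖M‖ := by
  have h1 := norm_le_one_of_isometry hV
  have h2 := norm_encode_inner_le hP hQ M
  refine (Matrix.l2_opNorm_mul _ _).trans ?_
  rw [Matrix.l2_opNorm_conjTranspose]
  refine (mul_le_of_le_one_right (norm_nonneg _) h1).trans ((Matrix.l2_opNorm_mul _ _).trans ?_)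
  exact (mul_le_of_le_one_left (norm_nonneg _) h1).trans h2

/-- Nearby isometries define nearby encodings. -/
theorem norm_encodeWith_sub_le (hV : Vᴴ * V = 1) (hW : Wᴴ * W = 1) (hP : IsStarProjection P)
    (hQ : IsStarProjection Q) {η : ℝ} (h : ‖W - V‖ ≤ η) (M : QOp d n) :
    ‖encodeWith W P Q M - encodeWith V P Q M‖ ≤ 4 * η * ‖M‖ := by
  set X := M ⊗ₖ P + M.map (starRingEnd ℂ) ⊗ₖ Q with hX
  have hXn : ‖X‖ ≤ 2 * ‖M‖ := norm_encode_inner_le hP hQ M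
  have h1 : encodeWith W P Q M - encodeWith V P Q M =
      (W - V) * X * Wᴴ + V * X * (W - V)ᴴ := by
    simp only [encodeWith, ← hX, Matrix.conjTranspose_sub, Matrix.sub_mul, Matrix.mul_sub]
    abel
  have hη : 0 ≤ η := (norm_nonneg _).trans h
  have h2 : ‖(W - V) * X * Wᴴ‖ ≤ η * (2 * ‖M‖) * 1 := by
    refine (Matrix.l2_opNorm_mul _ _).trans ?_
    rw [Matrix.l2_opNorm_conjTranspose]
    gcongr
    · refine (Matrix.l2_opNorm_mul _ _).trans ?_
      gcongr
    · exact norm_le_one_of_isometry hW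
  have h3 : ‖V * X * (W - V)ᴴ‖ ≤ 1 * (2 * ‖M‖) * η := by
    refine (Matrix.l2_opNorm_mul _ _).trans ?_
    rw [Matrix.l2_opNorm_conjTranspose]
    gcongr
    refine (Matrix.l2_opNorm_mul _ _).trans ?_
    gcongr
    exact norm_le_one_of_isometry hV
  rw [h1]
  refine (norm_add_le _ _).trans ?_
  linarith

theorem encodeWith_add (M N : QOp d n) :
    encodeWith V P Q (M + N) = encodeWith V P Q M + encodeWith V P Q N := by
  simp only [encodeWith, Matrix.map_add _ (map_add (starRingEnd ℂ)), Matrix.add_kronecker,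
    ← Matrix.add_mul, ← Matrix.mul_add]
  congr 2
  abel

theorem encodeWith_smul (c : ℝ) (M : QOp d n) :
    encodeWith V P Q ((c : ℂ) • M) = (c : ℂ) • encodeWith V P Q M := by
  have : ((c : ℂ) • M).map (starRingEnd ℂ) = (c : ℂ) • M.map (starRingEnd ℂ) := by
    ext i j; simp
  simp only [encodeWith, this, Matrix.smul_kronecker, ← smul_add, Matrix.mul_smul, Matrix.smul_mul]

theorem posSemidef_of_isStarProjection {P : Matrix E E ℂ} (h : IsStarProjection P) :
    P.PosSemidef := by
  have := Matrix.posSemidef_conjTranspose_mul_self P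
  rwa [← Matrix.star_eq_conjTranspose, h.isSelfAdjoint.star_eq, h.isIdempotentElem.eq] at this

/-- Encodings are positive maps. -/
theorem encodeWith_posSemidef (hP : IsStarProjection P) (hQ : IsStarProjection Q) {M : QOp d n}
    (hM : M.PosSemidef) : (encodeWith V P Q M).PosSemidef := by
  have h1 : (M.map (starRingEnd ℂ)).PosSemidef := by
    have h2 : M.map (starRingEnd ℂ) = Mᵀ := by
      ext i j
      exact hM.isHermitian.apply j i
    rw [h2]; exact hM.transpose
  exact ((hM.kronecker (posSemidef_of_isStarProjection hP)).add
    (h1.kronecker (posSemidef_of_isStarProjection hQ))).mul_mul_conjTranspose_same V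

end Encode

/-! ### Operators that act on few qudits -/

/-- An operator that acts on the qudits in `s` only has at most `d ^ s.length` nonzero entries in each
row and column. -/
theorem norm_le_of_local {d n : ℕ} (s : List (Fin n)) (D : QOp d n) {c : ℝ} (hc : 0 ≤ c)
    (hoff : ∀ x y, ¬(∀ i, i ∉ s → x i = y i) → D x y = 0) (hle : ∀ x y, ‖D x y‖ ≤ c) :
    ‖D‖ ≤ (d : ℝ) ^ s.length * c := by
  have key : ∀ (f : (Fin n → Fin d) → ℝ) (x : Fin n → Fin d),
      (∀ y, ¬(∀ i, i ∉ s → x i = y i) → f y = 0) → (∀ y, f y ≤ c) →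
      ∑ y, f y ≤ (d : ℝ) ^ s.length * c := by
    intro f x h0 hf
    have h1 : ∑ y, f y = ∑ y with ∀ i, i ∉ s → x i = y i, f y := by
      rw [Finset.sum_filter]
      refine Finset.sum_congr rfl fun y _ => ?_
      split_ifs with h
      · rfl
      · exact h0 y h
    have h2 : (Finset.univ.filter fun y : Fin n → Fin d => ∀ i, i ∉ s → x i = y i).card ≤
        d ^ s.length := by
      have := Finset.card_le_card_of_injOn (s := Finset.univ.filter fun y : Fin n → Fin d =>
        ∀ i, i ∉ s → x i = y i) (t := (Finset.univ : Finset (Fin s.length → Fin d)))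
        (fun y r => y (s.get r)) (fun _ _ => by simp) ?_
      · simpa using this
      · intro y hy y' hy' h
        simp only [Finset.coe_filter, Finset.mem_univ, true_and, Set.mem_ofPred_eq] at hy hy'
        funext i
        by_cases hi : i ∈ s
        · obtain ⟨r, rfl⟩ := List.mem_iff_get.1 hi
          exact congrFun h r
        · rw [← hy i hi, ← hy' i hi]
    rw [h1]
    refine (Finset.sum_le_card_nsmul _ _ c fun y _ => hf y).trans ?_
    rw [nsmul_eq_mul]
    gcongr
    exact_mod_cast h2
  refine norm_le_of_sum_le D (by positivity) (fun x => ?_) fun y => ?_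
  · exact key (fun y => ‖D x y‖) x (fun y h => by rw [hoff x y h, norm_zero]) (hle x)
  · refine key (fun x => ‖D x y‖) y (fun x h => ?_) fun x => hle x y
    rw [hoff x y fun h' => h fun i hi => (h' i hi).symm, norm_zero]

/-- The matrix of a local term, on digit strings. -/
noncomputable def LocalTerm.core {d n : ℕ} (t : LocalTerm d n) :
    Matrix (Fin t.supp.length → Fin d) (Fin t.supp.length → Fin d) ℂ :=
  Matrix.of fun u u' => t.mat.toMatrix (finFunctionFinEquiv u) (finFunctionFinEquiv u')

theorem LocalTerm.op_eq {d n : ℕ} (t : LocalTerm d n) :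
    t.op = LocalEncoding.onQudits t.supp t.core := rfl

/-- Each entry of the matrix of a term is an entry of its operator. -/
theorem LocalTerm.norm_core_apply_le {d n : ℕ} (hd : 0 < d) (t : LocalTerm d n)
    (u u' : Fin t.supp.length → Fin d) : ‖t.core u u'‖ ≤ ‖t.op‖ := by
  let ext (u : Fin t.supp.length → Fin d) : Fin n → Fin d := fun j =>
    if h : j ∈ t.supp then u ⟨t.supp.idxOf j, List.idxOf_lt_length_iff.2 h⟩ else ⟨0, hd⟩
  have hext : ∀ u, (fun r => ext u (t.supp.get r)) = u := by
    intro u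
    funext r
    simp only [ext, List.get_mem, dif_pos, LocalEncoding.idxOf_get' t.nodup]
  have h := norm_entry_le t.op (ext u) (ext u')
  have h' : t.op (ext u) (ext u') = t.core u u' := by
    have hoff : ∀ i, i ∉ t.supp → ext u i = ext u' i := by
      intro i hi
      simp [ext, hi]
    rw [t.op_eq]
    simp only [LocalEncoding.onQudits, Matrix.of_apply]
    rw [if_pos hoff, hext, hext]
  rwa [h'] at h

end

/-! ### Energies -/

section

open scoped ComplexOrder
set_option linter.unusedSectionVars false

section Expect

variable {d n : ℕ} {M N : QOp d n} {ψ : (Fin n → Fin d) → ℂ}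

theorem expect_add : expect (M + N) ψ = expect M ψ + expect N ψ := by
  simp [expect, Matrix.add_mulVec, dotProduct_add]

theorem expect_sub : expect (M - N) ψ = expect M ψ - expect N ψ := by
  simp [expect, Matrix.sub_mulVec, dotProduct_sub]

theorem expect_neg : expect (-M) ψ = -expect M ψ := by
  simp [expect, Matrix.neg_mulVec, dotProduct_neg]

theorem expect_smul (c : ℝ) : expect ((c : ℂ) • M) ψ = c * expect M ψ := by
  simp [expect, Matrix.smul_mulVec, dotProduct_smul]

theorem expect_smul_vec (c : ℝ) : expect M ((c : ℂ) • ψ) = c ^ 2 * expect M ψ := by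
  simp only [expect, Matrix.mulVec_smul, dotProduct_smul, star_smul, smul_dotProduct, smul_eq_mul]
  rw [show star (c : ℂ) = c from Complex.conj_ofReal c, ← mul_assoc, ← Complex.ofReal_mul,
    Complex.re_ofReal_mul, sq]

theorem expect_nonneg (h : M.PosSemidef) : 0 ≤ expect M ψ :=
  (Complex.le_def.1 (h.dotProduct_mulVec_nonneg ψ)).1

theorem dotProduct_eq_inner (φ χ : (Fin n → Fin d) → ℂ) :
    star φ ⬝ᵥ χ = inner ℂ (WithLp.toLp 2 φ) (WithLp.toLp 2 χ) := by
  rw [EuclideanSpace.inner_toLp_toLp, dotProduct_comm]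

theorem expect_one : expect (1 : QOp d n) ψ = ‖WithLp.toLp 2 ψ‖ ^ 2 := by
  rw [expect, Matrix.one_mulVec, dotProduct_eq_inner, inner_self_eq_norm_sq_to_K]
  norm_cast

theorem isState_iff : IsState ψ ↔ ‖WithLp.toLp 2 ψ‖ = 1 := by
  rw [IsState, dotProduct_eq_inner, inner_self_eq_norm_sq_to_K, ← pow_eq_one_iff_of_nonneg
    (norm_nonneg _) two_ne_zero, ← Complex.ofReal_inj]
  simp

theorem abs_expect_le : |expect M ψ| ≤ ‖WithLp.toLp 2 ψ‖ * ‖WithLp.toLp 2 (M *ᵥ ψ)‖ := by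
  rw [expect, dotProduct_eq_inner]
  exact (Complex.abs_re_le_norm _).trans (norm_inner_le_norm _ _)

theorem abs_expect_le_norm (h : IsState ψ) : |expect M ψ| ≤ ‖M‖ := by
  have h1 := norm_mulVec_le M ψ
  have h2 := abs_expect_le (M := M) (ψ := ψ)
  rw [isState_iff] at h
  rw [h] at h1 h2
  linarith

theorem posSemidef_of_expect (hM : M.IsHermitian) (h : ∀ ψ, IsState ψ → 0 ≤ expect M ψ) :
    M.PosSemidef := by
  refine Matrix.PosSemidef.of_dotProduct_mulVec_nonneg hM fun v => ?_
  have him : (star v ⬝ᵥ M *ᵥ v).im = 0 := by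
    have := hM.im_star_dotProduct_mulVec_self v
    simpa using this
  refine Complex.le_def.2 ⟨?_, him.symm⟩
  change 0 ≤ expect M v
  by_cases hv : WithLp.toLp 2 v = 0
  · have : v = 0 := by
      have := congrArg WithLp.ofLp hv
      simpa using this
    simp [this, expect]
  · have h0 := norm_pos_iff.2 hv
    have hs : IsState (((‖WithLp.toLp 2 v‖⁻¹ : ℝ) : ℂ) • v) := by
      rw [isState_iff, WithLp.toLp_smul, norm_smul, Complex.norm_real, norm_inv, norm_norm,
        inv_mul_cancel₀ h0.ne']
    have h1 := h _ hs
    rw [expect_smul_vec] at h1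
    exact nonneg_of_mul_nonneg_right h1 (by positivity)

theorem spectral_form (hM : M.IsHermitian) : M = (hM.eigenvectorUnitary : QOp d n) *
    Matrix.diagonal (fun i => (hM.eigenvalues i : ℂ)) * (hM.eigenvectorUnitary : QOp d n)ᴴ := by
  conv_lhs => rw [hM.spectral_theorem, Unitary.conjStarAlgAut_apply]
  rfl

theorem groundEnergy_le_eigenvalues (hM : M.IsHermitian) (i) : groundEnergy M ≤ hM.eigenvalues i := by
  rw [groundEnergy, hM.spectrum_real_eq_range_eigenvalues]
  exact csInf_le (Set.finite_range _).bddBelow ⟨i, rfl⟩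

theorem exists_eigenvalues_eq_groundEnergy (hd : 0 < d) (hM : M.IsHermitian) :
    ∃ i, hM.eigenvalues i = groundEnergy M := by
  have : Nonempty (Fin n → Fin d) := ⟨fun _ => ⟨0, hd⟩⟩
  rw [groundEnergy, hM.spectrum_real_eq_range_eigenvalues]
  exact (Set.range_nonempty _).csInf_mem (Set.finite_range _)

theorem conj_unitary_posSemidef (hM : M.IsHermitian) {f : (Fin n → Fin d) → ℝ} (hf : ∀ i, 0 ≤ f i) :
    ((hM.eigenvectorUnitary : QOp d n) * Matrix.diagonal (fun i => (f i : ℂ)) *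
      (hM.eigenvectorUnitary : QOp d n)ᴴ).PosSemidef :=
  (Matrix.PosSemidef.diagonal fun i => by simpa using hf i).mul_mul_conjTranspose_same _

theorem unitary_mul_conjTranspose (hM : M.IsHermitian) :
    (hM.eigenvectorUnitary : QOp d n) * (hM.eigenvectorUnitary : QOp d n)ᴴ = 1 :=
  Unitary.coe_mul_star_self _

theorem conjTranspose_mul_unitary (hM : M.IsHermitian) :
    (hM.eigenvectorUnitary : QOp d n)ᴴ * (hM.eigenvectorUnitary : QOp d n) = 1 :=
  Unitary.coe_star_mul_self _

theorem sub_groundEnergy_posSemidef (hM : M.IsHermitian) :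
    (M - (groundEnergy M : ℂ) • (1 : QOp d n)).PosSemidef := by
  have h := conj_unitary_posSemidef hM (f := fun i => hM.eigenvalues i - groundEnergy M)
    fun i => sub_nonneg.2 (groundEnergy_le_eigenvalues hM i)
  convert h using 1
  have h1 : Matrix.diagonal (fun i => ((hM.eigenvalues i - groundEnergy M : ℝ) : ℂ)) =
      Matrix.diagonal (fun i => (hM.eigenvalues i : ℂ)) - (groundEnergy M : ℂ) • (1 : QOp d n) := by
    rw [← Matrix.diagonal_one, ← Matrix.diagonal_smul, Matrix.diagonal_sub]
    congr 1; funext i; simp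
  rw [h1, Matrix.mul_sub, Matrix.sub_mul, ← spectral_form hM, Matrix.mul_smul, Matrix.smul_mul,
    Matrix.mul_one, unitary_mul_conjTranspose]

theorem groundEnergy_le_expect (hM : M.IsHermitian) (h : IsState ψ) :
    groundEnergy M ≤ expect M ψ := by
  have := expect_nonneg (ψ := ψ) (sub_groundEnergy_posSemidef hM)
  rw [expect_sub, expect_smul, expect_one, isState_iff.1 h] at this
  linarith

theorem exists_ground_state (hd : 0 < d) (hM : M.IsHermitian) :
    ∃ ψ, IsState ψ ∧ expect M ψ = groundEnergy M := by
  obtain ⟨i, hi⟩ := exists_eigenvalues_eq_groundEnergy hd hM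
  have hs : IsState (hM.eigenvectorBasis i).ofLp := by
    rw [isState_iff]
    exact hM.eigenvectorBasis.norm_eq_one i
  refine ⟨(hM.eigenvectorBasis i).ofLp, hs, ?_⟩
  rw [expect, hM.mulVec_eigenvectorBasis, hi]
  have h1 : star (hM.eigenvectorBasis i).ofLp ⬝ᵥ (hM.eigenvectorBasis i).ofLp = 1 := hs
  rw [dotProduct_smul, h1]
  simp

theorem abs_groundEnergy_le (hd : 0 < d) (hM : M.IsHermitian) : |groundEnergy M| ≤ ‖M‖ := by
  obtain ⟨ψ, hψ, h⟩ := exists_ground_state hd hM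
  rw [← h]
  exact abs_expect_le_norm hψ

/-! ### The projector onto the low-energy space -/

theorem lowProj_isStarProjection (hM : M.IsHermitian) (Δ : ℝ) :
    IsStarProjection (lowProj hM Δ) := by
  constructor
  · have h : ∀ U D : QOp d n, Uᴴ * U = 1 → D * D = D → U * D * Uᴴ * (U * D * Uᴴ) = U * D * Uᴴ := by
      intro U D hU hD
      calc U * D * Uᴴ * (U * D * Uᴴ) = U * D * (Uᴴ * U) * D * Uᴴ := by simp only [Matrix.mul_assoc]
        _ = U * (D * D) * Uᴴ := by rw [hU, Matrix.mul_one, Matrix.mul_assoc U]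
        _ = _ := by rw [hD]
    refine h _ _ (conjTranspose_mul_unitary hM) ?_
    rw [Matrix.diagonal_mul_diagonal]
    congr 1; funext i; split_ifs <;> simp
  · rw [IsSelfAdjoint, lowProj, Matrix.star_eq_conjTranspose, Matrix.conjTranspose_mul,
      Matrix.conjTranspose_mul, Matrix.conjTranspose_conjTranspose, Matrix.diagonal_conjTranspose,
      Matrix.mul_assoc]
    congr 3
    funext i
    rw [Pi.star_apply, apply_ite star, star_one, star_zero]

/-- Outside of the low-energy space the energy is at least `Δ`. -/
theorem sub_lowProj_posSemidef (hM : M.IsHermitian) (Δ : ℝ) :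
    (M - lowProj hM Δ * M * lowProj hM Δ - (Δ : ℂ) • (1 - lowProj hM Δ)).PosSemidef := by
  have h := conj_unitary_posSemidef hM
    (f := fun i => if hM.eigenvalues i ≤ Δ then 0 else hM.eigenvalues i - Δ)
    fun i => by split_ifs with h <;> linarith
  convert h using 1
  have key : ∀ U D E : QOp d n, Uᴴ * U = 1 → U * Uᴴ = 1 →
      U * D * Uᴴ - U * E * Uᴴ * (U * D * Uᴴ) * (U * E * Uᴴ) - (Δ : ℂ) • (1 - U * E * Uᴴ) =
        U * (D - E * D * E - (Δ : ℂ) • (1 - E)) * Uᴴ := by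
    intro U D E h1 h2
    have h3 : U * E * Uᴴ * (U * D * Uᴴ) * (U * E * Uᴴ) = U * (E * D * E) * Uᴴ := by
      calc _ = U * E * (Uᴴ * U) * D * (Uᴴ * U) * E * Uᴴ := by simp only [Matrix.mul_assoc]
        _ = _ := by rw [h1]; simp only [Matrix.mul_one, Matrix.mul_assoc]
    rw [h3]
    simp only [Matrix.mul_sub, Matrix.sub_mul, Matrix.mul_smul, Matrix.smul_mul, Matrix.mul_one, h2]
  have h4 := key _ (Matrix.diagonal (fun i => (hM.eigenvalues i : ℂ)))
    (Matrix.diagonal (fun i => if hM.eigenvalues i ≤ Δ then (1 : ℂ) else 0))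
    (conjTranspose_mul_unitary hM) (unitary_mul_conjTranspose hM)
  rw [← spectral_form hM] at h4
  refine h4.trans ?_
  rw [Matrix.diagonal_mul_diagonal, Matrix.diagonal_mul_diagonal, ← Matrix.diagonal_one,
    Matrix.diagonal_sub, Matrix.diagonal_sub, ← Matrix.diagonal_smul, Matrix.diagonal_sub]
  congr 3
  funext i
  simp only [Pi.smul_apply, smul_eq_mul]
  split_ifs <;> simp

/-! ### Low-energy states of a simulation -/

/-- If `A` has expectation at most `a` in all low-energy states of `H`, then it is dominated by `a`
plus a multiple of the excess energy. -/
theorem dominated_of_lowEnergy {H A : QOp d n} (hH : H.IsHermitian) (hA : A.IsHermitian) {a δ : ℝ}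
    (hδ : 0 < δ) (ha : -‖A‖ ≤ a)
    (h : ∀ ψ, IsState ψ → expect H ψ ≤ groundEnergy H + δ → expect A ψ ≤ a) :
    ((a : ℂ) • (1 : QOp d n) + ((2 * ‖A‖ / δ : ℝ) : ℂ) • (H - (groundEnergy H : ℂ) • (1 : QOp d n)) -
      A).PosSemidef := by
  have hreal : ∀ (c : ℝ) {X : QOp d n}, X.IsHermitian → ((c : ℂ) • X).IsHermitian := by
    intro c X hX
    rw [Matrix.IsHermitian, Matrix.conjTranspose_smul, hX.eq]
    congr 1
    exact Complex.conj_ofReal c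
  refine posSemidef_of_expect ?_ fun ψ hψ => ?_
  · exact ((hreal _ Matrix.isHermitian_one).add
      (hreal _ (hH.sub (hreal _ Matrix.isHermitian_one)))).sub hA
  · rw [expect_sub, expect_add, expect_smul, expect_smul, expect_sub, expect_smul, expect_one,
      isState_iff.1 hψ]
    have h1 := groundEnergy_le_expect hH hψ
    have h2 : 0 ≤ 2 * ‖A‖ / δ := by positivity
    -- below `λ(H) + δ` the hypothesis applies; above, the multiple of the excess energy is at
    -- least `2‖A‖`
    by_cases hlow : expect H ψ ≤ groundEnergy H + δ
    · have h3 := h ψ hψ hlow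
      nlinarith [mul_nonneg h2 (sub_nonneg.2 h1)]
    · have h4 : 2 * ‖A‖ / δ * δ ≤ 2 * ‖A‖ / δ * (expect H ψ - groundEnergy H) := by
        gcongr; linarith
      rw [div_mul_cancel₀ _ hδ.ne'] at h4
      have h5 := (abs_le.1 (abs_expect_le_norm (M := A) hψ)).2
      nlinarith

end Expect

section Simulation

variable {d n d' n' : ℕ} {E : Type} [Fintype E] [DecidableEq E]
  {W : Matrix (Fin n' → Fin d') ((Fin n → Fin d) × E) ℂ} {P Q : Matrix E E ℂ}

theorem mul_eq_zero_of_isStarProjection (hP : IsStarProjection P) (hQ : IsStarProjection Q)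
    (h : P * Q = 0) : Q * P = 0 := by
  have := congrArg star h
  rwa [star_mul, hP.isSelfAdjoint.star_eq, hQ.isSelfAdjoint.star_eq, star_zero] at this

/-- Expectations of encoded operators in product states factorize. -/
theorem expect_encodeWith (hW : Wᴴ * W = 1) (M : QOp d n) (f : (Fin n → Fin d) → ℂ) (e : E → ℂ) :
    expect (encodeWith W P Q M) (W *ᵥ fun p => f p.1 * e p.2) =
      ((star f ⬝ᵥ M *ᵥ f) * (star e ⬝ᵥ P *ᵥ e) +
        (star f ⬝ᵥ M.map (starRingEnd ℂ) *ᵥ f) * (star e ⬝ᵥ Q *ᵥ e)).re := by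
  have hk : ∀ (X : QOp d n) (R : Matrix E E ℂ),
      star (fun p : (Fin n → Fin d) × E => f p.1 * e p.2) ⬝ᵥ ((X ⊗ₖ R) *ᵥ fun p => f p.1 * e p.2) =
        (star f ⬝ᵥ X *ᵥ f) * (star e ⬝ᵥ R *ᵥ e) := by
    intro X R
    simp only [dotProduct, Matrix.mulVec, Fintype.sum_prod_type, Matrix.kroneckerMap_apply,
      Pi.star_apply, star_mul']
    rw [Finset.sum_mul_sum]
    refine Finset.sum_congr rfl fun x _ => Finset.sum_congr rfl fun z _ => ?_
    have : ∑ x', ∑ z', X x x' * R z z' * (f x' * e z') =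
        (∑ x', X x x' * f x') * ∑ z', R z z' * e z' := by
      rw [Finset.sum_mul_sum]
      exact Finset.sum_congr rfl fun _ _ => Finset.sum_congr rfl fun _ _ => by ring
    rw [this]; ring
  rw [expect, encodeWith, ← hk, ← hk, ← dotProduct_add, ← Matrix.add_mulVec, Matrix.mulVec_mulVec,
    Matrix.mul_assoc, hW, Matrix.mul_one, ← Matrix.mulVec_mulVec, Matrix.star_mulVec,
    ← Matrix.dotProduct_mulVec, Matrix.mulVec_mulVec, hW, Matrix.one_mulVec]

/-- For each state of the encoded system some encoded state has the same expectations. -/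
theorem exists_encoded_state (hW : Wᴴ * W = 1) (hP : IsStarProjection P) (hQ : IsStarProjection Q)
    (hPQ : P * Q = 0) (hne : P + Q ≠ 0) (ψ : (Fin n → Fin d) → ℂ) :
    ∃ (χ : (Fin n' → Fin d') → ℂ) (r : ℝ), 0 < r ∧ ∀ M : QOp d n,
      expect (encodeWith W P Q M) χ = r * expect M ψ := by
  have hQP := mul_eq_zero_of_isStarProjection hP hQ hPQ
  -- a vector in the range of `P` or `Q` serves as the ancilla state; `Q` calls for the conjugate
  -- state
  have key : ∀ R : Matrix E E ℂ, IsStarProjection R → R ≠ 0 →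
      ∃ (e : E → ℂ) (r : ℝ), 0 < r ∧ R *ᵥ e = e ∧ star e ⬝ᵥ e = (r : ℂ) := by
    intro R hR hR0
    obtain ⟨w, hw⟩ : ∃ w, R *ᵥ w ≠ 0 := by
      by_contra! h
      exact hR0 (Matrix.mulVec_injective (funext fun w => by rw [h w, Matrix.zero_mulVec]))
    have h0 : 0 < star (R *ᵥ w) ⬝ᵥ (R *ᵥ w) := Matrix.dotProduct_star_self_pos_iff.2 hw
    refine ⟨R *ᵥ w, (star (R *ᵥ w) ⬝ᵥ (R *ᵥ w)).re, (Complex.lt_def.1 h0).1, ?_, ?_⟩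
    · rw [Matrix.mulVec_mulVec, hR.isIdempotentElem.eq]
    · exact Complex.ext rfl (Complex.lt_def.1 h0).2.symm
  by_cases hP0 : P = 0
  · have hQ0 : Q ≠ 0 := fun h => hne (by rw [hP0, h, add_zero])
    obtain ⟨e, r, hr, he, her⟩ := key Q hQ hQ0
    refine ⟨W *ᵥ fun p => star ψ p.1 * e p.2, r, hr, fun M => ?_⟩
    have h1 : star (star ψ) ⬝ᵥ M.map (starRingEnd ℂ) *ᵥ star ψ =
        (starRingEnd ℂ) (star ψ ⬝ᵥ M *ᵥ ψ) := by
      simp only [dotProduct, Matrix.mulVec, map_sum, map_mul, Pi.star_apply, Matrix.map_apply,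
        starRingEnd_apply, star_star]
    rw [expect_encodeWith hW, hP0, he, her, h1, Matrix.zero_mulVec, dotProduct_zero, mul_zero,
      zero_add, Complex.re_mul_ofReal, Complex.conj_re, mul_comm]
    rfl
  · obtain ⟨e, r, hr, he, her⟩ := key P hP hP0
    refine ⟨W *ᵥ fun p => ψ p.1 * e p.2, r, hr, fun M => ?_⟩
    have h2 : Q *ᵥ e = 0 := by
      rw [← he, Matrix.mulVec_mulVec, hQP, Matrix.zero_mulVec]
    rw [expect_encodeWith hW, he, her, h2, dotProduct_zero, mul_zero, add_zero,
      Complex.re_mul_ofReal, mul_comm]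
    rfl

/-- The ground energy of the simulating Hamiltonian exceeds that of the simulated one by at most
the error of the simulation. -/
theorem groundEnergy_simulation_le {H : QOp d n} {H' : QOp d' n'} (hd : 0 < d) (hH : H.IsHermitian)
    (hH' : H'.IsHermitian) {Δ ε : ℝ} (hW : Wᴴ * W = 1) (hP : IsStarProjection P)
    (hQ : IsStarProjection Q) (hPQ : P * Q = 0) (hne : P + Q ≠ 0)
    (hlow : encodeWith W P Q (1 : QOp d n) = lowProj hH' Δ)
    (hε : ‖lowProj hH' Δ * H' * lowProj hH' Δ - encodeWith W P Q H‖ ≤ ε) :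
    groundEnergy H' ≤ groundEnergy H + ε := by
  obtain ⟨ψ, hψ, hψe⟩ := exists_ground_state hd hH
  obtain ⟨χ, r, hr, hχ⟩ := exists_encoded_state hW hP hQ hPQ hne ψ
  set Λ := lowProj hH' Δ with hΛ
  have hproj := lowProj_isStarProjection hH' Δ
  rw [← hΛ] at hproj
  have hadj : Λᴴ = Λ := hproj.isSelfAdjoint
  have hidem : Λ * Λ = Λ := hproj.isIdempotentElem
  have h1 : expect Λ χ = r := by
    rw [← hlow, hχ, expect_one, isState_iff.1 hψ]; ring
  have h2 := hχ H
  -- replacing the vector by its image under the projector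
  have hvec : ∀ X : QOp d' n', expect (Λ * X * Λ) χ = expect X (Λ *ᵥ χ) := by
    intro X
    rw [expect, expect, Matrix.star_mulVec, hadj, ← Matrix.dotProduct_mulVec,
      Matrix.mulVec_mulVec, Matrix.mulVec_mulVec]
  have hnorm : ‖WithLp.toLp 2 (Λ *ᵥ χ)‖ ^ 2 = r := by
    rw [← expect_one, ← hvec, Matrix.mul_one, hidem, h1]
  have h3 := expect_nonneg (ψ := Λ *ᵥ χ) (sub_groundEnergy_posSemidef hH')
  rw [expect_sub, expect_smul, expect_one, hnorm, ← hvec] at h3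
  -- encoded operators live on the low-energy space
  have hc : Λ * encodeWith W P Q H * Λ = encodeWith W P Q H := by
    have hQP := mul_eq_zero_of_isStarProjection hP hQ hPQ
    have hin : ((1 : QOp d n) ⊗ₖ P + (1 : QOp d n) ⊗ₖ Q) *
        (H ⊗ₖ P + H.map (starRingEnd ℂ) ⊗ₖ Q) = H ⊗ₖ P + H.map (starRingEnd ℂ) ⊗ₖ Q := by
      simp only [Matrix.add_mul, Matrix.mul_add, ← Matrix.mul_kronecker_mul, Matrix.one_mul, hPQ,
        hQP, Matrix.kronecker_zero, hP.isIdempotentElem.eq, hQ.isIdempotentElem.eq, add_zero,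
        zero_add]
    have hin' : (H ⊗ₖ P + H.map (starRingEnd ℂ) ⊗ₖ Q) *
        ((1 : QOp d n) ⊗ₖ P + (1 : QOp d n) ⊗ₖ Q) = H ⊗ₖ P + H.map (starRingEnd ℂ) ⊗ₖ Q := by
      simp only [Matrix.add_mul, Matrix.mul_add, ← Matrix.mul_kronecker_mul, Matrix.mul_one, hPQ,
        hQP, Matrix.kronecker_zero, hP.isIdempotentElem.eq, hQ.isIdempotentElem.eq, add_zero,
        zero_add]
    have hone : (1 : QOp d n).map (starRingEnd ℂ) = 1 := by
      ext; simp [Matrix.one_apply, apply_ite]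
    rw [← hlow, encodeWith, encodeWith, hone]
    set X := H ⊗ₖ P + H.map (starRingEnd ℂ) ⊗ₖ Q
    set R := (1 : QOp d n) ⊗ₖ P + (1 : QOp d n) ⊗ₖ Q
    calc W * R * Wᴴ * (W * X * Wᴴ) * (W * R * Wᴴ)
        = W * (R * ((Wᴴ * W) * X) * ((Wᴴ * W) * R)) * Wᴴ := by simp only [Matrix.mul_assoc]
      _ = W * X * Wᴴ := by rw [hW, Matrix.one_mul, Matrix.one_mul, hin, hin']
  have h4 : |expect (Λ * H' * Λ - encodeWith W P Q H) (Λ *ᵥ χ)| ≤ ε * r := by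
    refine abs_expect_le.trans ?_
    have h5 := norm_mulVec_le (Λ * H' * Λ - encodeWith W P Q H) (Λ *ᵥ χ)
    have h6 : ‖WithLp.toLp 2 ((Λ * H' * Λ - encodeWith W P Q H) *ᵥ (Λ *ᵥ χ))‖ ≤
        ε * ‖WithLp.toLp 2 (Λ *ᵥ χ)‖ := h5.trans (by gcongr)
    calc _ ≤ ‖WithLp.toLp 2 (Λ *ᵥ χ)‖ * (ε * ‖WithLp.toLp 2 (Λ *ᵥ χ)‖) := by gcongr
      _ = ε * r := by rw [← hnorm]; ring
  have h7 : Λ * (Λ * H' * Λ) * Λ = Λ * H' * Λ := by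
    calc _ = (Λ * Λ) * H' * (Λ * Λ) := by simp only [Matrix.mul_assoc]
      _ = _ := by rw [hidem]
  rw [expect_sub, ← hvec, ← hvec, hc, h7, h2, hψe] at h4
  have h8 := (abs_le.1 h4).2
  have h9 : r * groundEnergy H' ≤ r * (groundEnergy H + ε) := by linarith
  exact le_of_mul_le_mul_left h9 hr

/-- The upper bound on the expectation of an observable in low-energy states is inherited by the
simulation. -/
theorem expect_le_of_simulation {H A : QOp d n} {H' A' : QOp d' n'} (hd : 0 < d)
    (hH : H.IsHermitian) (hH' : H'.IsHermitian) (hA : A.IsHermitian)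
    {Δ ε κ a δ θ : ℝ} (hW : Wᴴ * W = 1)
    (hP : IsStarProjection P) (hQ : IsStarProjection Q) (hPQ : P * Q = 0) (hne : P + Q ≠ 0)
    (hlow : encodeWith W P Q (1 : QOp d n) = lowProj hH' Δ)
    (hε : ‖lowProj hH' Δ * H' * lowProj hH' Δ - encodeWith W P Q H‖ ≤ ε)
    (hκ : ‖A' * encodeWith W P Q 1 - encodeWith W P Q A‖ ≤ κ)
    (hδ : 0 < δ) (hθ : 0 ≤ θ) (hΔ : groundEnergy H + ε + 1 ≤ Δ)
    (h : ∀ ψ, IsState ψ → expect H ψ ≤ groundEnergy H + δ → expect A ψ ≤ a)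
    {ψ : (Fin n' → Fin d') → ℂ} (hψ : IsState ψ) (hψe : expect H' ψ ≤ groundEnergy H' + θ ^ 2) :
    expect A' ψ ≤ a + (‖A‖ * θ ^ 2 + 2 * ‖A‖ / δ * (2 * ε + θ ^ 2) + κ + ‖A'‖ * θ) := by
  have ha : -‖A‖ ≤ a := by
    obtain ⟨φ, hφ, hφe⟩ := exists_ground_state hd hH
    exact (abs_le.1 (abs_expect_le_norm hφ)).1.trans (h φ hφ (by linarith))
  have hdom := dominated_of_lowEnergy hH hA hδ ha h
  have hg := groundEnergy_simulation_le hd hH hH' hW hP hQ hPQ hne hlow hε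
  have hε0 : 0 ≤ ε := (norm_nonneg _).trans hε
  have hsub := expect_nonneg (ψ := ψ) (sub_lowProj_posSemidef hH' Δ)
  have hproj := lowProj_isStarProjection hH' Δ
  have henc := expect_nonneg (ψ := ψ) (encodeWith_posSemidef (V := W) hP hQ hdom)
  have hε' := abs_le.1 (abs_expect_le_norm
    (M := lowProj hH' Δ * H' * lowProj hH' Δ - encodeWith W P Q H) hψ)
  have hκ' := abs_le.1 (abs_expect_le_norm
    (M := A' * encodeWith W P Q 1 - encodeWith W P Q A) hψ)
  replace hε' := (neg_le_neg hε).trans hε'.1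
  replace hκ' := hκ'.2.trans hκ
  set Λ := lowProj hH' Δ with hΛ
  rw [hlow] at hκ'
  have hadj : Λᴴ = Λ := hproj.isSelfAdjoint
  have hidem : Λ * Λ = Λ := hproj.isIdempotentElem
  have hone := isState_iff.1 hψ
  have hgap : 0 ≤ expect (Λ * (H' - (groundEnergy H' : ℂ) • 1) * Λ) ψ := by
    refine expect_nonneg ?_
    have := (sub_groundEnergy_posSemidef hH').mul_mul_conjTranspose_same Λ
    rwa [hadj] at this
  rw [Matrix.mul_sub, Matrix.sub_mul, expect_sub, Matrix.mul_smul, Matrix.smul_mul, expect_smul,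
    Matrix.mul_one, hidem] at hgap
  rw [expect_sub, expect_sub, expect_smul, expect_sub, expect_one, hone] at hsub
  have hneg : ∀ X Y : QOp d n, encodeWith W P Q (X - Y) = encodeWith W P Q X - encodeWith W P Q Y := by
    intro X Y
    have := encodeWith_add (V := W) (P := P) (Q := Q) (X - Y) Y
    rw [sub_add_cancel] at this
    rw [this, add_sub_cancel_right]
  rw [hneg, encodeWith_add, encodeWith_smul, encodeWith_smul, hneg, encodeWith_smul, hlow, expect_sub,
    expect_add, expect_smul, expect_smul, expect_sub, expect_smul] at henc
  rw [expect_sub] at hε' hκ'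
  -- the weight of the state outside of the low-energy space
  have hnorm : ‖WithLp.toLp 2 ((1 - Λ) *ᵥ ψ)‖ ^ 2 = 1 - expect Λ ψ := by
    have h1 : (1 - Λ)ᴴ * (1 - Λ) = 1 - Λ := by
      rw [Matrix.conjTranspose_sub, Matrix.conjTranspose_one, hadj, Matrix.mul_sub, Matrix.sub_mul,
        Matrix.sub_mul, hidem]
      simp
    have h2 : expect (1 : QOp d' n') ((1 - Λ) *ᵥ ψ) = expect (1 - Λ) ψ := by
      rw [expect, expect, Matrix.one_mulVec, Matrix.star_mulVec, ← Matrix.dotProduct_mulVec,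
        Matrix.mulVec_mulVec, h1]
    rw [← expect_one, h2, expect_sub, expect_one, hone, one_pow]
  set p := 1 - expect Λ ψ with hp
  have hp0 : 0 ≤ p := by rw [← hnorm]; positivity
  have hpΛ : expect Λ ψ = 1 - p := by rw [hp]; ring
  have hsub' : expect (Λ * H' * Λ) ψ ≤ groundEnergy H' + θ ^ 2 - Δ * p := by
    rw [hpΛ] at hsub; linarith
  -- the gap between `λ(H')` and `Δ` is at least `1`
  have hpθ : p ≤ θ ^ 2 := by
    rw [hpΛ] at hgap
    have : 1 * p ≤ (Δ - groundEnergy H') * p := by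
      gcongr; linarith
    nlinarith
  -- the excess energy with respect to the encoded Hamiltonian
  have hexc : expect (encodeWith W P Q H) ψ - groundEnergy H * (1 - p) ≤ 2 * ε + θ ^ 2 := by
    have : 0 ≤ (Δ - groundEnergy H) * p := mul_nonneg (by linarith) hp0
    nlinarith
  have hEA : expect (encodeWith W P Q A) ψ ≤ a + ‖A‖ * θ ^ 2 + 2 * ‖A‖ / δ * (2 * ε + θ ^ 2) := by
    rw [hpΛ] at henc
    have h1 : 2 * ‖A‖ / δ * (expect (encodeWith W P Q H) ψ - groundEnergy H * (1 - p)) ≤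
        2 * ‖A‖ / δ * (2 * ε + θ ^ 2) := by gcongr
    have h2 : -a * p ≤ ‖A‖ * θ ^ 2 := by
      calc -a * p ≤ ‖A‖ * p := by gcongr; linarith
        _ ≤ _ := by gcongr
    nlinarith
  have hsplit : expect A' ψ = expect (A' * Λ) ψ + expect (A' * (1 - Λ)) ψ := by
    rw [← expect_add, ← Matrix.mul_add, add_sub_cancel, Matrix.mul_one]
  -- the part outside of the low-energy space has norm `√p ≤ θ`
  have hrest : expect (A' * (1 - Λ)) ψ ≤ ‖A'‖ * θ := by
    refine (le_abs_self _).trans (abs_expect_le.trans ?_)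
    rw [hone, one_mul, ← Matrix.mulVec_mulVec]
    refine (norm_mulVec_le _ _).trans ?_
    gcongr
    refine le_of_sq_le_sq ?_ hθ
    rw [hnorm]; exact hpθ
  rw [hsplit]
  linarith

end Simulation

end

/-! ### Data of matrices, terms and blocks -/

/-- The data of a matrix. -/
def GMat.raw {R C : ℕ} (M : GMat R C) : RawMat :=
  (M.den, List.ofFn fun r => List.ofFn fun c => (⟨(M.num r c).1, (M.num r c).2⟩ : GaussianInt))

theorem GMat.enc_raw {R C : ℕ} (M : GMat R C) : Word.enc M.raw = M.enc := by
  simp only [GMat.raw, GMat.enc, Word.enc, List.map_ofFn, Function.comp_def]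

theorem getD_ofFn {α : Type} {n : ℕ} (f : Fin n → α) (i : ℕ) (a : α) :
    (List.ofFn f).getD i a = if h : i < n then f ⟨i, h⟩ else a := by
  split_ifs with h
  · rw [List.getD_eq_getElem _ _ (by simpa using h)]; simp
  · rw [List.getD_eq_default _ _ (by simpa using h)]

/-- The stored integers are the entries multiplied by the denominator. -/
theorem GMat.toComplex_entryAt {R C : ℕ} (M : GMat R C) (i j : ℕ) :
    ((entryAt M.raw.2 i j : GaussianInt) : ℂ) = M.den * M.entry i j := by
  have hd : (M.den : ℂ) ≠ 0 := Nat.cast_ne_zero.2 M.den_pos.ne'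
  simp only [entryAt, GMat.raw, getD_ofFn, GMat.entry]
  by_cases hi : i < R
  · by_cases hj : j < C
    · rw [dif_pos hi, getD_ofFn, dif_pos hj, dif_pos ⟨hi, hj⟩, GMat.toMatrix, Matrix.of_apply,
        mul_div_cancel₀ _ hd, GaussianInt.toComplex_def']
    · rw [dif_pos hi, getD_ofFn, dif_neg hj, dif_neg (fun h => hj h.2)]; simp
  · rw [dif_neg hi, dif_neg (fun h => hi h.1)]; simp

theorem bind_pure_val {m : ℕ} (l : List (Fin m)) :
    (l >>= fun a => pure (a : ℕ)) = l.map Fin.val := by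
  rw [bind_pure_comp, List.map_eq_map]

/-- The data of a block. -/
def BlockData.raw {d d' n' : ℕ} (B : BlockData d d' n') : RawBlock :=
  (B.tgt.map Fin.val, B.dimE, B.V.raw, B.PE.raw, B.QE.raw, ())

theorem BlockData.enc_raw {d d' n' : ℕ} (B : BlockData d d' n') : Word.enc B.raw = B.enc := by
  have h1 := B.V.enc_raw
  have h2 := B.PE.enc_raw
  have h3 := B.QE.enc_raw
  simp only [BlockData.raw, BlockData.enc, Word.enc, bind_pure_val, List.map_map, encList] at *
  rw [← h1, ← h2, ← h3]

/-- The data of a local term. -/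
def LocalTerm.raw {d n : ℕ} (t : LocalTerm d n) : RawTerm :=
  (t.supp.map Fin.val, t.mat.raw)

theorem LocalTerm.enc_raw {d n : ℕ} (t : LocalTerm d n) : Word.enc t.raw = t.enc := by
  have h1 := t.mat.enc_raw
  simp only [LocalTerm.raw, LocalTerm.enc, Word.enc, bind_pure_val, List.map_map] at *
  rw [← h1]

/-- The data of a local operator. -/
def LocalOp.raw {d n : ℕ} (H : LocalOp d n) : RawHam :=
  (List.replicate n (), H.terms.map LocalTerm.raw)

theorem LocalOp.enc_raw {d n : ℕ} (H : LocalOp d n) : Word.enc H.raw = H.enc := by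
  have h1 : ∀ t : LocalTerm d n, Word.enc t.raw = t.enc := LocalTerm.enc_raw
  change Val.pair _ (encList ((H.terms.map LocalTerm.raw).map Word.enc)) = _
  rw [LocalOp.enc, List.map_map, List.map_congr_left (f := Word.enc ∘ LocalTerm.raw)
    (g := LocalTerm.enc) fun t _ => h1 t]
  congr 1
  change encList ((List.replicate n ()).map Word.enc) = _
  rw [List.map_replicate]
  rfl

section Correctness

variable {d d' n n' : ℕ}

/-- The number of the digit string that a basis state shows on a list of qudits. -/
def code (y : Fin n' → Fin d') (l : List (Fin n')) : ℕ := Nat.ofDigits d' (l.map fun w => (y w : ℕ))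

theorem code_append (y : Fin n' → Fin d') (l₁ l₂ : List (Fin n')) :
    code y (l₁ ++ l₂) = code y l₁ + d' ^ l₁.length * code y l₂ := by
  rw [code, List.map_append, Nat.ofDigits_append, List.length_map]; rfl

theorem code_eq_finFunctionFinEquiv (y : Fin n' → Fin d') (l : List (Fin n')) :
    (finFunctionFinEquiv (fun r => y (l.get r)) : ℕ) = code y l := by
  rw [finFunctionFinEquiv_apply]
  induction l with
  | nil => simp [code]
  | cons w l ih =>
    have : code y (w :: l) = y w + d' * code y l := by simp [code, Nat.ofDigits_cons]
    rw [this, ← ih]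
    refine (Fin.sum_univ_succ (n := l.length) _).trans ?_
    rw [Finset.mul_sum]
    congr 1
    · simp
    · refine Finset.sum_congr rfl fun r _ => ?_
      change (y (l.get r) : ℕ) * d' ^ ((r : ℕ) + 1) = _
      ring

theorem code_lt (y : Fin n' → Fin d') (l : List (Fin n')) : code y l < d' ^ l.length := by
  rw [← code_eq_finFunctionFinEquiv]
  exact (finFunctionFinEquiv _).2

theorem BlockData.rows_raw (hd' : 0 < d') (B : BlockData d d' n') :
    B.raw.rows = d' ^ B.tgt.length := by
  change max 1 (List.ofFn _).length = _
  rw [List.length_ofFn]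
  exact max_eq_right (Nat.one_le_pow _ _ hd')

/-- The digits in mixed radix of the number of a basis state are the numbers of its parts on the
blocks. -/
theorem tensorEntry_code (hd' : 0 < d') (N : RawBlock → Indices → GaussianInt)
    (block : Fin n → BlockData d d' n') (y y' : Fin n' → Fin d') (s : List (Fin n))
    (u u' : Fin s.length → Fin d) :
    tensorEntry d N (s.map fun j => (block j).raw)
      (code y (s.flatMap fun j => (block j).tgt), code y' (s.flatMap fun j => (block j).tgt),
        finFunctionFinEquiv u, finFunctionFinEquiv u') =
    ∏ r : Fin s.length, N (block (s.get r)).raw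
      (code y (block (s.get r)).tgt, code y' (block (s.get r)).tgt, u r, u' r) := by
  induction s with
  | nil => simp [tensorEntry]
  | cons j s ih =>
    have hx : ∀ v : Fin (j :: s).length → Fin d, (finFunctionFinEquiv v : ℕ) =
        (v ⟨0, Nat.succ_pos _⟩ : ℕ) + d * (finFunctionFinEquiv (fun r : Fin s.length => v r.succ) : ℕ) := by
      intro v
      rw [finFunctionFinEquiv_apply, finFunctionFinEquiv_apply, Finset.mul_sum]
      refine (Fin.sum_univ_succ (n := s.length) _).trans ?_
      congr 1
      · change (v ⟨0, Nat.succ_pos _⟩ : ℕ) * d ^ 0 = _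
        simp
      · refine Finset.sum_congr rfl fun r _ => ?_
        change (v r.succ : ℕ) * d ^ ((r : ℕ) + 1) = _
        ring
    rw [hx u, hx u', List.map_cons, tensorEntry, List.flatMap_cons, code_append, code_append]
    have hdig : ∀ {a b m : ℕ}, a < m → (a + m * b) % m = a := fun h => by
      rw [Nat.add_mul_mod_self_left, Nat.mod_eq_of_lt h]
    have hshift : ∀ {a b m : ℕ}, a < m → (a + m * b) / m = b := fun h => by
      rw [Nat.add_mul_div_left _ _ (by omega), Nat.div_eq_of_lt h, zero_add]
    simp only [RawBlock.digit, RawBlock.shift, BlockData.rows_raw hd', hdig (code_lt _ _),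
      hshift (code_lt _ _), hdig (Fin.is_lt _), hshift (Fin.is_lt _)]
    rw [ih]
    exact (Fin.prod_univ_succ (n := s.length) fun r => N (block ((j :: s).get r)).raw
      (code y (block ((j :: s).get r)).tgt, code y' (block ((j :: s).get r)).tgt, u r, u' r)).symm

/-- An entry of `V (|x⟩⟨x'| ⊗ X) V†` for the described isometry `V`. -/
noncomputable def BlockData.entry (B : BlockData d d' n') (X : GMat B.dimE B.dimE) (r r' x x' : ℕ) : ℂ :=
  ∑ z ∈ Finset.range B.dimE, ∑ z' ∈ Finset.range B.dimE,
    B.V.entry r (z + B.dimE * x) * X.entry z z' * (starRingEnd ℂ) (B.V.entry r' (z' + B.dimE * x'))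

theorem list_range_sum {M : Type} [AddCommMonoid M] (f : ℕ → M) (m : ℕ) :
    ((List.range m).map f).sum = ∑ i ∈ Finset.range m, f i := by
  induction m with
  | zero => simp
  | succ m ih => simp [List.range_succ, Finset.sum_range_succ, ih]

theorem BlockData.toComplex_blockNum (B : BlockData d d' n') (X : GMat B.dimE B.dimE) (i : Indices) :
    ((blockNum B.dimE B.V.raw.2 X.raw.2 i : GaussianInt) : ℂ) =
      B.V.den * B.V.den * X.den * B.entry X i.1 i.2.1 i.2.2.1 i.2.2.2 := by
  have hl : X.raw.2.length = B.dimE := List.length_ofFn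
  rw [blockNum, hl]
  simp only [list_range_sum, map_sum, map_mul, GaussianInt.toComplex_star, GMat.toComplex_entryAt,
    BlockData.entry, Finset.mul_sum, Complex.conj_natCast]
  refine Finset.sum_congr rfl fun z _ => Finset.sum_congr rfl fun z' _ => ?_
  ring

theorem BlockData.toComplex_numP (B : BlockData d d' n') (i : Indices) :
    ((B.raw.numP i : GaussianInt) : ℂ) =
      B.raw.den * B.entry B.PE i.1 i.2.1 i.2.2.1 i.2.2.2 := by
  have h := B.toComplex_blockNum B.PE i
  have h2 : (B.raw.den : ℂ) = B.V.den * B.V.den * (B.PE.den * B.QE.den) := by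
    change ((B.V.den * B.V.den * (B.PE.den * B.QE.den) : ℕ) : ℂ) = _
    push_cast; rfl
  have h3 : ((B.raw.numP i : GaussianInt) : ℂ) =
      B.QE.den * ((blockNum B.dimE B.V.raw.2 B.PE.raw.2 i : GaussianInt) : ℂ) := by
    rw [← map_natCast GaussianInt.toComplex, ← map_mul]; rfl
  rw [h3, h, h2]; ring

theorem BlockData.toComplex_numQ (B : BlockData d d' n') (i : Indices) :
    ((B.raw.numQ i : GaussianInt) : ℂ) =
      B.raw.den * B.entry B.QE i.1 i.2.1 i.2.2.1 i.2.2.2 := by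
  have h := B.toComplex_blockNum B.QE i
  have h2 : (B.raw.den : ℂ) = B.V.den * B.V.den * (B.PE.den * B.QE.den) := by
    change ((B.V.den * B.V.den * (B.PE.den * B.QE.den) : ℕ) : ℂ) = _
    push_cast; rfl
  have h3 : ((B.raw.numQ i : GaussianInt) : ℂ) =
      B.PE.den * ((blockNum B.dimE B.V.raw.2 B.QE.raw.2 i : GaussianInt) : ℂ) := by
    rw [← map_natCast GaussianInt.toComplex, ← map_mul]; rfl
  rw [h3, h, h2]; ring

theorem BlockData.den_raw_pos (B : BlockData d d' n') : 0 < B.raw.den :=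
  Nat.mul_pos (Nat.mul_pos B.V.den_pos B.V.den_pos) (Nat.mul_pos B.PE.den_pos B.QE.den_pos)

/-- The target qudits of the blocks of a list of qudits. -/
def targets (block : Fin n → BlockData d d' n') (s : List (Fin n)) : List (Fin n') :=
  s.flatMap fun j => (block j).tgt

/-- An entry of `⨂ V (A ⊗ (⨂ P) + Ā ⊗ (⨂ Q)) ⨂ V†` for the described blocks. -/
noncomputable def approxEntry (t : LocalTerm d n) (block : Fin n → BlockData d d' n')
    (y y' : Fin n' → Fin d') : ℂ :=
  ∑ u, ∑ u', (t.core u u' * ∏ r, (block (t.supp.get r)).entry (block (t.supp.get r)).PE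
      (code y (block (t.supp.get r)).tgt) (code y' (block (t.supp.get r)).tgt) (u r) (u' r) +
    (starRingEnd ℂ) (t.core u u') * ∏ r, (block (t.supp.get r)).entry (block (t.supp.get r)).QE
      (code y (block (t.supp.get r)).tgt) (code y' (block (t.supp.get r)).tgt) (u r) (u' r))

theorem sum_range_pow {M : Type} [AddCommMonoid M] (f : ℕ → M) (d k : ℕ) :
    ∑ x ∈ Finset.range (d ^ k), f x = ∑ u : Fin k → Fin d, f (finFunctionFinEquiv u : ℕ) := by
  rw [Finset.sum_range, ← Equiv.sum_comp finFunctionFinEquiv]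

theorem LocalTerm.entry_eq_core (t : LocalTerm d n) (u u' : Fin t.supp.length → Fin d) :
    t.mat.entry (finFunctionFinEquiv u) (finFunctionFinEquiv u') = t.core u u' := by
  rw [GMat.entry, dif_pos ⟨Fin.is_lt _, Fin.is_lt _⟩]
  rfl

/-- The integer matrix computed by the algorithm is the approximate image of the term, multiplied by
the denominators. -/
theorem toComplex_termNum (hd' : 0 < d') (t : LocalTerm d n) (block : Fin n → BlockData d d' n')
    (y y' : Fin n' → Fin d') :
    ((termNum d t.mat.raw.2 (t.supp.map fun j => (block j).raw) (code y (targets block t.supp))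
      (code y' (targets block t.supp)) : GaussianInt) : ℂ) =
    t.mat.den * ((t.supp.map fun j => (block j).raw).map RawBlock.den).prod *
      approxEntry t block y y' := by
  have hl : t.mat.raw.2.length = d ^ t.supp.length := List.length_ofFn
  have hden : ((((t.supp.map fun j => (block j).raw).map RawBlock.den).prod : ℕ) : ℂ) =
      ∏ r : Fin t.supp.length, ((block (t.supp.get r)).raw.den : ℂ) := by
    rw [List.map_map, ← Nat.cast_prod, ← List.prod_ofFn]
    congr 2
    conv_lhs => rw [← List.ofFn_get t.supp, List.map_ofFn]
    rfl
  rw [termNum, hl, hden]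
  simp only [list_range_sum, sum_range_pow, targets, tensorEntry_code hd']
  simp only [map_sum, map_add, map_mul, map_prod, GaussianInt.toComplex_star,
    GMat.toComplex_entryAt, LocalTerm.entry_eq_core, BlockData.toComplex_numP,
    BlockData.toComplex_numQ, Complex.conj_natCast, Finset.prod_mul_distrib, approxEntry,
    Finset.mul_sum]
  refine Finset.sum_congr rfl fun u _ => Finset.sum_congr rfl fun u' _ => ?_
  ring

theorem prod_rows (hd' : 0 < d') (block : Fin n → BlockData d d' n') (s : List (Fin n)) :
    ((s.map fun j => (block j).raw).map RawBlock.rows).prod = d' ^ (targets block s).length := by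
  induction s with
  | nil => simp [targets]
  | cons j s ih =>
    rw [List.map_cons, List.map_cons, List.prod_cons, ih, BlockData.rows_raw hd', ← pow_add,
      targets, targets, List.flatMap_cons, List.length_append]

theorem length_targets_le {block : Fin n → BlockData d d' n'} {K : ℕ}
    (hK : ∀ j, (block j).tgt.length ≤ K) (s : List (Fin n)) :
    (targets block s).length ≤ K * s.length := by
  induction s with
  | nil => simp [targets]
  | cons j s ih =>
    have := hK j
    rw [targets, List.flatMap_cons, List.length_append, List.length_cons, mul_add]
    rw [targets] at ih
    omega

/-- This bound makes `K * d'` an exponent for which the cut-off in `outRows` is without effect. -/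
theorem pow_le_pow_mul (hd : 2 ≤ d) (K k : ℕ) : d' ^ (K * k) ≤ (d ^ k) ^ (K * d') := by
  rw [← pow_mul]
  calc d' ^ (K * k) ≤ (2 ^ d') ^ (K * k) := Nat.pow_le_pow_left Nat.lt_two_pow_self.le _
    _ ≤ (d ^ d') ^ (K * k) := Nat.pow_le_pow_left (Nat.pow_le_pow_left hd _) _
    _ = _ := by rw [← pow_mul]; congr 1; ring

/-- The factor by which a term with empty support would be counted too often. -/
def emptyFactor (s : List (Fin n)) : ℕ := if s.length = 0 then 2 else 1

theorem emptyFactor_pos (s : List (Fin n)) : 0 < emptyFactor s := by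
  unfold emptyFactor; split_ifs <;> norm_num

/-- The new term that is obtained from a term and a description of the blocks. -/
def outTerm (t : LocalTerm d n) (block : Fin n → BlockData d d' n')
    (hnd : (targets block t.supp).Nodup) : LocalTerm d' n' where
  supp := targets block t.supp
  nodup := hnd
  mat :=
    { num := fun r r' =>
        let z := termNum d t.mat.raw.2 (t.supp.map fun j => (block j).raw) r r' +
          star (termNum d t.mat.raw.2 (t.supp.map fun j => (block j).raw) r' r)
        (z.re, z.im)
      den := outDen t.mat.den (t.supp.map fun j => (block j).raw)
      den_pos := by
        refine Nat.mul_pos two_pos (Nat.mul_pos (by split_ifs <;> norm_num)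
          (Nat.mul_pos t.mat.den_pos (List.prod_pos ?_)))
        intro m hm
        simp only [List.map_map, List.mem_map] at hm
        obtain ⟨j, _, rfl⟩ := hm
        exact (block j).den_raw_pos }
  herm := by
    ext r r'
    simp only [Matrix.conjTranspose_apply, GMat.toMatrix, Matrix.of_apply, RCLike.star_def, map_div₀,
      map_add, map_mul, Complex.conj_natCast, Complex.conj_I, map_intCast]
    simp only [Zsqrtd.re_add, Zsqrtd.im_add, Zsqrtd.re_star, Zsqrtd.im_star]
    push_cast
    ring

/-- The algorithm on lists computes the new term. -/
theorem outTerm_raw (hd : 2 ≤ d) (hd' : 0 < d') (t : LocalTerm d n)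
    (block : Fin n → BlockData d d' n') (hnd : (targets block t.supp).Nodup) {K : ℕ}
    (hK : ∀ j, (block j).tgt.length ≤ K) :
    (outTerm t block hnd).raw =
      blocksTerm d (K * d') t.mat.raw (t.supp.map fun j => (block j).raw) := by
  have hrows : outRows (K * d') t.mat.raw.2.length (t.supp.map fun j => (block j).raw) =
      d' ^ (targets block t.supp).length := by
    have hl : t.mat.raw.2.length = d ^ t.supp.length := List.length_ofFn
    rw [outRows, prod_rows hd', hl]
    refine min_eq_left ?_
    exact (Nat.pow_le_pow_right hd' (length_targets_le hK t.supp)).trans (pow_le_pow_mul hd _ _)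
  have hofFn : ∀ {α : Type} (m : ℕ) (f : ℕ → α),
      (List.ofFn fun i : Fin m => f i) = (List.range m).map f := by
    intro α m f
    refine List.ext_getElem (by simp) fun i h1 h2 => by simp
  rw [blocksTerm, hrows, LocalTerm.raw, GMat.raw]
  refine Prod.ext ?_ (Prod.ext rfl ?_)
  · change (t.supp.flatMap _).map _ = _
    rw [List.map_flatMap, List.flatMap_map]
    rfl
  · rw [← hofFn]
    simp only [← hofFn]
    rfl

/-- The new term is the Hermitian part of the approximate image. -/
theorem outTerm_op_apply (hd' : 0 < d') (t : LocalTerm d n)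
    (block : Fin n → BlockData d d' n') (hnd : (targets block t.supp).Nodup)
    (y y' : Fin n' → Fin d') :
    (outTerm t block hnd).op y y' = if ∀ w, w ∉ targets block t.supp → y w = y' w then
      (approxEntry t block y y' + (starRingEnd ℂ) (approxEntry t block y' y)) /
        (2 * emptyFactor t.supp) else 0 := by
  have hden0 : ((((t.supp.map fun j => (block j).raw).map RawBlock.den).prod : ℕ) : ℂ) ≠ 0 := by
    rw [Nat.cast_ne_zero]
    refine (List.prod_pos ?_).ne'
    intro m hm
    simp only [List.map_map, List.mem_map] at hm
    obtain ⟨j, _, rfl⟩ := hm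
    exact (block j).den_raw_pos
  have hA0 : (t.mat.den : ℂ) ≠ 0 := Nat.cast_ne_zero.2 t.mat.den_pos.ne'
  have he0 : (emptyFactor t.supp : ℂ) ≠ 0 := Nat.cast_ne_zero.2 (emptyFactor_pos _).ne'
  rw [LocalTerm.op, Matrix.of_apply]
  refine if_congr Iff.rfl ?_ rfl
  have hmat : ∀ r r', (outTerm t block hnd).mat.toMatrix r r' =
      ((termNum d t.mat.raw.2 (t.supp.map fun j => (block j).raw) r r' +
        star (termNum d t.mat.raw.2 (t.supp.map fun j => (block j).raw) r' r) : GaussianInt) : ℂ) /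
      (outDen t.mat.den (t.supp.map fun j => (block j).raw) : ℕ) := by
    intro r r'
    rw [GaussianInt.toComplex_def]
    rfl
  have hout : ((outDen t.mat.den (t.supp.map fun j => (block j).raw) : ℕ) : ℂ) =
      2 * (emptyFactor t.supp * (t.mat.den *
        ((t.supp.map fun j => (block j).raw).map RawBlock.den).prod)) := by
    rw [outDen, List.length_map, emptyFactor]
    push_cast
    rfl
  rw [hmat, hout, map_add, GaussianInt.toComplex_star]
  have h1 := code_eq_finFunctionFinEquiv y (targets block t.supp)
  have h2 := code_eq_finFunctionFinEquiv y' (targets block t.supp)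
  change ((termNum d _ _ (finFunctionFinEquiv fun r => y ((targets block t.supp).get r) : ℕ)
    (finFunctionFinEquiv fun r => y' ((targets block t.supp).get r) : ℕ) : ℂ) + (starRingEnd ℂ)
      (termNum d _ _ (finFunctionFinEquiv fun r => y' ((targets block t.supp).get r) : ℕ)
        (finFunctionFinEquiv fun r => y ((targets block t.supp).get r) : ℕ) : ℂ)) / _ = _
  rw [h1, h2, toComplex_termNum hd', toComplex_termNum hd', map_mul, map_mul, Complex.conj_natCast,
    Complex.conj_natCast]
  field_simp

end Correctness

/-! ### Accuracy of the transformed observable -/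

/-- Factors are exchanged one at a time. -/
theorem norm_prod_sub_prod_le {ι : Type} (S : Finset ι) (f g : ι → ℂ) {c η : ℝ} (hc : 1 ≤ c)
    (hη : 0 ≤ η) (hf : ∀ i, ‖f i‖ ≤ c) (hg : ∀ i, ‖g i‖ ≤ c) (h : ∀ i, ‖f i - g i‖ ≤ c * η) :
    ‖∏ i ∈ S, f i - ∏ i ∈ S, g i‖ ≤ S.card * c ^ S.card * η := by
  classical
  induction S using Finset.induction_on with
  | empty => simp
  | insert i S hi ih =>
    rw [Finset.prod_insert hi, Finset.prod_insert hi, Finset.card_insert_of_notMem hi]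
    have h1 : f i * ∏ i ∈ S, f i - g i * ∏ i ∈ S, g i =
        (f i - g i) * ∏ i ∈ S, f i + g i * (∏ i ∈ S, f i - ∏ i ∈ S, g i) := by ring
    have h2 : ‖∏ i ∈ S, f i‖ ≤ c ^ S.card := by
      rw [norm_prod]
      exact (Finset.prod_le_prod (fun _ _ => norm_nonneg _) fun i _ => hf i).trans (by simp)
    rw [h1]
    calc _ ≤ ‖f i - g i‖ * ‖∏ i ∈ S, f i‖ + ‖g i‖ * ‖∏ i ∈ S, f i - ∏ i ∈ S, g i‖ := by
          refine (norm_add_le _ _).trans ?_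
          rw [norm_mul, norm_mul]
      _ ≤ (c * η) * c ^ S.card + c * (S.card * c ^ S.card * η) := by
          gcongr
          · exact h i
          · exact hg i
      _ = _ := by push_cast; ring

theorem norm_mul_mul_sub_le {a b c a' b' c' : ℂ} {η : ℝ} (hη : η ≤ 1) (ha : ‖a‖ ≤ 1) (hb : ‖b‖ ≤ 1)
    (hc : ‖c‖ ≤ 1) (ha' : ‖a - a'‖ ≤ η) (hb' : ‖b - b'‖ ≤ η) (hc' : ‖c - c'‖ ≤ η) :
    ‖a' * b' * c' - a * b * c‖ ≤ 8 * η ∧ ‖a' * b' * c'‖ ≤ 8 := by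
  have hη0 : 0 ≤ η := (norm_nonneg _).trans ha'
  have key : ∀ {x x' : ℂ}, ‖x‖ ≤ 1 → ‖x - x'‖ ≤ η → ‖x'‖ ≤ 2 := by
    intro x x' h1 h2
    have := norm_sub_norm_le x' x
    rw [norm_sub_rev] at this
    linarith
  have h1 := key ha ha'
  have h2 := key hb hb'
  have h3 := key hc hc'
  rw [norm_sub_rev] at ha' hb' hc'
  constructor
  · have h4 : a' * b' * c' - a * b * c = (a' - a) * b' * c' + a * (b' - b) * c' + a * b * (c' - c) := by
      ring
    rw [h4]
    calc _ ≤ ‖a' - a‖ * ‖b'‖ * ‖c'‖ + ‖a‖ * ‖b' - b‖ * ‖c'‖ + ‖a‖ * ‖b‖ * ‖c' - c‖ := by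
          refine (norm_add₃_le).trans ?_
          simp only [norm_mul, le_refl]
      _ ≤ η * 2 * 2 + 1 * η * 2 + 1 * 1 * η := by gcongr
      _ ≤ 8 * η := by linarith
  · rw [norm_mul, norm_mul]
    calc _ ≤ (2 : ℝ) * 2 * 2 := by gcongr
      _ = 8 := by norm_num

theorem norm_sum_sum_le {α β : Type} [Fintype α] [Fintype β] (f : α → β → ℂ) {c : ℝ}
    (h : ∀ a b, ‖f a b‖ ≤ c) :
    ‖∑ a, ∑ b, f a b‖ ≤ Fintype.card α * (Fintype.card β * c) := by
  refine (norm_sum_le _ _).trans ?_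
  refine (Finset.sum_le_card_nsmul _ _ (Fintype.card β * c) fun a _ => ?_).trans (by simp)
  refine (norm_sum_le _ _).trans ?_
  exact (Finset.sum_le_card_nsmul _ _ c fun b _ => h a b).trans (by simp)

namespace LocalEncoding

variable {d n d' n' : ℕ} (L : LocalEncoding d n d' n')

theorem dim_le (j : Fin n) : d * L.dimE (.inl j) ≤ d' ^ (L.tgt (.inl j)).length := by
  have h1 := Matrix.rank_mul_le_right (L.V (.inl j))ᴴ (L.V (.inl j))
  have h2 := Matrix.rank_le_card_height (L.V (.inl j))
  rw [L.V_isometry, Matrix.rank_one] at h1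
  have h3 := h1.trans h2
  rw [Fintype.card_prod, Fintype.card_fin, Fintype.card_fin, Fintype.card_fun, Fintype.card_fin,
    Fintype.card_fin] at h3
  exact h3

theorem dimE_le (hd : 0 < d) (hd' : 0 < d') {K : ℕ} (hK : L.BlocksLe K) (j : Fin n) :
    L.dimE (.inl j) ≤ d' ^ K := by
  have h1 := L.dim_le j
  have h2 := Nat.pow_le_pow_right hd' (hK (.inl j))
  have h3 := Nat.le_mul_of_pos_left (L.dimE (.inl j)) hd
  omega

/-- The entries of `V (|a⟩⟨a'| ⊗ X) V†` for the block of the qudit `j`. -/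
noncomputable def blockEntry (j : Fin n) (X : Matrix (Fin (L.dimE (.inl j))) (Fin (L.dimE (.inl j))) ℂ)
    (y y' : Fin n' → Fin d') (a a' : Fin d) : ℂ :=
  ∑ z, ∑ z', L.V (.inl j) (L.part y (.inl j)) (a, z) * X z z' *
    (starRingEnd ℂ) (L.V (.inl j) (L.part y' (.inl j)) (a', z'))

theorem blockEntry_eq (j : Fin n) (X : Matrix (Fin (L.dimE (.inl j))) (Fin (L.dimE (.inl j))) ℂ)
    (y y' : Fin n' → Fin d') (a a' : Fin d) :
    (L.V (.inl j) * (Matrix.single a a' (1 : ℂ) ⊗ₖ X) * (L.V (.inl j))ᴴ) (L.part y (.inl j))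
      (L.part y' (.inl j)) = L.blockEntry j X y y' a a' := by
  rw [Matrix.mul_assoc]
  simp only [Matrix.mul_apply, Matrix.kroneckerMap_apply, Fintype.sum_prod_type, Matrix.single_apply,
    Matrix.conjTranspose_apply, blockEntry, Finset.mul_sum]
  rw [Finset.sum_eq_single a (fun b _ hb => by simp [hb.symm]) (by simp)]
  refine Finset.sum_congr rfl fun z _ => ?_
  rw [Finset.sum_eq_single a' (fun b _ hb => by simp [hb.symm]) (by simp)]
  refine Finset.sum_congr rfl fun z' _ => ?_
  simp only [and_self, if_true, one_mul, mul_assoc]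
  rfl

theorem notMem_targets_iff {s : List (Fin n)} (w : Fin n') :
    w ∉ s.flatMap (fun j => L.tgt (.inl j)) ↔ ∀ i, w ∈ L.tgt i → i ∉ L.sites s := by
  constructor
  · intro h i hi hs
    rcases i with j | r
    · rw [inl_mem_sites] at hs
      exact h (List.mem_flatMap.2 ⟨j, hs, hi⟩)
    · exact L.inr_notMem_sites s hs
  · intro h hw
    obtain ⟨j, hj, hw⟩ := List.mem_flatMap.1 hw
    exact h _ hw ((L.inl_mem_sites s).2 hj)

/-- A tensor product over all blocks that is the identity on all blocks but those of `s`. -/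
theorem blockTensor_unitOut_apply {s : List (Fin n)} (hs : s.Nodup)
    (X : ∀ i, Matrix (Fin (L.dimE i)) (Fin (L.dimE i)) ℂ) (u u' : Fin s.length → Fin d)
    (y y' : Fin n' → Fin d') :
    L.blockTensor (L.unitOut s X u u') y y' =
      if ∀ w, w ∉ s.flatMap (fun j => L.tgt (.inl j)) → y w = y' w then
        ∏ r, L.blockEntry (s.get r) (X (.inl (s.get r))) y y' (u r) (u' r) else 0 := by
  let g : Fin n ⊕ Fin L.anc → ℂ := fun i => match i with
    | .inl j => if h : j ∈ s then L.blockEntry j (X (.inl j)) y y'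
        (u ⟨s.idxOf j, List.idxOf_lt_length_iff.2 h⟩)
        (u' ⟨s.idxOf j, List.idxOf_lt_length_iff.2 h⟩) else 1
    | .inr _ => 1
  have h1 : ∀ i, L.unitOut s X u u' i (L.part y i) (L.part y' i) =
      (if i ∉ L.sites s → L.part y i = L.part y' i then 1 else 0) * g i := by
    intro i
    rcases i with j | r
    · by_cases hj : j ∈ s
      · have hm := (L.inl_mem_sites s).2 hj
        simp only [unitOut, unitIn, g, hm, if_true, dif_pos hj, not_true_eq_false, false_imp_iff,
          one_mul]
        exact L.blockEntry_eq j _ y y' _ _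
      · have hm : (Sum.inl j : Fin n ⊕ Fin L.anc) ∉ L.sites s :=
          fun h => hj ((L.inl_mem_sites s).1 h)
        simp only [unitOut, g, hm, if_false, dif_neg hj, not_false_eq_true, true_imp_iff, mul_one]
        exact Matrix.one_apply
    · have hm := L.inr_notMem_sites s (r := r)
      simp only [unitOut, g, hm, if_false, not_false_eq_true, true_imp_iff, mul_one]
      exact Matrix.one_apply
  have h2 : ∏ i, g i = ∏ r, L.blockEntry (s.get r) (X (.inl (s.get r))) y y' (u r) (u' r) := by
    rw [Fintype.prod_sum_type]
    simp only [g, Finset.prod_const_one, mul_one]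
    symm
    refine Fintype.prod_of_injective s.get hs.injective_get _ _ ?_ ?_
    · intro j hj
      rw [dif_neg]
      intro h
      obtain ⟨r, hr⟩ := List.mem_iff_get.1 h
      exact hj ⟨r, hr⟩
    · intro r
      rw [dif_pos (List.get_mem _ _), idxOf_get' hs]
  have h3 : (∀ i, i ∉ L.sites s → L.part y i = L.part y' i) ↔
      ∀ w, w ∉ s.flatMap (fun j => L.tgt (.inl j)) → y w = y' w := by
    constructor
    · intro h w hw
      obtain ⟨i, hi, _⟩ := L.tgt_partition w
      obtain ⟨r, rfl⟩ := List.mem_iff_get.1 hi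
      exact congrFun (h i ((L.notMem_targets_iff _).1 hw i hi)) r
    · intro h i hi
      funext r
      refine h _ ((L.notMem_targets_iff _).2 fun i' hi' => ?_)
      obtain ⟨k, _, hk⟩ := L.tgt_partition ((L.tgt i).get r)
      rw [hk i' hi', ← hk i (List.get_mem _ _)]
      exact hi
  rw [blockTensor, Matrix.of_apply, Finset.prod_congr rfl fun i _ => h1 i, Finset.prod_mul_distrib,
    h2, Finset.prod_ite_zero]
  simp only [Finset.prod_const_one, Finset.mem_univ, true_imp_iff, h3, ite_mul, one_mul, zero_mul]

/-- The entries of the exact image of a local term, up to the condition that the basis states agree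
outside of the blocks in question. -/
noncomputable def exactEntry (t : LocalTerm d n) (y y' : Fin n' → Fin d') : ℂ :=
  ∑ u, ∑ u', (t.core u u' * ∏ r, L.blockEntry (t.supp.get r) (L.PE _) y y' (u r) (u' r) +
    (starRingEnd ℂ) (t.core u u') * ∏ r, L.blockEntry (t.supp.get r) (L.QE _) y y' (u r) (u' r))

theorem ideal_apply (t : LocalTerm d n) (y y' : Fin n' → Fin d') :
    (L.ideal t.supp L.PE t.core + L.ideal t.supp L.QE (t.core.map (starRingEnd ℂ))) y y' =
      if ∀ w, w ∉ t.supp.flatMap (fun j => L.tgt (.inl j)) → y w = y' w then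
        L.exactEntry t y y' else 0 := by
  simp only [ideal, Matrix.add_apply, Matrix.sum_apply, Matrix.smul_apply, smul_eq_mul,
    L.blockTensor_unitOut_apply t.nodup, Matrix.map_apply]
  split_ifs with h
  · simp only [exactEntry, Finset.sum_add_distrib]
  · simp

theorem _root_.ApxSim.LocalTerm.core_conj (t : LocalTerm d n) (u u' : Fin t.supp.length → Fin d) :
    (starRingEnd ℂ) (t.core u u') = t.core u' u :=
  t.herm.apply _ _

theorem blockEntry_conj (j : Fin n) {X : Matrix (Fin (L.dimE (.inl j))) (Fin (L.dimE (.inl j))) ℂ}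
    (hX : IsStarProjection X) (y y' : Fin n' → Fin d') (a a' : Fin d) :
    (starRingEnd ℂ) (L.blockEntry j X y y' a a') = L.blockEntry j X y' y a' a := by
  have hX' : ∀ z z', (starRingEnd ℂ) (X z z') = X z' z := fun z z' =>
    congrFun (congrFun hX.isSelfAdjoint.star_eq z') z
  simp only [blockEntry, map_sum, map_mul, Complex.conj_conj, hX']
  rw [Finset.sum_comm]
  refine Finset.sum_congr rfl fun z _ => Finset.sum_congr rfl fun z' _ => by ring

theorem exactEntry_conj (t : LocalTerm d n) (y y' : Fin n' → Fin d') :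
    (starRingEnd ℂ) (L.exactEntry t y y') = L.exactEntry t y' y := by
  simp only [exactEntry, map_sum, map_add, map_mul, map_prod, L.blockEntry_conj _ (L.PE_proj _),
    L.blockEntry_conj _ (L.QE_proj _), t.core_conj]
  rw [Finset.sum_comm]

end LocalEncoding

section Accuracy

variable {d n d' : ℕ} {o : SimOutput d n d'} {L : LocalEncoding d n d' o.n'} {η : ℝ}

theorem targets_eq (h : o.Describes L η) (s : List (Fin n)) :
    targets o.block s = s.flatMap fun j => L.tgt (.inl j) := by
  rw [targets]
  congr 1
  funext j
  rw [(h j).1]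

theorem targets_nodup (h : o.Describes L η) {s : List (Fin n)} (hs : s.Nodup) :
    (targets o.block s).Nodup := by
  rw [targets_eq h, List.nodup_flatMap]
  refine ⟨fun j _ => L.tgt_nodup _, hs.imp fun {j j'} hne w hw hw' => hne ?_⟩
  obtain ⟨i, _, hi⟩ := L.tgt_partition w
  exact Sum.inl_injective ((hi _ hw).trans (hi _ hw').symm)

theorem length_tgt_le (h : o.Describes L η) {K : ℕ} (hK : L.BlocksLe K) (j : Fin n) :
    (o.block j).tgt.length ≤ K := by
  rw [← (h j).1]; exact hK _

/-- The constant by which entries of block operators are bounded. -/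
noncomputable def blockBound (d' K : ℕ) : ℝ := 8 * ((d' : ℝ) ^ K) ^ 2

theorem one_le_blockBound (hd' : 0 < d') (K : ℕ) : 1 ≤ blockBound d' K := by
  have h1 : (1 : ℝ) ≤ (d' : ℝ) ^ K := one_le_pow₀ (by exact_mod_cast hd')
  have h2 : (1 : ℝ) ≤ ((d' : ℝ) ^ K) ^ 2 := one_le_pow₀ h1
  unfold blockBound; linarith

/-- Entries of `V (|a⟩⟨a'| ⊗ X) V†` and of its approximation are double sums over the ancilla space,
whose dimension is at most `d' ^ K`, of products of three numbers that are known up to `η`. -/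
theorem blockEntry_bounds (hd : 0 < d) (hd' : 0 < d') (h : o.Describes L η) (hη : η ≤ 1) {K : ℕ}
    (hK : L.BlocksLe K) (j : Fin n) {X : Matrix (Fin (L.dimE (.inl j))) (Fin (L.dimE (.inl j))) ℂ}
    (hX : IsStarProjection X) {G : GMat (o.block j).dimE (o.block j).dimE}
    (hG : ‖X - Matrix.of (fun z z' : Fin _ => G.entry z.val z'.val)‖ ≤ η)
    (y y' : Fin o.n' → Fin d') (a a' : Fin d) :
    ‖(o.block j).entry G (code y (o.block j).tgt) (code y' (o.block j).tgt) a a' -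
        L.blockEntry j X y y' a a'‖ ≤ blockBound d' K * η ∧
      ‖(o.block j).entry G (code y (o.block j).tgt) (code y' (o.block j).tgt) a a'‖ ≤
        blockBound d' K ∧ ‖L.blockEntry j X y y' a a'‖ ≤ blockBound d' K := by
  obtain ⟨h1, h2, h3, -, -⟩ := h j
  have hη0 : 0 ≤ η := (norm_nonneg _).trans h3
  set Vt : Matrix (Fin (L.tgt (.inl j)).length → Fin d') (Fin (inDim d (.inl j : Fin n ⊕ Fin L.anc)) × Fin (L.dimE (.inl j))) ℂ :=
    Matrix.of (fun y c => (o.block j).V.entry (finFunctionFinEquiv y) (finProdFinEquiv c)) with hVt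
  have hentry : (o.block j).entry G (code y (o.block j).tgt) (code y' (o.block j).tgt) a a' =
      ∑ z : Fin (L.dimE (.inl j)), ∑ z' : Fin (L.dimE (.inl j)),
        Vt (L.part y (.inl j)) (a, z) * G.entry z z' *
          (starRingEnd ℂ) (Vt (L.part y' (.inl j)) (a', z')) := by
    have hcode : ∀ y : Fin o.n' → Fin d', code y (o.block j).tgt =
        finFunctionFinEquiv (L.part y (.inl j)) := by
      intro y
      rw [← h1]
      exact (code_eq_finFunctionFinEquiv y _).symm
    simp only [BlockData.entry, hcode, ← h2, Finset.sum_range]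
    rfl
  have hV : ∀ w c, ‖L.V (.inl j) w c‖ ≤ 1 := fun w c =>
    (norm_entry_le _ w c).trans (norm_le_one_of_isometry (L.V_isometry _))
  have hVd : ∀ w c, ‖L.V (.inl j) w c - Vt w c‖ ≤ η := fun w c =>
    (norm_entry_le (L.V (.inl j) - Vt) w c).trans h3
  have hXd : ∀ z z', ‖X z z' - G.entry z z'‖ ≤ η := fun z z' =>
    (norm_entry_le (X - Matrix.of (fun z z' : Fin _ => G.entry z.val z'.val)) z z').trans hG
  have hX1 : ∀ z z', ‖X z z'‖ ≤ 1 := fun z z' =>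
    (norm_entry_le _ z z').trans (norm_le_one_of_isStarProjection hX)
  have hVc : ∀ w c, ‖(starRingEnd ℂ) (L.V (.inl j) w c)‖ ≤ 1 := fun w c => by
    rw [Complex.norm_conj]; exact hV w c
  have hVdc : ∀ w c, ‖(starRingEnd ℂ) (L.V (.inl j) w c) - (starRingEnd ℂ) (Vt w c)‖ ≤ η :=
    fun w c => by rw [← map_sub, Complex.norm_conj]; exact hVd w c
  have hdim : ((L.dimE (.inl j) : ℕ) : ℝ) ≤ (d' : ℝ) ^ K := by
    exact_mod_cast L.dimE_le hd hd' hK j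
  have hsum : ∀ (f : Fin (L.dimE (.inl j)) → Fin (L.dimE (.inl j)) → ℂ) {c : ℝ}, 0 ≤ c →
      (∀ z z', ‖f z z'‖ ≤ 8 * c) → ‖∑ z, ∑ z', f z z'‖ ≤ blockBound d' K * c := by
    intro f c hc hf
    refine (norm_sum_sum_le f hf).trans ?_
    rw [Fintype.card_fin]
    calc _ ≤ (d' : ℝ) ^ K * ((d' : ℝ) ^ K * (8 * c)) := by gcongr
      _ = _ := by unfold blockBound; ring
  refine ⟨?_, ?_, ?_⟩
  · rw [hentry, LocalEncoding.blockEntry]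
    simp only [← Finset.sum_sub_distrib]
    exact hsum _ hη0 fun z z' => (norm_mul_mul_sub_le hη (hV _ _) (hX1 z z') (hVc _ _) (hVd _ _)
      (hXd z z') (hVdc _ _)).1
  · rw [hentry, ← mul_one (blockBound d' K)]
    exact hsum _ zero_le_one fun z z' => ((norm_mul_mul_sub_le hη (hV _ _) (hX1 z z') (hVc _ _)
      (hVd _ _) (hXd z z') (hVdc _ _)).2).trans (by norm_num)
  · rw [LocalEncoding.blockEntry, ← mul_one (blockBound d' K)]
    refine hsum _ zero_le_one fun z z' => ?_
    rw [norm_mul, norm_mul]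
    calc _ ≤ (1 : ℝ) * 1 * 1 := by
          gcongr
          · exact hV _ _
          · exact hX1 _ _
          · exact hVc _ _
      _ ≤ _ := by norm_num

/-- The error of an entry is linear in `η`, with a factor that is exponential only in the number of
qudits on which the term acts. -/
theorem approxEntry_bounds (hd : 0 < d) (hd' : 0 < d') (h : o.Describes L η) (hη : η ≤ 1)
    (hη0 : 0 ≤ η) {K : ℕ} (hK : L.BlocksLe K) (t : LocalTerm d n) (y y' : Fin o.n' → Fin d') :
    ‖approxEntry t o.block y y' - L.exactEntry t y y'‖ ≤ ((d : ℝ) ^ t.supp.length) ^ 2 *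
        (2 * ‖t.op‖ * (t.supp.length * blockBound d' K ^ t.supp.length * η)) ∧
      ‖approxEntry t o.block y y'‖ ≤ ((d : ℝ) ^ t.supp.length) ^ 2 *
        (2 * ‖t.op‖ * blockBound d' K ^ t.supp.length) := by
  have hP := fun j => blockEntry_bounds hd hd' h hη hK j (L.PE_proj (.inl j)) (h j).2.2.2.1 y y'
  have hQ := fun j => blockEntry_bounds hd hd' h hη hK j (L.QE_proj (.inl j)) (h j).2.2.2.2 y y'
  have hcore := t.norm_core_apply_le hd
  have hcore' : ∀ u u', ‖(starRingEnd ℂ) (t.core u u')‖ ≤ ‖t.op‖ := fun u u' => by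
    rw [Complex.norm_conj]; exact hcore u u'
  have hb := one_le_blockBound hd' K
  have hcard : (Fintype.card (Fin t.supp.length → Fin d) : ℝ) = (d : ℝ) ^ t.supp.length := by simp
  constructor
  · rw [approxEntry, LocalEncoding.exactEntry]
    simp only [← Finset.sum_sub_distrib]
    refine (norm_sum_sum_le _ (c := 2 * ‖t.op‖ *
      (t.supp.length * blockBound d' K ^ t.supp.length * η)) fun u u' => ?_).trans
      (le_of_eq (by rw [hcard]; ring))
    have hPp := norm_prod_sub_prod_le Finset.univ _ _ hb hη0
      (fun r => (hP (t.supp.get r) (u r) (u' r)).2.1) (fun r => (hP (t.supp.get r) (u r) (u' r)).2.2)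
      (fun r => (hP (t.supp.get r) (u r) (u' r)).1)
    have hQp := norm_prod_sub_prod_le Finset.univ _ _ hb hη0
      (fun r => (hQ (t.supp.get r) (u r) (u' r)).2.1) (fun r => (hQ (t.supp.get r) (u r) (u' r)).2.2)
      (fun r => (hQ (t.supp.get r) (u r) (u' r)).1)
    rw [Finset.card_univ, Fintype.card_fin] at hPp hQp
    rw [add_sub_add_comm, ← mul_sub, ← mul_sub]
    refine (norm_add_le _ _).trans ?_
    rw [norm_mul, norm_mul]
    calc _ ≤ ‖t.op‖ * (t.supp.length * blockBound d' K ^ t.supp.length * η) +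
          ‖t.op‖ * (t.supp.length * blockBound d' K ^ t.supp.length * η) := by
          gcongr
          · exact hcore u u'
          · exact hcore' u u'
      _ = _ := by ring
  · rw [approxEntry]
    refine (norm_sum_sum_le _ (c := 2 * ‖t.op‖ * blockBound d' K ^ t.supp.length)
      fun u u' => ?_).trans (le_of_eq (by rw [hcard]; ring))
    refine (norm_add_le _ _).trans ?_
    rw [norm_mul, norm_mul, norm_prod, norm_prod]
    have hp : ∀ f : Fin t.supp.length → ℝ, (∀ r, 0 ≤ f r) → (∀ r, f r ≤ blockBound d' K) →
        ∏ r, f r ≤ blockBound d' K ^ t.supp.length := by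
      intro f h0 hf
      refine (Finset.prod_le_prod (fun r _ => h0 r) fun r _ => hf r).trans ?_
      simp
    calc _ ≤ ‖t.op‖ * blockBound d' K ^ t.supp.length + ‖t.op‖ * blockBound d' K ^ t.supp.length := by
          gcongr
          · exact hcore u u'
          · exact hp _ (fun _ => norm_nonneg _) fun r => (hP (t.supp.get r) (u r) (u' r)).2.1
          · exact hcore' u u'
          · exact hp _ (fun _ => norm_nonneg _) fun r => (hQ (t.supp.get r) (u r) (u' r)).2.1
      _ = _ := by ring

theorem outTerm_norm_le (hd : 0 < d) (hd' : 0 < d') (h : o.Describes L η) (hη : η ≤ 1)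
    (hη0 : 0 ≤ η) {K : ℕ} (hK : L.BlocksLe K) (t : LocalTerm d n)
    (hnd : (targets o.block t.supp).Nodup) :
    ‖(outTerm t o.block hnd).op‖ ≤ (d' : ℝ) ^ (K * t.supp.length) *
      (((d : ℝ) ^ t.supp.length) ^ 2 * (2 * ‖t.op‖ * blockBound d' K ^ t.supp.length)) := by
  have hb := one_le_blockBound hd' K
  have hlen := length_targets_le (fun j => length_tgt_le h hK j) t.supp
  set c := ((d : ℝ) ^ t.supp.length) ^ 2 * (2 * ‖t.op‖ * blockBound d' K ^ t.supp.length) with hc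
  have hc0 : 0 ≤ c := by positivity
  refine (norm_le_of_local (targets o.block t.supp) _ hc0 (fun y y' hy => ?_) fun y y' => ?_).trans ?_
  · rw [outTerm_op_apply hd', if_neg hy]
  · rw [outTerm_op_apply hd']
    split_ifs
    · have h1 := (approxEntry_bounds hd hd' h hη hη0 hK t y y').2
      have h2 := (approxEntry_bounds hd hd' h hη hη0 hK t y' y).2
      have he : (1 : ℝ) ≤ emptyFactor t.supp := by exact_mod_cast emptyFactor_pos t.supp
      rw [norm_div, norm_mul, Complex.norm_natCast, Complex.norm_ofNat,
        div_le_iff₀ (by linarith)]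
      refine (norm_add_le _ _).trans ?_
      rw [Complex.norm_conj]
      nlinarith
    · simpa using hc0
  · gcongr
    exact_mod_cast hd'

theorem norm_encode_one_le (L : LocalEncoding d n d' o.n') : ‖L.encode (1 : QOp d n)‖ ≤ 2 := by
  have h1 := norm_encodeWith_le L.isom_isometry L.P_proj L.Q_proj (1 : QOp d n)
  have h2 := norm_one_le (n := Fin n → Fin d)
  rw [LocalEncoding.encode]; linarith

/-- The new term, multiplied by `𝓔(1)`, approximates the encoding of the old one. -/
theorem outTerm_encode_le (hd : 0 < d) (hd' : 0 < d') (h : o.Describes L η) (hη : η ≤ 1)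
    (hη0 : 0 ≤ η) {K : ℕ} (hK : L.BlocksLe K) (t : LocalTerm d n)
    (hnd : (targets o.block t.supp).Nodup) :
    ‖(outTerm t o.block hnd).op * L.encode 1 - L.encode t.op‖ ≤
      (d' : ℝ) ^ (K * t.supp.length) * (((d : ℝ) ^ t.supp.length) ^ 2 *
        (2 * ‖t.op‖ * (t.supp.length * blockBound d' K ^ t.supp.length * η))) * 2 := by
  have hb := one_le_blockBound hd' K
  have hlen := length_targets_le (fun j => length_tgt_le h hK j) t.supp
  by_cases hs : t.supp = []
  · -- a term with empty support is a real multiple of the identity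
    obtain ⟨s, hsn, mat, herm⟩ := t
    obtain rfl : s = [] := hs
    set t : LocalTerm d n := ⟨[], hsn, mat, herm⟩ with ht
    let u₀ : Fin t.supp.length → Fin d := fun r => Fin.elim0 r
    have hcr : (starRingEnd ℂ) (t.core u₀ u₀) = t.core u₀ u₀ := t.core_conj _ _
    obtain ⟨r, hr⟩ := Complex.conj_eq_iff_real.1 hcr
    have hop : t.op = (r : ℂ) • 1 := by
      ext x y
      rw [t.op_eq]
      simp only [LocalEncoding.onQudits, Matrix.of_apply, Matrix.smul_apply, Matrix.one_apply,
        smul_eq_mul, mul_ite, mul_one, mul_zero]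
      refine if_congr ?_ ?_ rfl
      · simp [ht, funext_iff]
      · rw [← hr]
        congr 1 <;> exact Subsingleton.elim (α := Fin 0 → Fin d) _ _
    have happ : ∀ y y', approxEntry t o.block y y' = 2 * r := by
      intro y y'
      rw [approxEntry]
      refine (Fintype.sum_unique (ι := Fin 0 → Fin d) _).trans
        ((Fintype.sum_unique (ι := Fin 0 → Fin d) _).trans ?_)
      have h1 : t.core u₀ u₀ = r := hr
      refine (congrArg₂ (· + ·) (congrArg₂ (· * ·) h1 Finset.prod_empty)
        (congrArg₂ (· * ·) (hcr.trans h1) Finset.prod_empty)).trans ?_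
      ring
    have hout : (outTerm t o.block hnd).op = (r : ℂ) • 1 := by
      ext y y'
      rw [outTerm_op_apply hd', happ, happ]
      simp only [Matrix.smul_apply, Matrix.one_apply, smul_eq_mul, mul_ite, mul_one, mul_zero]
      refine if_congr ?_ ?_ rfl
      · simp [ht, targets, funext_iff]
      · simp [ht, emptyFactor, map_mul, Complex.conj_ofReal, map_ofNat]
        ring
    rw [hout, hop, LocalEncoding.encode, LocalEncoding.encode, encodeWith_smul, Matrix.smul_mul,
      Matrix.one_mul, sub_self, norm_zero]
    positivity
  · set c := ((d : ℝ) ^ t.supp.length) ^ 2 *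
      (2 * ‖t.op‖ * (t.supp.length * blockBound d' K ^ t.supp.length * η)) with hc
    have hc0 : 0 ≤ c := by positivity
    set O := L.ideal t.supp L.PE t.core + L.ideal t.supp L.QE (t.core.map (starRingEnd ℂ)) with hO
    have hO1 : L.encode t.op = O * L.encode 1 := by
      rw [hO, L.ideal_mul_encode_one t.nodup hs, t.op_eq]
    have hdiff : ‖(outTerm t o.block hnd).op - O‖ ≤ (d' : ℝ) ^ (K * t.supp.length) * c := by
      have hent : ∀ y y', ((outTerm t o.block hnd).op - O) y y' =
          if ∀ w, w ∉ targets o.block t.supp → y w = y' w then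
            ((approxEntry t o.block y y' - L.exactEntry t y y') +
              (starRingEnd ℂ) (approxEntry t o.block y' y - L.exactEntry t y' y)) / 2 else 0 := by
        intro y y'
        rw [Matrix.sub_apply, outTerm_op_apply hd', hO, L.ideal_apply, ← targets_eq h]
        split_ifs
        · rw [map_sub, L.exactEntry_conj, emptyFactor, if_neg (by simpa using hs)]
          push_cast
          ring
        · simp
      refine (norm_le_of_local (targets o.block t.supp) _ hc0 (fun y y' hy => ?_)
        fun y y' => ?_).trans ?_
      · rw [hent, if_neg hy]
      · rw [hent]
        split_ifs
        · have h1 := (approxEntry_bounds hd hd' h hη hη0 hK t y y').1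
          have h2 := (approxEntry_bounds hd hd' h hη hη0 hK t y' y).1
          rw [norm_div, Complex.norm_ofNat, div_le_iff₀ (by norm_num)]
          refine (norm_add_le _ _).trans ?_
          rw [Complex.norm_conj]
          linarith
        · simpa using hc0
      · gcongr
        exact_mod_cast hd'
    rw [hO1, ← Matrix.sub_mul]
    refine (Matrix.l2_opNorm_mul _ _).trans ?_
    gcongr
    exact norm_encode_one_le L

end Accuracy

/-! ### Polynomial error bounds -/

theorem norm_list_sum_le {α E : Type} [SeminormedAddCommGroup E] (l : List α) (f : α → E) {c : ℝ}
    (h : ∀ t ∈ l, ‖f t‖ ≤ c) : ‖(l.map f).sum‖ ≤ l.length * c := by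
  induction l with
  | nil => simp
  | cons t l ih =>
    rw [List.map_cons, List.sum_cons, List.length_cons, Nat.cast_succ]
    have h1 := norm_add_le (f t) (l.map f).sum
    have h2 := ih fun t ht => h t (by simp [ht])
    have h3 := h t (by simp)
    linarith

theorem LocalOp.norm_op_le {d n : ℕ} {A : LocalOp d n} {N : ℕ} (hB : A.TermBound N)
    (hN : A.terms.length ≤ N) : ‖A.op‖ ≤ (N : ℝ) ^ 2 := by
  refine (norm_list_sum_le A.terms LocalTerm.op hB).trans ?_
  rw [sq]
  gcongr

section
variable {d n d' : ℕ} {o : SimOutput d n d'} {L : LocalEncoding d n d' o.n'} {η : ℝ}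

/-- The observable that is obtained from `A` by replacing each term. -/
def outObs (A : LocalOp d n) (o : SimOutput d n d')
    (hnd : ∀ s : List (Fin n), s.Nodup → (targets o.block s).Nodup) : LocalOp d' o.n' :=
  ⟨A.terms.map fun t => outTerm t o.block (hnd _ t.nodup)⟩

/-- The exponent with which the bounds for the transformed terms grow. -/
def boundExp (d' K : ℕ) : ℕ := 3 * (K * d') + 6

theorem blockBound_le (d' K : ℕ) : blockBound d' K ≤ 2 ^ (2 * (K * d') + 3) := by
  have h1 : (d' : ℝ) ≤ 2 ^ d' := by exact_mod_cast Nat.lt_two_pow_self.le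
  have h2 : (d' : ℝ) ^ K ≤ 2 ^ (K * d') := by
    rw [mul_comm, pow_mul]; gcongr
  rw [blockBound, pow_add, mul_comm 2, pow_mul]
  have := pow_le_pow_left₀ (by positivity) h2 2
  linarith

/-- A power with a logarithmic exponent is polynomial. -/
theorem blockBound_pow_le (hd : 2 ≤ d) (hd' : 0 < d') {K k N : ℕ} (hk : d ^ k ≤ N) :
    blockBound d' K ^ k ≤ (N : ℝ) ^ (2 * (K * d') + 3) := by
  have h1 : ((2 : ℝ) ^ k) ≤ N := by exact_mod_cast (Nat.pow_le_pow_left hd k).trans hk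
  have h0 : 0 ≤ blockBound d' K := zero_le_one.trans (one_le_blockBound hd' K)
  calc _ ≤ ((2 : ℝ) ^ (2 * (K * d') + 3)) ^ k := pow_le_pow_left₀ h0 (blockBound_le d' K) k
    _ = ((2 : ℝ) ^ k) ^ (2 * (K * d') + 3) := by rw [← pow_mul, ← pow_mul, mul_comm]
    _ ≤ _ := by gcongr

/-- For terms on logarithmically many qudits the bounds are polynomial. -/
theorem outTerm_bounds (hd : 2 ≤ d) (hd' : 0 < d') (h : o.Describes L η) (hη : η ≤ 1)
    (hη0 : 0 ≤ η) {K N : ℕ} (hK : L.BlocksLe K) (t : LocalTerm d n)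
    (hnd : (targets o.block t.supp).Nodup) (hk : d ^ t.supp.length ≤ N) (ht : ‖t.op‖ ≤ N) :
    ‖(outTerm t o.block hnd).op‖ ≤ 2 * (N : ℝ) ^ boundExp d' K ∧
    ‖(outTerm t o.block hnd).op * L.encode 1 - L.encode t.op‖ ≤
      4 * (N : ℝ) ^ (boundExp d' K + 1) * η := by
  have h1 : (d' : ℝ) ^ (K * t.supp.length) ≤ (N : ℝ) ^ (K * d') := by
    exact_mod_cast (pow_le_pow_mul hd K _).trans (Nat.pow_le_pow_left hk _)
  have h2 : (d : ℝ) ^ t.supp.length ≤ N := by exact_mod_cast hk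
  have h3 := blockBound_pow_le (K := K) hd hd' hk
  have h4 : (t.supp.length : ℝ) ≤ N := by
    exact_mod_cast (Nat.lt_pow_self (Nat.lt_of_lt_of_le one_lt_two hd)).le.trans hk
  have hb : 0 ≤ blockBound d' K := zero_le_one.trans (one_le_blockBound hd' K)
  constructor
  · refine (outTerm_norm_le (by omega) hd' h hη hη0 hK t hnd).trans ?_
    calc _ ≤ (N : ℝ) ^ (K * d') * ((N : ℝ) ^ 2 * (2 * N * (N : ℝ) ^ (2 * (K * d') + 3))) := by
          gcongr
      _ = _ := by rw [boundExp]; ring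
  · refine (outTerm_encode_le (by omega) hd' h hη hη0 hK t hnd).trans ?_
    calc _ ≤ (N : ℝ) ^ (K * d') * ((N : ℝ) ^ 2 *
          (2 * N * (N * (N : ℝ) ^ (2 * (K * d') + 3) * η))) * 2 := by gcongr
      _ = _ := by rw [boundExp]; ring

theorem outObs_mul_encode_sub (A : LocalOp d n)
    (hnd : ∀ s : List (Fin n), s.Nodup → (targets o.block s).Nodup) :
    (outObs A o hnd).op * L.encode 1 - L.encode A.op = (A.terms.map fun t =>
      (outTerm t o.block (hnd _ t.nodup)).op * L.encode 1 - L.encode t.op).sum := by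
  obtain ⟨l⟩ := A
  simp only [outObs, LocalOp.op, List.map_map]
  induction l with
  | nil => simp [LocalEncoding.encode, encodeWith]
  | cons t l ih =>
    simp only [List.map_cons, List.sum_cons, Function.comp_apply] at ih ⊢
    rw [← ih, Matrix.add_mul]
    have : L.encode (t.op + (l.map LocalTerm.op).sum) =
        L.encode t.op + L.encode (l.map LocalTerm.op).sum := encodeWith_add _ _
    rw [this]
    abel

theorem outObs_bounds (hd : 2 ≤ d) (hd' : 0 < d') (h : o.Describes L η) (hη : η ≤ 1)
    (hη0 : 0 ≤ η) {K N : ℕ} (hK : L.BlocksLe K) (A : LocalOp d n)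
    (hnd : ∀ s : List (Fin n), s.Nodup → (targets o.block s).Nodup)
    (hk : ∀ t ∈ A.terms, d ^ t.supp.length ≤ N) (hA : A.TermBound N) (hN : A.terms.length ≤ N) :
    ‖(outObs A o hnd).op‖ ≤ 2 * (N : ℝ) ^ (boundExp d' K + 1) ∧
    ‖(outObs A o hnd).op * L.encode 1 - L.encode A.op‖ ≤
      4 * (N : ℝ) ^ (boundExp d' K + 2) * η := by
  have key := fun t ht => outTerm_bounds hd hd' h hη hη0 hK t (hnd _ t.nodup) (hk t ht) (hA t ht)
  have hN' : (A.terms.length : ℝ) ≤ N := by exact_mod_cast hN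
  constructor
  · have : (outObs A o hnd).op = (A.terms.map fun t =>
        (outTerm t o.block (hnd _ t.nodup)).op).sum := by
      rw [LocalOp.op, outObs, List.map_map]; rfl
    rw [this]
    refine (norm_list_sum_le _ _ fun t ht => (key t ht).1).trans ?_
    calc _ ≤ (N : ℝ) * (2 * (N : ℝ) ^ boundExp d' K) := by gcongr
      _ = _ := by ring
  · rw [outObs_mul_encode_sub]
    refine (norm_list_sum_le _ _ fun t ht => (key t ht).2).trans ?_
    calc _ ≤ (N : ℝ) * (4 * (N : ℝ) ^ (boundExp d' K + 1) * η) := by gcongr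
      _ = _ := by ring

/-- The same accuracy for the perturbed encoding that belongs to a simulation. -/
theorem outObs_encodeWith_le (hd : 2 ≤ d) (hd' : 0 < d') (h : o.Describes L η) (hη : η ≤ 1)
    (hη0 : 0 ≤ η) {K N : ℕ} (hK : L.BlocksLe K) (A : LocalOp d n)
    (hnd : ∀ s : List (Fin n), s.Nodup → (targets o.block s).Nodup) (hN1 : 1 ≤ N)
    (hk : ∀ t ∈ A.terms, d ^ t.supp.length ≤ N) (hA : A.TermBound N) (hN : A.terms.length ≤ N)
    {W : Matrix (Fin o.n' → Fin d') ((Fin n → Fin d) × (∀ i, Fin (L.dimE i))) ℂ}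
    (hW : Wᴴ * W = 1) (hWL : ‖W - L.isom‖ ≤ η) :
    ‖(outObs A o hnd).op * encodeWith W L.P L.Q 1 - encodeWith W L.P L.Q A.op‖ ≤
      16 * (N : ℝ) ^ (boundExp d' K + 2) * η := by
  obtain ⟨h1, h2⟩ := outObs_bounds hd hd' h hη hη0 hK A hnd hk hA hN
  have h3 := norm_encodeWith_sub_le L.isom_isometry hW L.P_proj L.Q_proj hWL (1 : QOp d n)
  have h4 := norm_encodeWith_sub_le L.isom_isometry hW L.P_proj L.Q_proj hWL A.op
  have h5 := norm_one_le (n := Fin n → Fin d)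
  have h6 := LocalOp.norm_op_le hA hN
  have hN' : (1 : ℝ) ≤ N := by exact_mod_cast hN1
  have p1 : (N : ℝ) ^ (boundExp d' K + 1) ≤ (N : ℝ) ^ (boundExp d' K + 2) :=
    pow_le_pow_right₀ hN' (by omega)
  have p2 : (N : ℝ) ^ 2 ≤ (N : ℝ) ^ (boundExp d' K + 2) := pow_le_pow_right₀ hN' (by omega)
  set A' := (outObs A o hnd).op
  have e : A' * encodeWith W L.P L.Q 1 - encodeWith W L.P L.Q A.op =
      A' * (encodeWith W L.P L.Q 1 - L.encode 1) + (A' * L.encode 1 - L.encode A.op) -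
        (encodeWith W L.P L.Q A.op - L.encode A.op) := by
    rw [Matrix.mul_sub]; abel
  rw [e]
  have t1 : ‖A' * (encodeWith W L.P L.Q 1 - L.encode 1)‖ ≤
      2 * (N : ℝ) ^ (boundExp d' K + 2) * (4 * η) := by
    refine (Matrix.l2_opNorm_mul _ _).trans ?_
    have : ‖encodeWith W L.P L.Q 1 - L.encode (1 : QOp d n)‖ ≤ 4 * η :=
      h3.trans (mul_le_of_le_one_right (by positivity) h5)
    gcongr
    linarith
  have t2 : ‖encodeWith W L.P L.Q A.op - L.encode A.op‖ ≤
      4 * η * (N : ℝ) ^ (boundExp d' K + 2) := h4.trans (by gcongr; exact h6.trans p2)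
  refine (norm_sub_le _ _).trans ((add_le_add ((norm_add_le _ _).trans (add_le_add t1 h2)) t2).trans ?_)
  exact le_of_eq (by ring)

/-- An isometry with a domain of dimension at least `2` needs a target qudit, so no block of an
encoded qudit is empty. -/
theorem LocalEncoding.le_card {n' : ℕ} (hd : 2 ≤ d) (L : LocalEncoding d n d' n') : n ≤ n' := by
  classical
  have hE : ∀ i, 0 < L.dimE i := by
    -- otherwise `E` would be zero-dimensional and `P + Q = 0`
    intro i
    by_contra h0
    refine L.nonzero ?_
    ext z
    have := (z i).2
    omega
  have hne : ∀ j : Fin n, L.tgt (.inl j) ≠ [] := by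
    intro j h0
    have h1 := L.dim_le j
    rw [h0] at h1
    have h2 := hE (.inl j)
    simp only [List.length_nil, pow_zero] at h1
    have := Nat.mul_le_mul hd h2
    omega
  have hinj : Function.Injective fun j : Fin n => (L.tgt (.inl j)).head (hne j) := by
    intro j j' h
    obtain ⟨i, _, hi⟩ := L.tgt_partition ((L.tgt (.inl j)).head (hne j))
    have h1 := hi _ (List.head_mem (hne j))
    have h2 := hi (.inl j') (by
      have := List.head_mem (hne j')
      beta_reduce at h ⊢
      rwa [← h] at this)
    exact Sum.inl_injective (h1.trans h2.symm)
  simpa using Fintype.card_le_of_injective _ hinj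

end

/-- All errors together, with `1 / W` for the errors of the simulation and `1 / W ^ 2` for the excess
energy of a state, are at most `1 / (3 N)`. -/
theorem error_le {N m : ℕ} (hN : 1 ≤ N) {W A₀ A₁ κ δ : ℝ} (hW : 75 * (N : ℝ) ^ (m + 4) ≤ W)
    (hA₀ : A₀ ≤ (N : ℝ) ^ 2) (hA₁ : A₁ ≤ 2 * (N : ℝ) ^ (m + 1))
    (hκ : κ ≤ 16 * (N : ℝ) ^ (m + 2) * (1 / W)) (hδ : 1 ≤ N * δ) :
    A₀ * (1 / W) ^ 2 + 2 * A₀ / δ * (2 * (1 / W) + (1 / W) ^ 2) + κ + A₁ * (1 / W) ≤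
      1 / (3 * N) := by
  have hN' : (1 : ℝ) ≤ N := by exact_mod_cast hN
  have hpow : ∀ j ≤ m + 3, (N : ℝ) ^ j ≤ (N : ℝ) ^ (m + 3) := fun j hj => pow_le_pow_right₀ hN' hj
  have hX1 : (1 : ℝ) ≤ (N : ℝ) ^ (m + 3) := one_le_pow₀ hN'
  have p1 := hpow 2 (by omega)
  have p2 := hpow 3 (by omega)
  have p3 := hpow (m + 1) (by omega)
  have p4 := hpow (m + 2) (by omega)
  have e4 : (N : ℝ) ^ (m + 4) = N * (N : ℝ) ^ (m + 3) := by ring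
  rw [e4] at hW
  set X := (N : ℝ) ^ (m + 3)
  have hX : 1 ≤ N * X := one_le_mul_of_one_le_of_one_le hN' hX1
  have hW0 : 1 ≤ W := by nlinarith
  have hWp : 0 < W := by linarith
  set θ := 1 / W with hθ
  have hθ0 : 0 ≤ θ := by positivity
  have hθ1 : θ ≤ 1 := by rw [hθ, div_le_one hWp]; exact hW0
  have hθ2 : θ ^ 2 ≤ θ := by nlinarith
  have hδ0 : 0 < δ := by
    by_contra h
    have := mul_nonpos_of_nonneg_of_nonpos (zero_le_one.trans hN') (not_lt.1 h)
    linarith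
  have hA₀δ : A₀ / δ ≤ X := by
    rw [div_le_iff₀ hδ0]
    calc A₀ ≤ (N : ℝ) ^ 2 := hA₀
      _ ≤ (N : ℝ) ^ 2 * (N * δ) := le_mul_of_one_le_right (by positivity) hδ
      _ = (N : ℝ) ^ 3 * δ := by ring
      _ ≤ _ := by gcongr
  have t1 : A₀ * θ ^ 2 ≤ X * θ := by gcongr; linarith
  have t2 : 2 * A₀ / δ * (2 * θ + θ ^ 2) ≤ 6 * (X * θ) := by
    have : 2 * A₀ / δ * (2 * θ + θ ^ 2) = A₀ / δ * (2 * (2 * θ + θ ^ 2)) := by ring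
    rw [this]
    calc _ ≤ X * (2 * (2 * θ + θ)) := by gcongr
      _ = _ := by ring
  have t3 : κ ≤ 16 * (X * θ) := hκ.trans (by rw [mul_assoc]; gcongr)
  have t4 : A₁ * θ ≤ 2 * (X * θ) := by
    rw [← mul_assoc]; gcongr; linarith
  have t5 : X * θ * (75 * N) ≤ 1 := by
    rw [hθ, mul_one_div, div_mul_eq_mul_div, div_le_one hWp]; linarith
  have t6 : 1 / (3 * (N : ℝ)) = 25 * (1 / (75 * N)) := by field_simp; norm_num
  have t7 : X * θ ≤ 1 / (75 * N) := by
    rw [le_div_iff₀ (by positivity)]; exact t5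
  have h0 : 0 ≤ X * θ := by positivity
  rw [t6]
  linarith

/-! ### The transformed instance -/

instance {d : ℕ} : Word (Inst d) := ⟨Inst.enc⟩

/-- The data of an instance. -/
def Inst.raw {d : ℕ} (x : Inst d) : RawInst :=
  (x.H.raw, x.A.raw, x.k, x.l, (x.a.num, x.a.den), (x.b.num, x.b.den), (x.δ.num, x.δ.den), ())

theorem Inst.enc_raw {d : ℕ} (x : Inst d) : Word.enc x.raw = x.enc := by
  have h1 := x.H.enc_raw
  have h2 := x.A.enc_raw
  rw [Inst.enc, ← h1, ← h2]
  rfl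

/-- The data of the output of a simulation algorithm. -/
def SimOutput.raw {d n d' : ℕ} (o : SimOutput d n d') : RawHam × List RawBlock :=
  (o.H'.raw, List.ofFn fun j => (o.block j).raw)

theorem SimOutput.enc_raw {d n d' : ℕ} (o : SimOutput d n d') : Word.enc o.raw = o.enc := by
  have h1 := o.H'.enc_raw
  change Val.pair (Word.enc o.H'.raw) (encList ((List.ofFn fun j => (o.block j).raw).map Word.enc)) = _
  rw [SimOutput.enc, h1, List.map_ofFn]
  congr 3
  funext j
  exact (o.block j).enc_raw

/-- The fraction `(2 a + b) / 3`. -/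
def Frac.third (a b : Frac) : Frac :=
  ⟨2 * a.num * b.den + b.num * a.den, 3 * (a.den * b.den),
    Nat.mul_pos three_pos (Nat.mul_pos a.den_pos b.den_pos)⟩

theorem Frac.val_third (a b : Frac) : (a.third b).val = a.val + (b.val - a.val) / 3 := by
  have h1 : (a.den : ℝ) ≠ 0 := by exact_mod_cast a.den_pos.ne'
  have h2 : (b.den : ℝ) ≠ 0 := by exact_mod_cast b.den_pos.ne'
  rw [Frac.val, Frac.val, Frac.val, Frac.third]
  push_cast
  field_simp
  ring

/-- The largest size of the support of a term. -/
def LocalOp.locality {d n : ℕ} (H : LocalOp d n) : ℕ :=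
  (H.terms.map fun t => t.supp.length).foldl max 0

theorem foldl_max_le {l : List ℕ} {s k : ℕ} : l.foldl max s ≤ k ↔ s ≤ k ∧ ∀ m ∈ l, m ≤ k := by
  induction l generalizing s with
  | nil => simp
  | cons m l ih => rw [List.foldl_cons, ih]; simp [and_assoc]

theorem foldl_max_mem (l : List ℕ) (s : ℕ) : l.foldl max s = s ∨ l.foldl max s ∈ l := by
  induction l generalizing s with
  | nil => simp
  | cons m l ih =>
    rw [List.foldl_cons]
    rcases ih (max s m) with h | h
    · rcases max_choice s m with h' | h'
      · left; rw [h, h']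
      · right; rw [h, h']; simp
    · right; simp [h]

theorem LocalOp.locality_le_iff {d n : ℕ} (H : LocalOp d n) {k : ℕ} :
    H.locality ≤ k ↔ H.IsLocal k := by
  simp [LocalOp.locality, foldl_max_le, LocalOp.IsLocal]

theorem LocalOp.length_le_size {d n : ℕ} (H : LocalOp d n) : H.terms.length ≤ H.enc.size := by
  rw [← H.enc_raw]
  have h := length_lt_sz (H.terms.map LocalTerm.raw)
  rw [List.length_map] at h
  have h2 : (Word.enc H.raw).size = sz (List.replicate n ()) + sz (H.terms.map LocalTerm.raw) + 1 := rfl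
  omega

theorem LocalOp.qudits_le_size {d n : ℕ} (H : LocalOp d n) : n ≤ H.enc.size := by
  rw [← H.enc_raw]
  have h := length_lt_sz (List.replicate n ())
  rw [List.length_replicate] at h
  have h2 : (Word.enc H.raw).size = sz (List.replicate n ()) + sz (H.terms.map LocalTerm.raw) + 1 := rfl
  omega

/-- The matrix of a term is written down in full, so that the number of its rows is bounded by
the length of the description. -/
theorem LocalOp.pow_locality_le_size {d n : ℕ} (H : LocalOp d n) : d ^ H.locality ≤ H.enc.size := by
  rcases foldl_max_mem (H.terms.map fun t => t.supp.length) 0 with h | h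
  · rw [LocalOp.locality, h, pow_zero]
    exact Val.one_le_size _
  · rw [LocalOp.locality]
    obtain ⟨t, ht, he⟩ := List.mem_map.1 h
    rw [← he, ← H.enc_raw]
    have h1 : sz t.raw < sz (H.terms.map LocalTerm.raw) :=
      sz_lt_of_mem (List.mem_map.2 ⟨t, ht, rfl⟩)
    have h2 : (Word.enc H.raw).size = sz (List.replicate n ()) + sz (H.terms.map LocalTerm.raw) + 1 := rfl
    have h3 : sz t.raw = sz (t.supp.map Fin.val) + (sz t.mat.den + sz t.mat.raw.2 + 1) + 1 := rfl
    have h4 := length_lt_sz t.mat.raw.2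
    have h5 : t.mat.raw.2.length = d ^ t.supp.length := List.length_ofFn
    omega

section

variable {d d' : ℕ} {F : HamFamily d} {q : Polynomial ℕ} {x : Inst d}

theorem Inst.Admissible.one_le (hx : x.Admissible F q) : 1 ≤ q.eval x.n := by
  by_contra h
  have h0 : q.eval x.n = 0 := by omega
  have := hx.gap
  rw [h0] at this
  norm_num at this

theorem Inst.Admissible.size_H_le (hx : x.Admissible F q) : x.H.enc.size ≤ q.eval x.n := by
  refine le_trans ?_ hx.size_le
  simp only [Inst.enc, encList, Val.size]; omega

theorem Inst.Admissible.size_A_le (hx : x.Admissible F q) : x.A.enc.size ≤ q.eval x.n := by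
  refine le_trans ?_ hx.size_le
  simp only [Inst.enc, encList, Val.size]; omega

theorem Inst.Admissible.pow_le (hd : 0 < d) (hx : x.Admissible F q) :
    ∀ t ∈ x.A.terms, d ^ t.supp.length ≤ q.eval x.n := fun t ht =>
  (Nat.pow_le_pow_right hd (hx.A_local t ht)).trans hx.l_log

/-- The instance to which `x` is mapped, for the simulating Hamiltonian and the blocks `o`. -/
def outInst (x : Inst d) (o : SimOutput d x.n d')
    (hnd : ∀ s : List (Fin x.n), s.Nodup → (targets o.block s).Nodup) (K : ℕ) {W : ℕ} (hW : 0 < W) :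
    Inst d' where
  n := o.n'
  H := o.H'
  A := outObs x.A o hnd
  k := o.H'.locality
  l := K * x.l
  a := x.a.third x.b
  b := x.b.third x.a
  δ := ⟨1, W ^ 2, pow_pos hW 2⟩

/-- The polynomial in the number of qudits that gives the precision asked for. It exceeds the
threshold of the simulation, and the inverse errors that the energy estimates require. -/
noncomputable def precision (d' K : ℕ) (threshold q : Polynomial ℕ) : Polynomial ℕ :=
  threshold.comp (2 * q) + 75 * q ^ (boundExp d' K + 4)

theorem precision_eval (d' K : ℕ) (threshold q : Polynomial ℕ) (n : ℕ) :
    (precision d' K threshold q).eval n =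
      threshold.eval (2 * q.eval n) + 75 * q.eval n ^ (boundExp d' K + 4) := by
  simp [precision, Polynomial.eval_comp]

section Energies

variable {o : SimOutput d x.n d'} {L : LocalEncoding d x.n d' o.n'} {K W : ℕ}
  {hnd : ∀ s : List (Fin x.n), s.Nodup → (targets o.block s).Nodup} {hW : 0 < W}

/-- Both kinds of instances at once: `A` is the observable for YES instances and its negative for NO
instances. -/
theorem expect_outObs_le (hd : 2 ≤ d) (hd' : 0 < d') (hx : x.Admissible F q)
    (hK : L.BlocksLe K) (h : o.Describes L (1 / (W : ℝ)))
    (hs : L.IsSimulation W (1 / (W : ℝ)) (1 / (W : ℝ)) x.H o.H')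
    (hWq : 75 * q.eval x.n ^ (boundExp d' K + 4) ≤ W) {A : QOp d x.n} {A' : QOp d' o.n'} {a : ℝ}
    (hA : (A = x.A.op ∧ A' = (outObs x.A o hnd).op) ∨ (A = -x.A.op ∧ A' = -(outObs x.A o hnd).op))
    (hyes : ∀ ψ, x.LowEnergy ψ → expect A ψ ≤ a)
    {ψ : (Fin o.n' → Fin d') → ℂ} (hψ : (outInst x o hnd K hW).LowEnergy ψ) :
    expect A' ψ ≤ a + (x.b.val - x.a.val) / 3 := by
  have hN1 := hx.one_le
  set N := q.eval x.n with hN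
  have hN' : (1 : ℝ) ≤ N := by exact_mod_cast hN1
  have hWq' : 75 * (N : ℝ) ^ (boundExp d' K + 4) ≤ W := by exact_mod_cast hWq
  have hlenA : x.A.terms.length ≤ N := x.A.length_le_size.trans hx.size_A_le
  have hlenH : x.H.terms.length ≤ N := x.H.length_le_size.trans hx.size_H_le
  have hW1 : (1 : ℝ) ≤ W := by exact_mod_cast hW
  have hθ1 : 1 / (W : ℝ) ≤ 1 := by rw [div_le_one (by linarith)]; exact hW1
  have hθ0 : 0 ≤ 1 / (W : ℝ) := by positivity
  obtain ⟨V, hV, hVL, hlow, hε⟩ := hs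
  have hκ := outObs_encodeWith_le hd hd' h hθ1 hθ0 hK x.A hnd hN1 (hx.pow_le (by omega))
    hx.A_norm hlenA hV hVL
  have hA0 := LocalOp.norm_op_le hx.A_norm hlenA
  have hA1 := (outObs_bounds hd hd' h hθ1 hθ0 hK x.A hnd (hx.pow_le (by omega)) hx.A_norm hlenA).1
  have hH0 := LocalOp.norm_op_le hx.H_norm hlenH
  have hδ0 : 0 < x.δ.val := by
    by_contra h0
    have := mul_nonpos_of_nonneg_of_nonpos (zero_le_one.trans hN') (not_lt.1 h0)
    linarith [hx.δ_ge]
  -- the same bounds hold for the negative of the observable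
  obtain ⟨hAh, hA0', hA1', hκ'⟩ : A.IsHermitian ∧ ‖A‖ = ‖x.A.op‖ ∧
      ‖A'‖ = ‖(outObs x.A o hnd).op‖ ∧ ‖A' * encodeWith V L.P L.Q 1 - encodeWith V L.P L.Q A‖ =
        ‖(outObs x.A o hnd).op * encodeWith V L.P L.Q 1 - encodeWith V L.P L.Q x.A.op‖ := by
    rcases hA with ⟨rfl, rfl⟩ | ⟨rfl, rfl⟩
    · exact ⟨x.A.op_isHermitian, rfl, rfl, rfl⟩
    · refine ⟨x.A.op_isHermitian.neg, norm_neg _, norm_neg _, ?_⟩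
      have h1 := encodeWith_smul (V := V) (P := L.P) (Q := L.Q) (-1) x.A.op
      simp only [Complex.ofReal_neg, Complex.ofReal_one, neg_smul, one_smul] at h1
      rw [h1, ← norm_neg, Matrix.neg_mul]
      congr 1; abel
  rw [← hA0'] at hA0
  rw [← hA1'] at hA1
  have hgs := (abs_le.1 (abs_groundEnergy_le (by omega) x.H.op_isHermitian)).2
  have hΔ : groundEnergy x.H.op + 1 / (W : ℝ) + 1 ≤ W := by
    have p1 : (N : ℝ) ^ 2 ≤ (N : ℝ) ^ (boundExp d' K + 4) := pow_le_pow_right₀ hN' (by omega)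
    have p2 : 1 ≤ (N : ℝ) ^ (boundExp d' K + 4) := one_le_pow₀ hN'
    linarith
  have hψe : expect o.H'.op ψ ≤ groundEnergy o.H'.op + (1 / (W : ℝ)) ^ 2 := by
    refine hψ.2.trans (le_of_eq ?_)
    simp [outInst, Frac.val]
  have key := expect_le_of_simulation (by omega) x.H.op_isHermitian o.H'.op_isHermitian hAh hV
    L.P_proj L.Q_proj L.PQ L.nonzero hlow hε (hκ'.le.trans hκ) hδ0 hθ0 hΔ
    (fun φ h1 h2 => hyes φ ⟨h1, h2⟩) hψ.1 hψe
  have herr := error_le hN1 hWq' hA0 hA1 le_rfl hx.δ_ge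
  have hgap : 1 / (3 * (N : ℝ)) ≤ (x.b.val - x.a.val) / 3 := by
    have := hx.gap
    rw [div_le_div_iff₀ (by positivity) (by norm_num)]
    linarith
  linarith

theorem outInst_yes (hd : 2 ≤ d) (hd' : 0 < d') (hx : x.Admissible F q)
    (hK : L.BlocksLe K) (h : o.Describes L (1 / (W : ℝ)))
    (hs : L.IsSimulation W (1 / (W : ℝ)) (1 / (W : ℝ)) x.H o.H')
    (hWq : 75 * q.eval x.n ^ (boundExp d' K + 4) ≤ W)
    (hyes : ∀ ψ, x.LowEnergy ψ → expect x.A.op ψ ≤ x.a.val) :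
    ∀ ψ, (outInst x o hnd K hW).LowEnergy ψ →
      expect (outInst x o hnd K hW).A.op ψ ≤ (outInst x o hnd K hW).a.val := fun _ hψ =>
  (expect_outObs_le hd hd' hx hK h hs hWq (.inl ⟨rfl, rfl⟩) hyes hψ).trans
    (le_of_eq (Frac.val_third _ _).symm)

theorem outInst_no (hd : 2 ≤ d) (hd' : 0 < d') (hx : x.Admissible F q)
    (hK : L.BlocksLe K) (h : o.Describes L (1 / (W : ℝ)))
    (hs : L.IsSimulation W (1 / (W : ℝ)) (1 / (W : ℝ)) x.H o.H')
    (hWq : 75 * q.eval x.n ^ (boundExp d' K + 4) ≤ W)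
    (hno : ∀ ψ, x.LowEnergy ψ → x.b.val ≤ expect x.A.op ψ) :
    ∀ ψ, (outInst x o hnd K hW).LowEnergy ψ →
      (outInst x o hnd K hW).b.val ≤ expect (outInst x o hnd K hW).A.op ψ := fun ψ hψ => by
  have h1 := expect_outObs_le (a := -x.b.val) hd hd' hx hK h hs hWq (.inr ⟨rfl, rfl⟩)
    (fun φ hφ => by rw [expect_neg]; exact neg_le_neg (hno φ hφ)) hψ
  have h2 : (outInst x o hnd K hW).b.val = _ := Frac.val_third x.b x.a
  rw [show expect (-(outObs x.A o hnd).op) ψ = -expect (outObs x.A o hnd).op ψ from expect_neg] at h1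
  rw [h2]
  change _ ≤ expect (outObs x.A o hnd).op ψ
  linarith

end Energies

/-! ### The program of the reduction -/

/-- The fraction `(2 a + b) / 3` on data. -/
def rawThird (a b : ℤ × ℕ) : ℤ × ℕ := (2 * a.1 * b.2 + b.1 * a.2, 3 * (a.2 * b.2))

/-- The transformation of an instance on data, from the instance, the output of the simulation
algorithm, and the precision. -/
def rawOut (d K m : ℕ) (p : RawInst × (RawHam × List RawBlock) × ℕ) : RawInst :=
  (p.2.1.1, (p.2.1.1.1, p.1.2.1.2.map (rawTermOut d m p.2.1.2)),
    (p.2.1.1.2.map fun t => t.1.length).foldl max 0, K * p.1.2.2.2.1,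
    rawThird p.1.2.2.2.2.1 p.1.2.2.2.2.2.1, rawThird p.1.2.2.2.2.2.1 p.1.2.2.2.2.1,
    (1, p.2.2 ^ 2), ())

theorem PolyTime.third {α : Type} [Word α] {a b : α → ℤ × ℕ} (ha : PolyTime a) (hb : PolyTime b) :
    PolyTime (fun p => rawThird (a p) (b p)) :=
  ((((PolyTime.const 2).intMul ha.fst).intMul hb.snd.cast).intAdd (hb.fst.intMul ha.snd.cast)).pair
    ((PolyTime.const 3).natMul (ha.snd.natMul hb.snd))

theorem polyTime_rawOut {d : ℕ} (hd : 0 < d) (K m : ℕ) : PolyTime (rawOut d K m) := by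
  have hx : PolyTime (fun p : RawInst × (RawHam × List RawBlock) × ℕ => p.1) := .fst'
  have ho : PolyTime (fun p : RawInst × (RawHam × List RawBlock) × ℕ => p.2.1) := PolyTime.snd'.fst
  have hW : PolyTime (fun p : RawInst × (RawHam × List RawBlock) × ℕ => p.2.2) := PolyTime.snd'.snd
  have hr := hx.snd.snd.snd
  refine ho.fst.pair (.pair (.pair ho.fst.fst (.map hx.snd.fst.snd ?_)) (.pair ?_
    (.pair ((PolyTime.const K).natMul hr.fst) (.pair (.third hr.snd.fst hr.snd.snd.fst)
    (.pair (.third hr.snd.snd.fst hr.snd.fst) (.pair (.pair (.const 1) (hW.natPow 2))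
    (.const ())))))))
  · exact (polyTime_rawTermOut hd m).comp ((ho.comp .fst').snd.pair .snd')
  · exact .listMax (.map ho.fst.snd (PolyTime.length PolyTime.snd'.fst))

theorem outInst_raw (hd : 2 ≤ d) (hd' : 0 < d') (x : Inst d) (o : SimOutput d x.n d')
    (hnd : ∀ s : List (Fin x.n), s.Nodup → (targets o.block s).Nodup) {K W : ℕ} (hW : 0 < W)
    (hK : ∀ j, (o.block j).tgt.length ≤ K) :
    (outInst x o hnd K hW).raw = rawOut d K (K * d') (x.raw, o.raw, W) := by
  have hA : (outObs x.A o hnd).terms.map LocalTerm.raw =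
      (x.A.terms.map LocalTerm.raw).map (rawTermOut d (K * d') o.raw.2) := by
    rw [outObs, List.map_map, List.map_map]
    refine List.map_congr_left fun t _ => ?_
    simp only [Function.comp_apply]
    rw [outTerm_raw hd hd' t o.block _ hK, rawTermOut, SimOutput.raw]
    simp only [LocalTerm.raw, List.map_map]
    congr 1
    refine List.map_congr_left fun j _ => ?_
    simp
  have hk : o.H'.locality = ((o.H'.terms.map LocalTerm.raw).map fun t => t.1.length).foldl max 0 := by
    rw [LocalOp.locality, List.map_map]
    congr 1
    exact List.map_congr_left fun t _ => by simp [LocalTerm.raw]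
  refine Prod.ext rfl (Prod.ext (Prod.ext rfl hA) (Prod.ext hk rfl))

/-- A program that runs in polynomial time on words computed in polynomial time. -/
theorem PolyTime.run {α β γ : Type} [Word α] [Word β] [Word γ] {f : α → β} {g : α → γ} {b : α → ℕ}
    (hf : PolyTime f) (S : Prog) (hS : ∀ a, S.Computes (Word.enc (f a)) (Word.enc (g a)) (b a))
    (hb : PolyBdd b) : PolyTime g := by
  obtain ⟨p, c, hc, hp⟩ := hf
  refine ⟨.seq p S, fun a => c a + b a + 1, (hc.add hb).add (.const 1), fun a => ?_⟩
  obtain ⟨t, ht, he⟩ := hp a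
  obtain ⟨u, hu, he'⟩ := hS a
  exact ⟨_, by beta_reduce; omega, Eval.seq he he'⟩

end

section

variable {d d' : ℕ} {F : HamFamily d} {F' : HamFamily d'} {q : Polynomial ℕ} {x : Inst d}

/-- The polynomial that bounds the transformed instances; `U` bounds their length in terms of the
length of the given instance. -/
noncomputable def outPoly (d' K : ℕ) (U threshold strength q : Polynomial ℕ) : Polynomial ℕ :=
  U.comp q + q ^ (K * d') + strength.comp (2 * q + 3 * precision d' K threshold q) +
    2 * q ^ boundExp d' K + 3 * q + precision d' K threshold q ^ 2

theorem outPoly_eval (d' K : ℕ) (U threshold strength q : Polynomial ℕ) (n : ℕ) :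
    (outPoly d' K U threshold strength q).eval n =
      U.eval (q.eval n) + q.eval n ^ (K * d') +
        strength.eval (2 * q.eval n + 3 * (precision d' K threshold q).eval n) +
        2 * q.eval n ^ boundExp d' K + 3 * q.eval n + (precision d' K threshold q).eval n ^ 2 := by
  simp [outPoly, Polynomial.eval_comp]

/-- The new number of qudits is at least the old one, so that it is enough to bound everything by the
value of the polynomial at the old number of qudits. -/
theorem outInst_admissible (hd : 2 ≤ d) (hd' : 0 < d') (hx : x.Admissible F q)
    {o : SimOutput d x.n d'} {L : LocalEncoding d x.n d' o.n'} {K : ℕ}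
    {hnd : ∀ s : List (Fin x.n), s.Nodup → (targets o.block s).Nodup}
    {U threshold strength : Polynomial ℕ} {hW : 0 < (precision d' K threshold q).eval x.n}
    (hmem : o.H' ∈ F' o.n') (hK : L.BlocksLe K)
    (h : o.Describes L (1 / (((precision d' K threshold q).eval x.n : ℕ) : ℝ)))
    (hstr : o.H'.TermBound (strength.eval (x.H.enc.size + q.eval x.n +
      (precision d' K threshold q).eval x.n + (precision d' K threshold q).eval x.n +
      (precision d' K threshold q).eval x.n) : ℕ))
    (hsz : (outInst x o hnd K hW).enc.size ≤ U.eval x.enc.size) :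
    (outInst x o hnd K hW).Admissible F' (outPoly d' K U threshold strength q) := by
  have hev := outPoly_eval d' K U threshold strength q x.n
  have hmono := eval_mono (outPoly d' K U threshold strength q) (L.le_card hd)
  set W := (precision d' K threshold q).eval x.n with hWdef
  set N := q.eval x.n with hN
  set Q := (outPoly d' K U threshold strength q).eval o.n' with hQ
  rw [hev] at hmono
  have hU : U.eval x.enc.size ≤ U.eval N := eval_mono U hx.size_le
  have hsize : (outInst x o hnd K hW).enc.size ≤ Q := by change _ ≤ Q at hmono; omega
  have hHsize : o.H'.enc.size ≤ (outInst x o hnd K hW).enc.size := by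
    simp only [Inst.enc, encList, Val.size, outInst]; omega
  have hW1 : (1 : ℝ) ≤ W := by exact_mod_cast hW
  have hθ1 : 1 / (W : ℝ) ≤ 1 := by rw [div_le_one (by linarith)]; exact hW1
  have hθ0 : 0 ≤ 1 / (W : ℝ) := by positivity
  have hsHle := hx.size_H_le
  refine ⟨hmem, ?_, ?_, ?_, ?_, ?_, ?_, hsize, ?_, ?_⟩
  · exact o.H'.locality_le_iff.1 le_rfl
  · intro t' ht'
    obtain ⟨t, ht, rfl⟩ := List.mem_map.1 ht'
    exact (length_targets_le (fun j => length_tgt_le h hK j) t.supp).trans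
      (Nat.mul_le_mul_left _ (hx.A_local t ht))
  · exact (o.H'.pow_locality_le_size.trans hHsize).trans hsize
  · have h1 : d' ^ (K * x.l) ≤ N ^ (K * d') :=
      (pow_le_pow_mul hd K x.l).trans (Nat.pow_le_pow_left hx.l_log _)
    exact h1.trans (by change _ ≤ Q; omega)
  · intro t ht
    refine (hstr t ht).trans ?_
    have h1 := eval_mono strength (show x.H.enc.size + N + W + W + W ≤ 2 * N + 3 * W by omega)
    exact_mod_cast h1.trans (show _ ≤ Q by omega)
  · intro t' ht'
    obtain ⟨t, ht, rfl⟩ := List.mem_map.1 ht'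
    refine (outTerm_bounds hd hd' h hθ1 hθ0 hK t _ (hx.pow_le (by omega) t ht)
      (hx.A_norm t ht)).1.trans ?_
    exact_mod_cast (show 2 * N ^ boundExp d' K ≤ Q by omega)
  · have e1 : (outInst x o hnd K hW).a.val = _ := Frac.val_third x.a x.b
    have e2 : (outInst x o hnd K hW).b.val = _ := Frac.val_third x.b x.a
    rw [e1, e2]
    change 1 ≤ (Q : ℝ) * _
    have h1 : (3 * N : ℝ) ≤ Q := by exact_mod_cast (show 3 * N ≤ Q by omega)
    have h2 := hx.gap
    have h3 : 0 ≤ x.b.val - x.a.val := by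
      by_contra h0
      have := mul_nonpos_of_nonneg_of_nonpos (Nat.cast_nonneg (α := ℝ) N) (not_le.1 h0).le
      linarith
    have h4 := mul_le_mul_of_nonneg_right h1 h3
    linarith
  · have e1 : (outInst x o hnd K hW).δ.val = 1 / (W : ℝ) ^ 2 := by simp [outInst, Frac.val]
    rw [e1, mul_one_div, le_div_iff₀ (by positivity), one_mul]
    change _ ≤ (Q : ℝ)
    exact_mod_cast (show W ^ 2 ≤ Q by omega)

end

end ApxSim

open ApxSim
/-- If `F` is efficiently simulated by `F'`, then APX-SIM2 restricted to `F` reduces to APX-SIM2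
restricted to `F'` under polynomial-time many-one reductions: for all polynomial bounds `q` in
the promise there are polynomial bounds `q'` and a reduction `R`. Moreover `R` maps every
admissible input `(H, A, k, ℓ, a, b, δ)` to an admissible input `(H', A', k', ℓ', a', b', δ')`
with `ℓ' = O(ℓ)` and `b' - a' = (b - a) / 3`, where `H'` simulates `H` with a local
encoding `𝓔` and `A'` is obtained from `A` term by term, with `A' 𝓔(1) = 𝓔(A)` up to
inverse polynomial precision. -/
theorem mainTheorem3 (d d' : ℕ) (hd : 2 ≤ d) (hd' : 2 ≤ d')
    (F : HamFamily d) (F' : HamFamily d') (hsim : EfficientlySimulatedBy F F')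
    (q : Polynomial ℕ) :
    ∃ (R : Prog) (q' time : Polynomial ℕ) (C : ℕ),
      IsPolyTimeReduction R (apxSim2 F q) (apxSim2 F' q') ∧
      ∀ x : Inst d, x.Admissible F q →
        ∃ y : Inst d', R.Computes x.enc y.enc (time.eval x.enc.size) ∧
          y.Admissible F' q' ∧
          (∀ k₀, y.H.IsLocal k₀ → y.k ≤ k₀) ∧
          y.l ≤ C * x.l ∧
          y.a.val = x.a.val + (x.b.val - x.a.val) / 3 ∧
          y.b.val = x.b.val - (x.b.val - x.a.val) / 3 ∧
          ∃ (L : LocalEncoding d x.n d' y.n) (Δ η ε : ℝ),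
            ((q.eval x.n : ℕ) : ℝ) ≤ Δ ∧
            0 < η ∧ η ≤ 1 / ((q.eval x.n : ℕ) : ℝ) ∧
            0 < ε ∧ ε ≤ 1 / ((q.eval x.n : ℕ) : ℝ) ∧
            L.BlocksLe C ∧
            L.IsSimulation Δ η ε x.H y.H ∧
            List.Forall₂ (fun (t : LocalTerm d x.n) (t' : LocalTerm d' y.n) =>
                (∀ w ∈ t'.supp, ∃ j ∈ t.supp, w ∈ L.tgt (.inl j)) ∧
                ‖t'.op * L.encode 1 - L.encode t.op‖ ≤ 1 / ((q.eval x.n : ℕ) : ℝ))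
              x.A.terms y.A.terms := by
  have hd0 : 0 < d := by omega
  have hd0' : 0 < d' := by omega
  obtain ⟨S, time, threshold, strength, K, hS⟩ := hsim
  set w := precision d' K threshold q with hw
  have hwe : ∀ n, w.eval n = _ := precision_eval d' K threshold q
  have hWpos : ∀ x : {x : Inst d // x.Admissible F q}, 0 < w.eval x.1.n := fun x => by
    have := Nat.pow_pos (n := boundExp d' K + 4) x.2.one_le
    rw [hwe]; omega
  have hWq : ∀ x : {x : Inst d // x.Admissible F q},
      75 * q.eval x.1.n ^ (boundExp d' K + 4) ≤ w.eval x.1.n := fun x => by rw [hwe]; omega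
  have hex := fun x : {x : Inst d // x.Admissible F q} =>
    hS x.1.n x.1.H x.2.mem (q.eval x.1.n) (w.eval x.1.n) (w.eval x.1.n) (w.eval x.1.n)
      x.2.H_norm (hWpos x) (hWpos x) (by
        rw [hwe]
        have := eval_mono threshold (show x.1.H.enc.size + q.eval x.1.n ≤ 2 * q.eval x.1.n by
          have := x.2.size_H_le; omega)
        omega)
  -- the output of the algorithm, for `B = q(n)` and `Δ = h = e = w(n)`
  choose o L hcomp hmem hstr hK hdesc hsimu using hex
  let y : {x : Inst d // x.Admissible F q} → Inst d' := fun x =>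
    outInst x.1 (o x) (fun s hs => targets_nodup (hdesc x) hs) K (hWpos x)
  have hy : PolyTime y := by
    have hraw : PolyTime (fun x : {x : Inst d // x.Admissible F q} => x.1.raw) :=
      .recode fun x => x.1.enc_raw.symm
    have hn : PolyTime (fun x : {x : Inst d // x.Admissible F q} => x.1.n) :=
      hraw.fst.fst.length.congr fun x => by simp [Inst.raw, LocalOp.raw]
    have hH : ∀ x : {x : Inst d // x.Admissible F q}, x.1.H.enc.size ≤ sz x := fun x => by
      change _ ≤ x.1.enc.size
      simp only [Inst.enc, encList, Val.size]; omega
    have hwb : PolyBdd (fun x : {x : Inst d // x.Admissible F q} => w.eval x.1.n) :=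
      (PolyBdd.sz.mono fun x => x.1.H.qudits_le_size.trans (hH x)).eval w
    have hW := hn.polyEval w
    have hrun : PolyTime (fun x => (o x).raw) :=
      (hraw.fst.pair (hW.pair (hW.pair (hW.pair (.const ()))))).run S
        (fun x => by
          have h1 := hcomp x
          rw [← (o x).enc_raw, ← x.1.H.enc_raw] at h1
          exact h1)
        (((((PolyBdd.sz.mono fun x => by rw [x.1.H.enc_raw]; exact hH x).add hwb).add hwb).add
          hwb).eval time)
    refine ((polyTime_rawOut hd0 K (K * d')).comp
      (hraw.pair (hrun.pair hW))).transport id (fun _ => rfl) fun x => ?_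
    exact (Inst.enc_raw _).symm.trans (congrArg Word.enc (outInst_raw hd hd0' x.1 (o x)
      (fun s hs => targets_nodup (hdesc x) hs) (hWpos x)
      (fun j => length_tgt_le (hdesc x) (hK x) j)))
  obtain ⟨U, hU⟩ := hy.sz_bdd
  obtain ⟨R, g, ⟨T, hT⟩, hR⟩ := hy
  have hRT : ∀ x, R.Computes x.1.enc (y x).enc (T.eval x.1.enc.size) := fun x => by
    obtain ⟨t, ht, he⟩ := hR x
    exact ⟨t, ht.trans (hT x), he⟩
  have hadm : ∀ x, (y x).Admissible F' (outPoly d' K U threshold strength q) := fun x =>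
    outInst_admissible hd hd0' x.2 (hmem x) (hK x) (hdesc x) (hstr x) (hU x)
  refine ⟨R, outPoly d' K U threshold strength q, T, K, ⟨T, ?_, ?_⟩, ?_⟩
  · rintro v ⟨x, rfl, hx, hyes⟩
    exact ⟨_, ⟨y ⟨x, hx⟩, rfl, hadm _, outInst_yes hd hd0' hx (hK ⟨x, hx⟩) (hdesc ⟨x, hx⟩)
      (hsimu ⟨x, hx⟩) (hWq ⟨x, hx⟩) hyes⟩, hRT ⟨x, hx⟩⟩
  · rintro v ⟨x, rfl, hx, hno⟩
    exact ⟨_, ⟨y ⟨x, hx⟩, rfl, hadm _, outInst_no hd hd0' hx (hK ⟨x, hx⟩) (hdesc ⟨x, hx⟩)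
      (hsimu ⟨x, hx⟩) (hWq ⟨x, hx⟩) hno⟩, hRT ⟨x, hx⟩⟩
  · intro x hx
    have hN1 := hx.one_le
    have hWx := hWq ⟨x, hx⟩
    have hdx := hdesc ⟨x, hx⟩
    have hW0 := hWpos ⟨x, hx⟩
    dsimp only at hWx hdx hW0
    have hN' : (1 : ℝ) ≤ (q.eval x.n : ℕ) := by exact_mod_cast hN1
    have hWx' : 75 * ((q.eval x.n : ℕ) : ℝ) ^ (boundExp d' K + 4) ≤ (w.eval x.n : ℕ) := by
      exact_mod_cast hWx
    have hW1 : (1 : ℝ) ≤ (w.eval x.n : ℕ) := by exact_mod_cast hW0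
    have hpow : ((q.eval x.n : ℕ) : ℝ) ^ (boundExp d' K + 2) ≤
        ((q.eval x.n : ℕ) : ℝ) ^ (boundExp d' K + 4) := pow_le_pow_right₀ hN' (by omega)
    have hNpow : ((q.eval x.n : ℕ) : ℝ) ≤ ((q.eval x.n : ℕ) : ℝ) ^ (boundExp d' K + 4) :=
      le_self_pow₀ hN' (by omega)
    have hNW : ((q.eval x.n : ℕ) : ℝ) ≤ (w.eval x.n : ℕ) := by linarith
    have hη : 1 / ((w.eval x.n : ℕ) : ℝ) ≤ 1 / ((q.eval x.n : ℕ) : ℝ) :=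
      one_div_le_one_div_of_le (by linarith) hNW
    have hη0 : 0 < 1 / ((w.eval x.n : ℕ) : ℝ) := by positivity
    have hη1 : 1 / ((w.eval x.n : ℕ) : ℝ) ≤ 1 := by rw [div_le_one (by linarith)]; exact hW1
    refine ⟨y ⟨x, hx⟩, hRT ⟨x, hx⟩, hadm _, fun k₀ h => (LocalOp.locality_le_iff _).2 h, le_rfl,
      Frac.val_third _ _, (Frac.val_third _ _).trans (by ring), L ⟨x, hx⟩, (w.eval x.n : ℕ),
      1 / ((w.eval x.n : ℕ) : ℝ), 1 / ((w.eval x.n : ℕ) : ℝ), hNW, hη0, hη, hη0, hη,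
      hK ⟨x, hx⟩, hsimu ⟨x, hx⟩, ?_⟩
    refine List.forall₂_map_right_iff.2 (List.forall₂_same.2 fun t ht => ⟨fun v hv => ?_, ?_⟩)
    · have hv' : v ∈ targets (o ⟨x, hx⟩).block t.supp := hv
      rw [targets_eq hdx] at hv'
      exact List.mem_flatMap.1 hv'
    · refine (outTerm_bounds hd hd0' hdx hη1 hη0.le (hK ⟨x, hx⟩) t _
        (hx.pow_le hd0 t ht) (hx.A_norm t ht)).2.trans ?_
      rw [mul_one_div, div_le_div_iff₀ (by linarith) (by linarith), one_mul]
      have : ((q.eval x.n : ℕ) : ℝ) ^ (boundExp d' K + 1) * (q.eval x.n : ℕ) =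
        ((q.eval x.n : ℕ) : ℝ) ^ (boundExp d' K + 2) := by ring
      rw [mul_assoc, this]
      linarith [pow_nonneg (zero_le_one.trans hN') (boundExp d' K + 4)]
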